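/- Let $X$ be a complex manifold of complex dimension $n$ with a smooth Hermitian metric $h$, let $S:X\to\mathbb C$ be holomorphic, $\theta\in\mathbb R$, and put $S_\theta=e^{-i\theta}S$, $F_\theta=\operatorname{Re}S_\theta$, $G_\theta=\operatorname{Im}S_\theta$. Let $\nabla_hF_\theta$ be the gradient with respect to the Riemannian metric $g_h=\operatorname{Re}h$, and let $p$ be a nondegenerate critical point of $S$. Let $\mathcal J_p^\theta$ (resp. $\mathcal K_p^\theta$) be the set of points $z_0\in X$ whose flow line $\dot z=-\nabla_hF_\theta(z)$, $z(0)=z_0$, exists for all $s\ge 0$ (resp. $s\le 0$) and converges to $p$ as $s\to+\infty$ (resp. $s\to-\infty$). For a neighbourhood $U$ of $p$, the local stable (resp. unstable) manifold of $p$ in $U$ consists of those $z_0\in\mathcal J_p^\theta$ (resp. $\mathcal K_p^\theta$) whose forward (resp. backward) flow line also stays in $U$. Call a holomorphic chart $w=(w_1,\dots,w_n)$, $w_j=x_j+iy_j$, centered at $p$ an adapted Morse chart if $S_\theta=S_\theta(p)+\frac12\sum_j w_j^2$ on its domain and the Hermitian matrix $(h_{i\bar j}(p))$ of $h$ at $p$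 in these coordinates is real (for $n=1$ the last condition is automatic). **Proposition.** Adapted Morse charts at $p$ exist. In every adapted Morse chart there are $\varepsilon_0>0$ and $C^\infty$ maps $\psi_s,\psi_u$ from $\{v\in\mathbb R^n:|v|<\varepsilon_0\}$ to $\mathbb R^n$ with $\psi_s(0)=\psi_u(0)=0$ and $D\psi_s(0)=D\psi_u(0)=0$ such that the set $\{x+iy:|x|<\varepsilon_0,\ |y|<\varepsilon_0\}$ lies in the image of the chart and, for every $0<\varepsilon\le\varepsilon_0$, with $U_\varepsilon=\{x+iy:|x|<\varepsilon,\ |y|<\varepsilon\}$: 1. the local stable manifold of $p$ in $U_\varepsilon$ is the graph $\mathcal J_{p,\mathrm{loc}}^\theta=\{x+i\psi_s(x):|x|<\varepsilon\}$, the local unstable manifold of $p$ in $U_\varepsilon$ is the graph $\mathcal K_{p,\mathrm{loc}}^\theta=\{\psi_u(y)+iy:|y|<\varepsilon\}$, and these equal $\mathcal J_p^\theta\cap U_\varepsilon$ and $\mathcal K_p^\theta\cap U_\varepsilon$ respectively; 2. both are embedded smooth real submanifolds of $X$ of real dimension $n$ (half of $\dim_{\mathbb R}X=2n$); 3. in the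 chart, their tangent spaces at $p$ are $T_p\mathcal J_p^\theta=\mathbb R^n=\{y=0\}$ and $T_p\mathcal K_p^\theta=i\mathbb R^n=\{x=0\}$; 4. both are contained in the level set $\{G_\theta=G_\theta(p)\}$. -/

import Mathlib

open Set Filter Topology
open scoped Manifold ContDiff ComplexConjugate

/-- The model space `ℂⁿ` with its Euclidean norm. -/
abbrev CSpace (n : ℕ) : Type := EuclideanSpace ℂ (Fin n)

/-- The space `ℝⁿ` with its Euclidean norm. -/
abbrev RSpace (n : ℕ) : Type := EuclideanSpace ℝ (Fin n)

/-- The vector `x + i y` of `ℂⁿ`. -/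
def cvec {n : ℕ} (x y : RSpace n) : CSpace n :=
  WithLp.toLp 2 fun j => (x j : ℂ) + Complex.I * (y j : ℂ)

/-- The product neighbourhood `{x + i y : |x| < ε, |y| < ε}` of the origin of `ℂⁿ`. -/
def coordBall (n : ℕ) (ε : ℝ) : Set (CSpace n) :=
  {w | ∃ x y : RSpace n, ‖x‖ < ε ∧ ‖y‖ < ε ∧ w = cvec x y}

section Manifolds

variable {n : ℕ} {X : Type*} [TopologicalSpace X] [ChartedSpace (CSpace n) X]

/-- The holomorphic charts of the complex manifold `X`. -/
def holoCharts (n : ℕ) (X : Type*) [TopologicalSpace X] [ChartedSpace (CSpace n) X] :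
    Set (OpenPartialHomeomorph X (CSpace n)) :=
  IsManifold.maximalAtlas 𝓘(ℂ, CSpace n) ω X

/-- The coordinate vector field `∂/∂zʲ` of the chart `e`, at the point with coordinates `z`. -/
noncomputable def coordVec (e : OpenPartialHomeomorph X (CSpace n)) (j : Fin n) (z : CSpace n) :
    TangentSpace 𝓘(ℂ, CSpace n) (e.symm z) :=
  mfderiv 𝓘(ℂ, CSpace n) 𝓘(ℂ, CSpace n) e.symm z
    (EuclideanSpace.single j (1 : ℂ) : CSpace n)

/-- A smooth Hermitian metric: a positive definite Hermitian form on each tangent space, linear in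
the first and conjugate-linear in the second argument, whose coefficients
`h_{i j̄} = h(∂/∂zⁱ, ∂/∂zʲ)` in every holomorphic chart are smooth functions. -/
structure HermitianMetric (n : ℕ) (X : Type*) [TopologicalSpace X]
    [ChartedSpace (CSpace n) X] where
  form : ∀ x : X, TangentSpace 𝓘(ℂ, CSpace n) x →ₗ[ℂ] TangentSpace 𝓘(ℂ, CSpace n) x →ₗ⋆[ℂ] ℂ
  conj_symm : ∀ x v w, form x v w = conj (form x w v)
  pos : ∀ x v, v ≠ 0 → 0 < (form x v v).re
  smooth : ∀ e ∈ holoCharts n X, ∀ i j : Fin n,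
    ContDiffOn ℝ ∞ (fun z => form (e.symm z) (coordVec e i z) (coordVec e j z)) e.target

/-- The coefficient `h_{i j̄}` of the metric in the chart `e`, as a function of the coordinates. -/
noncomputable def HermitianMetric.coeff (h : HermitianMetric n X)
    (e : OpenPartialHomeomorph X (CSpace n)) (i j : Fin n) (z : CSpace n) : ℂ :=
  h.form (e.symm z) (coordVec e i z) (coordVec e j z)

/-- The underlying Riemannian metric `g_h = Re h`. -/
noncomputable def HermitianMetric.riem (h : HermitianMetric n X) (x : X)
    (v w : TangentSpace 𝓘(ℝ, CSpace n) x) : ℝ :=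
  (h.form x v w).re

/-- Riesz representation for the Riemannian metric `Re h`. -/
theorem HermitianMetric.exists_riesz (h : HermitianMetric n X) (x : X)
    (L : TangentSpace 𝓘(ℝ, CSpace n) x →L[ℝ] ℝ) :
    ∃ v : TangentSpace 𝓘(ℝ, CSpace n) x, ∀ ξ, h.riem x v ξ = L ξ := by
  let B : CSpace n →ₗ[ℂ] CSpace n →ₗ⋆[ℂ] ℂ := h.form x
  have smul_one : ∀ (r : ℝ) (v : CSpace n), r • v = (r : ℂ) • v := fun r v => by
    ext j; simp
  let T : CSpace n →ₗ[ℝ] Module.Dual ℝ (CSpace n) :=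
    LinearMap.mk₂ ℝ (fun v w => (B v w).re) (by intros; simp)
      (by intros; rw [smul_one]; simp) (by intros; simp)
      (by intro c v w; rw [smul_one, (B v).map_smulₛₗ]; simp)
  have hT : Function.Injective T := by
    rw [injective_iff_map_eq_zero]
    intro v hv
    by_contra hne
    have h1 := h.pos x v hne
    have h2 : (B v v).re = 0 := by
      have := LinearMap.congr_fun hv v
      simpa [T] using this
    exact absurd h2 h1.ne'
  have hS : Function.Surjective T :=
    (LinearMap.injective_iff_surjective_of_finrank_eq_finrank
      (Subspace.dual_finrank_eq (K := ℝ) (V := CSpace n)).symm).1 hT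
  obtain ⟨v, hv⟩ := hS (show Module.Dual ℝ (CSpace n) from L.toLinearMap)
  exact ⟨v, fun ξ => LinearMap.congr_fun hv ξ⟩

/-- The gradient of a real function, characterized by `g_h(∇f, ξ) = df(ξ)`. -/
noncomputable def HermitianMetric.gradient (h : HermitianMetric n X) (f : X → ℝ) (x : X) :
    TangentSpace 𝓘(ℝ, CSpace n) x :=
  Classical.choose (h.exists_riesz x (mfderiv 𝓘(ℝ, CSpace n) 𝓘(ℝ, ℝ) f x))

theorem HermitianMetric.riem_gradient (h : HermitianMetric n X) (f : X → ℝ) (x : X)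
    (ξ : TangentSpace 𝓘(ℝ, CSpace n) x) :
    h.riem x (h.gradient f x) ξ = mfderiv 𝓘(ℝ, CSpace n) 𝓘(ℝ, ℝ) f x ξ :=
  Classical.choose_spec (h.exists_riesz x (mfderiv 𝓘(ℝ, CSpace n) 𝓘(ℝ, ℝ) f x)) ξ

/-- The rotated action `S_θ = e^{-iθ} S`. -/
noncomputable def rotAction {X : Type*} (S : X → ℂ) (θ : ℝ) (x : X) : ℂ :=
  Complex.exp (-(Complex.I * (θ : ℂ))) * S x

/-- `F_θ = Re S_θ`. -/
noncomputable def actionRe {X : Type*} (S : X → ℂ) (θ : ℝ) (x : X) : ℝ := (rotAction S θ x).re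

/-- `G_θ = Im S_θ`. -/
noncomputable def actionIm {X : Type*} (S : X → ℂ) (θ : ℝ) (x : X) : ℝ := (rotAction S θ x).im

/-- `p` is a critical point of `S` whose complex Hessian (in the preferred chart at `p`) is a
nondegenerate bilinear form. -/
def IsNondegCritPt (n : ℕ) {X : Type*} [TopologicalSpace X] [ChartedSpace (CSpace n) X]
    (S : X → ℂ) (p : X) : Prop :=
  mfderiv 𝓘(ℂ, CSpace n) 𝓘(ℂ, ℂ) S p = 0 ∧
  ∀ v : CSpace n,
    (∀ w : CSpace n, fderiv ℂ (fderiv ℂ (S ∘ (chartAt (CSpace n) p).symm))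
      (chartAt (CSpace n) p p) v w = 0) → v = 0

/-- `γ` is, on the time set `T`, a solution of `dz/ds = -∇_h F_θ(z)`. -/
def IsFlowLineOn (h : HermitianMetric n X) (S : X → ℂ) (θ : ℝ) (γ : ℝ → X) (T : Set ℝ) : Prop :=
  IsMIntegralCurveOn (I := 𝓘(ℝ, CSpace n)) γ (fun x => -h.gradient (actionRe S θ) x) T

/-- The (global) stable manifold `𝒥_p^θ` of `p` for `-∇_h F_θ`. -/
def stableSet (h : HermitianMetric n X) (S : X → ℂ) (θ : ℝ) (p : X) : Set X :=
  {z₀ | ∃ γ : ℝ → X, γ 0 = z₀ ∧ IsFlowLineOn h S θ γ (Ici 0) ∧ Tendsto γ atTop (𝓝 p)}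

/-- The (global) unstable manifold `𝒦_p^θ` of `p` for `-∇_h F_θ`. -/
def unstableSet (h : HermitianMetric n X) (S : X → ℂ) (θ : ℝ) (p : X) : Set X :=
  {z₀ | ∃ γ : ℝ → X, γ 0 = z₀ ∧ IsFlowLineOn h S θ γ (Iic 0) ∧ Tendsto γ atBot (𝓝 p)}

/-- The local stable manifold in `U`: the points whose forward flow line stays in `U` and
converges to `p`. -/
def localStableSet (h : HermitianMetric n X) (S : X → ℂ) (θ : ℝ) (p : X) (U : Set X) : Set X :=
  {z₀ | ∃ γ : ℝ → X, γ 0 = z₀ ∧ IsFlowLineOn h S θ γ (Ici 0) ∧ (∀ s, 0 ≤ s → γ s ∈ U) ∧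
    Tendsto γ atTop (𝓝 p)}

/-- The local unstable manifold in `U`: the points whose backward flow line stays in `U` and
converges to `p`. -/
def localUnstableSet (h : HermitianMetric n X) (S : X → ℂ) (θ : ℝ) (p : X) (U : Set X) : Set X :=
  {z₀ | ∃ γ : ℝ → X, γ 0 = z₀ ∧ IsFlowLineOn h S θ γ (Iic 0) ∧ (∀ s, s ≤ 0 → γ s ∈ U) ∧
    Tendsto γ atBot (𝓝 p)}

/-- Holomorphic Morse coordinates for `S_θ` centered at `p`:
`S_θ(w) = S_θ(p) + ½ ∑ w_j²` on the domain of the chart. -/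
def IsMorseChart (S : X → ℂ) (θ : ℝ) (p : X) (e : OpenPartialHomeomorph X (CSpace n)) : Prop :=
  e ∈ holoCharts n X ∧ p ∈ e.source ∧ e p = 0 ∧
  ∀ q ∈ e.source, rotAction S θ q = rotAction S θ p + (1 / 2 : ℂ) * ∑ j, (e q j) ^ 2

/-- The matrix `(h_{i j̄})` of the metric at the center of the chart `e` is real. -/
def HermitianMetric.IsRealAtCenter (h : HermitianMetric n X)
    (e : OpenPartialHomeomorph X (CSpace n)) : Prop :=
  ∀ i j : Fin n, (h.coeff e i j 0).im = 0

/-- `A` is an embedded smooth real submanifold of `X` of dimension `d`: around each of its points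
there is a smooth (real) chart of `X` in which `A` is a `d`-dimensional real linear slice. -/
def IsRealSubmanifold (n : ℕ) {X : Type*} [TopologicalSpace X] [ChartedSpace (CSpace n) X]
    (d : ℕ) (A : Set X) : Prop :=
  ∀ q ∈ A, ∃ φ ∈ IsManifold.maximalAtlas 𝓘(ℝ, CSpace n) ∞ X, q ∈ φ.source ∧
    ∃ V : Submodule ℝ (CSpace n), Module.finrank ℝ V = d ∧
      φ '' (A ∩ φ.source) = φ.target ∩ (V : Set (CSpace n))

/-- The tangent vectors of `A ⊆ X` at `p`, in the coordinates of the chart `e` around `p`: the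
coordinate velocities at `p` of curves in `A` through `p`. -/
def coordTangent (e : OpenPartialHomeomorph X (CSpace n)) (A : Set X) (p : X) :
    Set (CSpace n) :=
  {w | ∃ γ : ℝ → X, γ 0 = p ∧ ContinuousAt γ 0 ∧ (∀ᶠ t in 𝓝 (0 : ℝ), γ t ∈ A) ∧
    HasDerivAt (fun t => e (γ t)) w 0}

/-- The disk `{x + i ψ(x) : |x| < ε}` in the coordinates `e`. -/
def stableDisk (e : OpenPartialHomeomorph X (CSpace n)) (ψ : RSpace n → RSpace n) (ε : ℝ) :
    Set X :=
  {q | ∃ x : RSpace n, ‖x‖ < ε ∧ q = e.symm (cvec x (ψ x))}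

/-- The disk `{ψ(y) + i y : |y| < ε}` in the coordinates `e`. -/
def unstableDisk (e : OpenPartialHomeomorph X (CSpace n)) (ψ : RSpace n → RSpace n) (ε : ℝ) :
    Set X :=
  {q | ∃ y : RSpace n, ‖y‖ < ε ∧ q = e.symm (cvec (ψ y) y)}

end Manifolds

/-! In a Morse chart the flow reads `z' = -(hᵀ)⁻¹ z̄`. At the centre of an adapted chart the matrix
is real, so real and imaginary parts decouple: the linearization is the saddle `(x, y) ↦ (-A x, A
y)`, where `A` is the inverse of a real positive definite matrix and hence coercive
(`exists_saddle_linearization`).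

The stable graph comes from the Lyapunov–Perron method (`exists_stable_graph`). After a cutoff of
the nonlinear part, bounded forward orbits are obtained from an equation `z = ι x + K (N z)` in a
space of bounded continuous functions. Here `K` is a bounded linear integral operator and `N` a
superposition operator, smooth with `DN(0) = 0`, so the inverse function theorem yields solutions
depending smoothly on `x`. A cone estimate shows that they converge to `0` and that every orbit
staying near `0` starts on the graph.

An orbit converging to `p` might a priori leave the box and return. This is excluded by `F_θ`, which
decreases along the flow to `F_θ(p)`: hence `‖y‖ ≤ ‖x‖` whenever the orbit is in the chart, and in
this cone `‖x‖` does not increase (`IsFlowLineOn.mem_closedBall`). So the global stable set meets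
each box exactly in the graph. On it `G_θ` is constant: `∑ z_j z_j'` is minus a Hermitian square,
hence real, so `Im ∑ z_j²` is conserved and equals its limit `0`.

Replacing `θ` by `θ + π` reverses the flow, and `-i w` is an adapted Morse chart for `θ + π` if `w`
is one for `θ`. The unstable statements are the stable ones in the rotated chart
(`exists_unstable_submanifold`).

Adapted charts exist because the Autonne–Takagi factorization (`exists_takagi_family_of_form`)
normalizes the Hessian and makes the metric real by a single linear change of coordinates. The
holomorphic Morse lemma (`exists_morse_chart`) then applies with a chart tangent to the identity,
which leaves the metric at `p` unchanged. Its chart is `z ↦ √M(z) z`, with `M(z)` an average of the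
Hessian along the ray to `z`. -/

/-! ### Holomorphic functions of several variables are analytic -/

section SeveralVariables

open Complex Metric

universe u

variable {E F : Type u} [NormedAddCommGroup E] [NormedSpace ℂ E] [NormedAddCommGroup F]
  [NormedSpace ℂ F]

/-- Cauchy estimate for the Fréchet derivative. -/
theorem norm_fderiv_le_of_norm_le_on_ball {f : E → F} {c : E} {R C : ℝ} (hR : 0 < R)
    (hd : DifferentiableOn ℂ f (ball c R)) (hC : ∀ z ∈ ball c R, ‖f z‖ ≤ C) :
    ‖fderiv ℂ f c‖ ≤ 2 * C / R := by
  refine Complex.norm_fderiv_le_div_of_mapsTo_ball hd (fun z hz => ?_) hR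
  rw [mem_closedBall, dist_eq_norm]
  have h1 := hC z hz
  have h2 := hC c (mem_ball_self hR)
  linarith [norm_sub_le (f z) (f c)]

/-- Cauchy's formula on the complex line through `z` in direction `v` gives `Df(z) v = (2πi)⁻¹ ∮ f(z
+ ζ v) ζ⁻² dζ`. The `z`-derivative of the integrand is bounded uniformly by the Cauchy estimate, so
one may differentiate under the integral. -/
theorem DifferentiableOn.fderiv_apply_of_isOpen [FiniteDimensional ℂ E] [FiniteDimensional ℂ F]
    {f : E → F} {U : Set E} (hU : IsOpen U) (hf : DifferentiableOn ℂ f U) (v : E) :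
    DifferentiableOn ℂ (fun z => fderiv ℂ f z v) U := by
  intro z₀ hz₀
  refine DifferentiableAt.differentiableWithinAt ?_
  have : CompleteSpace F := FiniteDimensional.complete ℂ F
  have : CompleteSpace E := FiniteDimensional.complete ℂ E
  have : ProperSpace E := FiniteDimensional.proper ℂ E
  have : ProperSpace (E →L[ℂ] F) := FiniteDimensional.proper ℂ _
  borelize E
  borelize F
  -- The factor 4 leaves room for three displacements of size at most `r`: from `z₀` to `z`, along
  -- `ζ v`, and inside the ball used for the Cauchy estimate.
  obtain ⟨r, hr, hrU⟩ : ∃ r > 0, closedBall z₀ (4 * r) ⊆ U := by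
    obtain ⟨r, hr, h⟩ := Metric.isOpen_iff.1 hU z₀ hz₀
    exact ⟨r / 8, by positivity, (closedBall_subset_ball (by linarith)).trans h⟩
  obtain ⟨C, hC⟩ := (isCompact_closedBall z₀ (4 * r)).exists_bound_of_continuousOn
    (hf.continuousOn.mono hrU)
  obtain ⟨R, hR, hRv⟩ : ∃ R > 0, R * ‖v‖ ≤ r := by
    refine ⟨r / (‖v‖ + 1), by positivity, ?_⟩
    rw [div_mul_eq_mul_div, div_le_iff₀ (by positivity)]
    nlinarith [norm_nonneg v]
  have hdist : ∀ z ∈ ball z₀ r, ∀ ζ : ℂ, ‖ζ‖ ≤ R → ball (z + ζ • v) r ⊆ ball z₀ (4 * r) := by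
    intro z hz ζ hζ u hu
    rw [mem_ball, dist_eq_norm] at *
    have h1 : ‖ζ • v‖ ≤ r := by
      rw [norm_smul]; exact (mul_le_mul_of_nonneg_right hζ (norm_nonneg v)).trans hRv
    have : u - z₀ = (u - (z + ζ • v)) + (z - z₀) + ζ • v := by abel
    rw [this]
    linarith [norm_add₃_le (a := u - (z + ζ • v)) (b := z - z₀) (c := ζ • v)]
  have hsub : ball z₀ (4 * r) ⊆ U := ball_subset_closedBall.trans hrU
  have hdiff : ∀ z ∈ ball z₀ r, ∀ ζ : ℂ, ‖ζ‖ ≤ R → DifferentiableAt ℂ f (z + ζ • v) := by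
    intro z hz ζ hζ
    exact (hf.mono hsub).differentiableAt
      (isOpen_ball.mem_nhds (hdist z hz ζ hζ (mem_ball_self hr)))
  have hbd : ∀ z ∈ ball z₀ r, ∀ ζ : ℂ, ‖ζ‖ ≤ R → ‖fderiv ℂ f (z + ζ • v)‖ ≤ 2 * C / r := by
    intro z hz ζ hζ
    exact norm_fderiv_le_of_norm_le_on_ball hr ((hf.mono hsub).mono (hdist z hz ζ hζ))
      (fun u hu => hC u (ball_subset_closedBall (hdist z hz ζ hζ hu)))
  have hcm : ∀ t : ℝ, ‖circleMap 0 R t‖ ≤ R := fun t => by simp [abs_of_pos hR]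
  let k : ℝ → ℂ := fun t => _root_.deriv (circleMap 0 R) t * (1 / (circleMap 0 R t) ^ 2)
  have hk : Continuous k := by
    have h0 : ∀ t, (circleMap 0 R t) ^ 2 ≠ 0 := fun t => pow_ne_zero _ (circleMap_ne_center hR.ne')
    simp only [k, deriv_circleMap]
    have := continuous_circleMap 0 R
    fun_prop (disch := exact h0)
  have hmap : ∀ z : E, Continuous fun t : ℝ => z + circleMap 0 R t • v := fun z => by
    have := continuous_circleMap 0 R
    fun_prop
  have hFc : ∀ z ∈ ball z₀ r, Continuous fun t => k t • f (z + circleMap 0 R t • v) := by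
    intro z hz
    refine hk.smul (continuous_iff_continuousAt.2 fun t => ?_)
    exact ContinuousAt.comp (f := fun t : ℝ => z + circleMap 0 R t • v)
      (hdiff z hz _ (hcm t)).continuousAt (hmap z).continuousAt
  have key : HasFDerivAt (fun z => ∫ t in (0 : ℝ)..2 * Real.pi,
      k t • f (z + circleMap 0 R t • v))
      (∫ t in (0 : ℝ)..2 * Real.pi, k t • fderiv ℂ f (z₀ + circleMap 0 R t • v)) z₀ := by
    refine intervalIntegral.hasFDerivAt_integral_of_dominated_of_fderiv_le
      (F' := fun z t => k t • fderiv ℂ f (z + circleMap 0 R t • v))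
      (bound := fun t => ‖k t‖ * (2 * C / r)) (ball_mem_nhds z₀ hr) ?_ ?_ ?_ ?_ ?_ ?_
    · filter_upwards [ball_mem_nhds z₀ hr] with z hz
      exact (hFc z hz).aestronglyMeasurable
    · exact (hFc z₀ (mem_ball_self hr)).intervalIntegrable _ _
    -- Continuity of the derivative is not yet known at this stage; its measurability suffices.
    · refine hk.aestronglyMeasurable.smul ?_
      have := (measurable_fderiv ℂ f).comp (hmap z₀).measurable
      exact this.aestronglyMeasurable
    · refine .of_forall fun t _ z hz => ?_
      rw [norm_smul]
      exact mul_le_mul_of_nonneg_left (hbd z hz _ (hcm t)) (norm_nonneg _)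
    · exact (hk.norm.mul continuous_const).intervalIntegrable _ _
    · refine .of_forall fun t _ z hz => ?_
      have h1 : HasFDerivAt (fun z : E => z + circleMap 0 R t • v) (.id ℂ E) z :=
        (hasFDerivAt_id z).add_const _
      have := ((hdiff z hz _ (hcm t)).hasFDerivAt.comp z h1).const_smul (k t)
      rw [ContinuousLinearMap.comp_id] at this
      exact this
  have heq : (fun z => fderiv ℂ f z v) =ᶠ[𝓝 z₀] fun z => (2 * Real.pi * I : ℂ)⁻¹ •
      ∫ t in (0 : ℝ)..2 * Real.pi, k t • f (z + circleMap 0 R t • v) := by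
    filter_upwards [ball_mem_nhds z₀ hr] with z hz
    have hd : ∀ ζ ∈ closedBall (0 : ℂ) R, DifferentiableAt ℂ (fun ζ : ℂ => f (z + ζ • v)) ζ := by
      intro ζ hζ
      exact (hdiff z hz ζ (by simpa using hζ)).comp ζ (f := fun ζ : ℂ => z + ζ • v) (by fun_prop)
    have h1 : DiffContOnCl ℂ (fun ζ : ℂ => f (z + ζ • v)) (ball 0 R) := by
      refine DifferentiableOn.diffContOnCl fun ζ hζ => (hd ζ ?_).differentiableWithinAt
      rwa [closure_ball _ hR.ne'] at hζ
    have h2 := h1.deriv_eq_smul_circleIntegral hR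
    have h3 := DifferentiableAt.deriv_comp_add_smul (𝕜 := ℂ) (f := f) (x := z) (y := v) (t := 0)
      (hdiff z hz 0 (by simpa using hR.le))
    rw [h3] at h2
    rw [circleIntegral] at h2
    simp only [sub_zero, zero_smul, add_zero, smul_smul] at h2
    simp only [k, h2]
    rw [smul_smul, inv_mul_cancel₀ (by simp [Real.pi_ne_zero]), one_smul]
  exact (key.differentiableAt.const_smul ((2 * Real.pi * I : ℂ)⁻¹)).congr_of_eventuallyEq heq

theorem DifferentiableOn.fderiv_of_isOpen [FiniteDimensional ℂ E] [FiniteDimensional ℂ F]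
    {f : E → F} {U : Set E} (hU : IsOpen U) (hf : DifferentiableOn ℂ f U) :
    DifferentiableOn ℂ (fderiv ℂ f) U := by
  let b := Module.finBasis ℂ E
  have h : fderiv ℂ f = fun z => ∑ i, (LinearMap.toContinuousLinearMap (b.coord i)).smulRight
      (fderiv ℂ f z (b i)) := by
    funext z
    refine ContinuousLinearMap.coe_injective (b.ext fun j => ?_)
    simp [Finsupp.single_apply, ite_smul]
  rw [h]
  refine DifferentiableOn.fun_sum fun i _ => ?_
  have := hf.fderiv_apply_of_isOpen hU (b i)
  exact (ContinuousLinearMap.smulRightL ℂ E F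
    (LinearMap.toContinuousLinearMap (b.coord i))).differentiable.comp_differentiableOn this

theorem DifferentiableOn.contDiffOn_infty_of_isOpen [FiniteDimensional ℂ E]
    [FiniteDimensional ℂ F] {f : E → F} {U : Set E} (hU : IsOpen U)
    (hf : DifferentiableOn ℂ f U) : ContDiffOn ℂ ∞ f U := by
  refine contDiffOn_infty.2 fun k => ?_
  induction k generalizing F with
  | zero => exact contDiffOn_zero.2 hf.continuousOn
  | succ k ih =>
    push_cast
    rw [contDiffOn_succ_iff_fderiv_of_isOpen hU]
    exact ⟨hf, by simp, ih (hf.fderiv_of_isOpen hU)⟩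

/-- By the Cauchy estimate each derivative costs a radius `δ` and a factor `2 / δ`. The bound at `c`
is a separate hypothesis because the ball is empty for `k = 0`. -/
theorem norm_iteratedFDeriv_le_of_norm_le_on_ball {f : E → F} {c : E} {δ M : ℝ} (hδ : 0 < δ)
    (k : ℕ) (hd : ContDiffOn ℂ ∞ f (ball c (k * δ))) (hM : ∀ z ∈ ball c (k * δ), ‖f z‖ ≤ M)
    (hM0 : ‖f c‖ ≤ M) :
    ‖iteratedFDeriv ℂ k f c‖ ≤ M * (2 / δ) ^ k := by
  induction k generalizing c with
  | zero => simpa using hM0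
  | succ k ih =>
    have hsub : ∀ z ∈ ball c δ, ball z (k * δ) ⊆ ball c ((k + 1 : ℕ) * δ) := by
      intro z hz
      refine ball_subset_ball' ?_
      rw [mem_ball] at hz
      push_cast; linarith
    have hb : ∀ z ∈ ball c δ, ‖iteratedFDeriv ℂ k f z‖ ≤ M * (2 / δ) ^ k := by
      intro z hz
      refine ih (hd.mono (hsub z hz)) (fun u hu => hM u (hsub z hz hu)) (hM z ?_)
      refine ball_subset_ball ?_ hz
      push_cast
      nlinarith [(Nat.cast_nonneg k : (0 : ℝ) ≤ k)]
    rw [← norm_fderiv_iteratedFDeriv]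
    refine (norm_fderiv_le_of_norm_le_on_ball hδ ?_ hb).trans_eq (by rw [pow_succ]; ring)
    intro z hz
    refine DifferentiableAt.differentiableWithinAt ?_
    refine ContDiffAt.differentiableAt_iteratedFDeriv (n := ∞) (hd.contDiffAt ?_) ?_
    · refine isOpen_ball.mem_nhds (ball_subset_ball ?_ hz)
      push_cast
      nlinarith [(Nat.cast_nonneg k : (0 : ℝ) ≤ k)]
    · exact_mod_cast WithTop.coe_lt_top _

/-- A holomorphic function of several variables is analytic. -/
theorem DifferentiableOn.analyticOnNhd_of_isOpen [FiniteDimensional ℂ E] [FiniteDimensional ℂ F]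
    {f : E → F} {U : Set E} (hU : IsOpen U) (hf : DifferentiableOn ℂ f U) :
    AnalyticOnNhd ℂ f U := by
  intro c hc
  have : CompleteSpace F := FiniteDimensional.complete ℂ F
  have : ProperSpace E := FiniteDimensional.proper ℂ E
  have hsm := hf.contDiffOn_infty_of_isOpen hU
  obtain ⟨r, hr, hrU⟩ : ∃ r > 0, closedBall c r ⊆ U := by
    obtain ⟨r, hr, h⟩ := Metric.isOpen_iff.1 hU c hc
    exact ⟨r / 2, by positivity, (closedBall_subset_ball (by linarith)).trans h⟩
  obtain ⟨M, hM⟩ := (isCompact_closedBall c r).exists_bound_of_continuousOn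
    (hf.continuousOn.mono hrU)
  have hM0 : 0 ≤ M := (norm_nonneg _).trans (hM c (mem_closedBall_self hr.le))
  have hbr : ball c r ⊆ U := ball_subset_closedBall.trans hrU
  have hbound : ∀ k : ℕ, ‖iteratedFDeriv ℂ k f c‖ ≤ M * (2 * k / r) ^ k := by
    intro k
    rcases Nat.eq_zero_or_pos k with rfl | hk
    · simpa using hM c (mem_closedBall_self hr.le)
    have hk' : (0 : ℝ) < k := by exact_mod_cast hk
    have hkr : (k : ℝ) * (r / k) = r := by field_simp
    -- The available radius is divided into `k` equal steps.
    have := norm_iteratedFDeriv_le_of_norm_le_on_ball (f := f) (c := c) (δ := r / k) (M := M)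
      (by positivity) k (by rw [hkr]; exact hsm.mono hbr)
      (by rw [hkr]; exact fun z hz => hM z (ball_subset_closedBall hz))
      (hM c (mem_closedBall_self hr.le))
    rwa [div_div_eq_mul_div] at this
  let q : FormalMultilinearSeries ℂ E F := fun k => ((k.factorial : ℂ)⁻¹) • iteratedFDeriv ℂ k f c
  -- Since `k ^ k / k! ≤ e ^ k`, the `k`-th Taylor coefficient is at most `M (2e / r) ^ k`, which
  -- dictates this radius.
  let s : NNReal := ⟨r / (2 * Real.exp 1), by positivity⟩
  have hs : (s : ℝ) = r / (2 * Real.exp 1) := rfl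
  have hs0 : 0 < (s : ℝ) := by rw [hs]; positivity
  have hsr : (s : ℝ) ≤ r := by
    rw [hs, div_le_iff₀ (by positivity)]
    nlinarith [Real.add_one_le_exp (1 : ℝ)]
  have hrad : (s : ENNReal) ≤ q.radius := by
    refine q.le_radius_of_bound M fun k => ?_
    have h1 : ‖q k‖ = (k.factorial : ℝ)⁻¹ * ‖iteratedFDeriv ℂ k f c‖ := by
      simp only [q, norm_smul, norm_inv, Complex.norm_natCast]
    have h2 : (k : ℝ) ^ k / k.factorial ≤ Real.exp k :=
      Real.pow_div_factorial_le_exp _ (Nat.cast_nonneg k) k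
    have h3 : Real.exp k = Real.exp 1 ^ k := by rw [← Real.exp_nat_mul, mul_one]
    rw [h1]
    calc (k.factorial : ℝ)⁻¹ * ‖iteratedFDeriv ℂ k f c‖ * (s : ℝ) ^ k
        ≤ (k.factorial : ℝ)⁻¹ * (M * (2 * k / r) ^ k) * (s : ℝ) ^ k := by
          gcongr; exact hbound k
      _ = M * ((k : ℝ) ^ k / k.factorial) * ((2 / r) * s) ^ k := by
          rw [mul_pow, div_pow, div_pow, mul_pow]; ring
      _ ≤ M * Real.exp 1 ^ k * ((2 / r) * s) ^ k := by
          rw [← h3]; gcongr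
      _ = M := by
          rw [hs, mul_assoc, ← mul_pow]
          have : Real.exp 1 * (2 / r * (r / (2 * Real.exp 1))) = 1 := by
            field_simp
          rw [this, one_pow, mul_one]
  refine ⟨q, s, hrad, by exact_mod_cast hs0, fun {y} hy => ?_⟩
  have hy' : ‖y‖ < s := by simpa [Metric.eball_coe] using hy
  have hyr : ‖y‖ < r := hy'.trans_le hsr
  -- Taylor expansion on the complex line through `c` in direction `y`
  obtain ⟨ρ, hρ1, hρ⟩ : ∃ ρ : ℝ, 1 < ρ ∧ ρ * ‖y‖ ≤ r := by
    rcases eq_or_lt_of_le (norm_nonneg y) with h0 | h0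
    · exact ⟨2, by norm_num, by rw [← h0]; simpa using hr.le⟩
    · exact ⟨r / ‖y‖, (one_lt_div h0).2 hyr, (div_mul_cancel₀ _ h0.ne').le⟩
  have hline : ∀ t ∈ ball (0 : ℂ) ρ, c + t • y ∈ U := by
    intro t ht
    rcases eq_or_ne y 0 with rfl | h0
    · simpa using hc
    refine hbr ?_
    rw [mem_ball, dist_eq_norm, add_sub_cancel_left, norm_smul]
    refine lt_of_lt_of_le ?_ hρ
    exact mul_lt_mul_of_pos_right (by simpa using ht) (norm_pos_iff.2 h0)
  -- The one-variable Taylor series of `t ↦ f (c + t y)` has the terms of `q` on the diagonal at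
  -- `y`. It is evaluated at `t = 1`, which lies in the disc because `ρ > 1`.
  have hiter : ∀ k : ℕ, ∀ t ∈ ball (0 : ℂ) ρ, iteratedDeriv k (fun t : ℂ => f (c + t • y)) t =
      iteratedFDeriv ℂ k f (c + t • y) (fun _ => y) := by
    intro k
    induction k with
    | zero => intro t ht; simp
    | succ k ih =>
      intro t ht
      have hat : ContDiffAt ℂ (k + 1) f (c + t • y) :=
        (hsm.contDiffAt (hU.mem_nhds (hline t ht))).of_le (by exact_mod_cast le_top)
      rw [iteratedDeriv_succ, ← hat.deriv_fderiv_add_smul]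
      refine EventuallyEq.deriv_eq ?_
      filter_upwards [isOpen_ball.mem_nhds ht] with u hu using ih u hu
  have hd1 : DifferentiableOn ℂ (fun t : ℂ => f (c + t • y)) (ball 0 ρ) :=
    hf.comp (by fun_prop) hline
  have hsum := Complex.hasSum_taylorSeries_on_ball hd1 (z := 1) (by simpa using hρ1)
  simp only [sub_zero, one_pow, one_smul] at hsum
  convert hsum using 2 with k
  rw [hiter k 0 (mem_ball_self (by linarith))]
  simp [q]

end SeveralVariables


/-! ### Smoothness of superposition operators on bounded continuous functions -/

section Superposition

open BoundedContinuousFunction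

universe u

variable {T : Type*} [TopologicalSpace T]
variable {P F : Type u} [NormedAddCommGroup P] [NormedSpace ℝ P]
  [NormedAddCommGroup F] [NormedSpace ℝ F]

/-- Pointwise application of bounded operator-valued functions to bounded functions. -/
noncomputable def BoundedContinuousFunction.pointwiseApply :
    (T →ᵇ (P →L[ℝ] F)) →L[ℝ] (T →ᵇ P) →L[ℝ] (T →ᵇ F) :=
  LinearMap.mkContinuous₂
    (LinearMap.mk₂ ℝ (fun (A : T →ᵇ (P →L[ℝ] F)) (z : T →ᵇ P) =>
      BoundedContinuousFunction.ofNormedAddCommGroup (fun t => A t (z t))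
        (A.continuous.clm_apply z.continuous) (‖A‖ * ‖z‖)
        (fun t => ((A t).le_opNorm _).trans (mul_le_mul (A.norm_coe_le_norm t)
          (z.norm_coe_le_norm t) (norm_nonneg (z t)) (norm_nonneg A))))
      (by intros; ext; simp) (by intros; ext; simp) (by intros; ext; simp) (by intros; ext; simp))
    1 (fun A z => by
      rw [one_mul]
      exact (BoundedContinuousFunction.norm_le (mul_nonneg (norm_nonneg A) (norm_nonneg z))).2
        fun t => ((A t).le_opNorm _).trans (mul_le_mul (A.norm_coe_le_norm t)
          (z.norm_coe_le_norm t) (norm_nonneg (z t)) (norm_nonneg A)))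

@[simp]
theorem BoundedContinuousFunction.pointwiseApply_apply (A : T →ᵇ (P →L[ℝ] F)) (z : T →ᵇ P) (t : T) :
    pointwiseApply A z t = A t (z t) := rfl

theorem exists_boundedContinuousFunction_of_hasCompactSupport {P F : Type*}
    [NormedAddCommGroup P] [NormedAddCommGroup F] {g : P → F} (hg : Continuous g)
    (hc : HasCompactSupport g) : ∃ G : P →ᵇ F, ∀ x, G x = g x := by
  obtain ⟨C, hC⟩ := hc.exists_bound_of_continuous hg
  exact ⟨BoundedContinuousFunction.ofNormedAddCommGroup g hg C hC, fun x => rfl⟩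

/-- Mean value inequality for `g - Dg(x)` on the ball of radius `‖y - x‖`; the factor `1 / 2` of
Taylor's formula is not needed. -/
theorem norm_sub_sub_fderiv_le {g : P → F} (hg : Differentiable ℝ g) {C : NNReal}
    (hL : LipschitzWith C (fderiv ℝ g)) (x y : P) :
    ‖g y - g x - fderiv ℝ g x (y - x)‖ ≤ C * ‖y - x‖ * ‖y - x‖ := by
  refine (convex_closedBall x ‖y - x‖).norm_image_sub_le_of_norm_hasFDerivWithin_le'
    (f := g) (f' := fderiv ℝ g) (fun z _ => (hg z).hasFDerivAt.hasFDerivWithinAt) (fun z hz => ?_)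
    (Metric.mem_closedBall_self (norm_nonneg _)) (by simp [dist_eq_norm])
  refine (hL.norm_sub_le z x).trans (mul_le_mul_of_nonneg_left ?_ C.2)
  simpa [dist_eq_norm] using hz

/-- Derivative of the superposition operator. -/
theorem hasFDerivAt_superposition [FiniteDimensional ℝ P] (G : P →ᵇ F) (hG : ContDiff ℝ ∞ G)
    (hc : HasCompactSupport G) (DG : P →ᵇ (P →L[ℝ] F)) (hDG : ∀ x, DG x = fderiv ℝ G x)
    (z : T →ᵇ P) :
    HasFDerivAt (fun z : T →ᵇ P => G.compContinuous z.toContinuousMap)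
      (BoundedContinuousFunction.pointwiseApply (DG.compContinuous z.toContinuousMap)) z := by
  have hcont : ContDiff ℝ ∞ (fderiv ℝ G) := hG.fderiv_right (by simp)
  obtain ⟨C, hC⟩ := ContDiff.lipschitzWith_of_hasCompactSupport (hc.fderiv (𝕜 := ℝ)) hcont (by simp)
  rw [hasFDerivAt_iff_isLittleO]
  -- The pointwise Taylor remainder is at most `C ‖w - z‖ ^ 2` uniformly in `t`, so this bounds its
  -- sup norm.
  refine Asymptotics.IsBigO.trans_isLittleO (g := fun w => ‖w - z‖ * ‖w - z‖) ?_ ?_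
  · refine Asymptotics.IsBigO.of_bound C (.of_forall fun w => ?_)
    have h0 : (0 : ℝ) ≤ C * (‖w - z‖ * ‖w - z‖) := by positivity
    rw [norm_mul, norm_norm]
    refine (BoundedContinuousFunction.norm_le h0).2 fun t => ?_
    have h1 := norm_sub_sub_fderiv_le (hG.differentiable (by simp)) hC (z t) (w t)
    have h2 : ‖w t - z t‖ ≤ ‖w - z‖ := (w - z).norm_coe_le_norm t
    simp only [BoundedContinuousFunction.coe_sub, Pi.sub_apply,
      BoundedContinuousFunction.compContinuous_apply,
      BoundedContinuousFunction.pointwiseApply_apply, hDG]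
    refine h1.trans ?_
    rw [mul_assoc]
    gcongr
  · have h : Tendsto (fun w : T →ᵇ P => ‖w - z‖) (𝓝 z) (𝓝 0) := by
      have : Continuous fun w : T →ᵇ P => ‖w - z‖ := by fun_prop
      simpa using this.tendsto z
    have h1 := (Asymptotics.isLittleO_one_iff ℝ).2 h
    have := h1.mul_isBigO (Asymptotics.isBigO_refl (fun w : T →ᵇ P => ‖w - z‖) (𝓝 z))
    simp only [one_mul] at this
    exact this.trans_isBigO (Asymptotics.isBigO_refl _ _).norm_left

/-- The superposition operator of a compactly supported smooth function is smooth. -/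
theorem contDiff_superposition [FiniteDimensional ℝ P] (G : P →ᵇ F) (hG : ContDiff ℝ ∞ G)
    (hc : HasCompactSupport G) :
    ContDiff ℝ ∞ (fun z : T →ᵇ P => G.compContinuous z.toContinuousMap) := by
  refine contDiff_infty.2 fun k => ?_
  induction k generalizing F with
  | zero =>
    refine contDiff_zero.2 (continuous_iff_continuousAt.2 fun z => ?_)
    have hcont : ContDiff ℝ ∞ (fderiv ℝ G) := hG.fderiv_right (by simp)
    obtain ⟨DG, hDG⟩ := exists_boundedContinuousFunction_of_hasCompactSupport hcont.continuous
      (hc.fderiv (𝕜 := ℝ))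
    exact (hasFDerivAt_superposition G hG hc DG hDG z).continuousAt
  -- The derivative is the superposition operator of `fderiv ℝ G` followed by the bounded linear map
  -- `pointwiseApply`, so the induction has to let the target space `F` vary.
  | succ k ih =>
    have hcont : ContDiff ℝ ∞ (fderiv ℝ G) := hG.fderiv_right (by simp)
    obtain ⟨DG, hDG⟩ := exists_boundedContinuousFunction_of_hasCompactSupport hcont.continuous
      (hc.fderiv (𝕜 := ℝ))
    have hfun : (DG : P → (P →L[ℝ] F)) = fderiv ℝ G := funext hDG
    push_cast
    refine contDiff_succ_iff_hasFDerivAt.2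
      ⟨fun z => BoundedContinuousFunction.pointwiseApply (DG.compContinuous z.toContinuousMap), ?_,
        fun z => hasFDerivAt_superposition G hG hc DG hDG z⟩
    refine (BoundedContinuousFunction.pointwiseApply).contDiff.comp (ih DG ?_ ?_)
    · rwa [hfun]
    · rw [hfun]; exact hc.fderiv (𝕜 := ℝ)

end Superposition


/-! ### A Grönwall-type estimate -/

/-- A differential inequality `k f ≤ f'` gives exponential growth. -/
theorem mul_exp_le_of_hasDerivWithinAt {f f' : ℝ → ℝ} {k a b : ℝ} (hab : a ≤ b)
    (hf : ∀ t ∈ Icc a b, HasDerivWithinAt f (f' t) (Icc a b) t)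
    (h : ∀ t ∈ Icc a b, k * f t ≤ f' t) : f a * Real.exp (k * (b - a)) ≤ f b := by
  have hd : ∀ t ∈ Icc a b, HasDerivWithinAt (fun t => f t * Real.exp (-k * (t - a)))
      ((f' t - k * f t) * Real.exp (-k * (t - a))) (Icc a b) t := by
    intro t ht
    have h1 : HasDerivAt (fun t => Real.exp (-k * (t - a))) (Real.exp (-k * (t - a)) * (-k)) t := by
      have := (((hasDerivAt_id t).sub_const a).const_mul (-k)).exp
      simpa using this
    exact ((hf t ht).mul h1.hasDerivWithinAt).congr_deriv (by ring)
  have hmono : MonotoneOn (fun t => f t * Real.exp (-k * (t - a))) (Icc a b) := by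
    refine monotoneOn_of_hasDerivWithinAt_nonneg (convex_Icc a b)
      (fun t ht => (hd t ht).continuousWithinAt)
      (fun t ht => (hd t (interior_subset ht)).mono interior_subset) (fun t ht => ?_)
    exact mul_nonneg (sub_nonneg.2 (h t (interior_subset ht))) (Real.exp_pos _).le
  have := hmono (left_mem_Icc.2 hab) (right_mem_Icc.2 hab) hab
  simp only [sub_self, mul_zero, Real.exp_zero, mul_one] at this
  calc f a * Real.exp (k * (b - a))
      ≤ f b * Real.exp (-k * (b - a)) * Real.exp (k * (b - a)) := by gcongr
    _ = f b := by rw [mul_assoc, ← Real.exp_add]; simp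

/-! ### Linear flows and the two Lyapunov–Perron integral operators -/

section Semigroup

variable {E : Type*} [NormedAddCommGroup E] [InnerProductSpace ℝ E]

open scoped RealInnerProductSpace

/-- The one-parameter group generated by a bounded operator. -/
noncomputable def expGroup (A : E →L[ℝ] E) (t : ℝ) : E →L[ℝ] E := NormedSpace.exp (t • A)

theorem expGroup_zero (A : E →L[ℝ] E) : expGroup A 0 = 1 := by
  simp [expGroup, NormedSpace.exp_zero]

variable [CompleteSpace E]

theorem hasDerivAt_expGroup (A : E →L[ℝ] E) (t : ℝ) :
    HasDerivAt (expGroup A) (A * expGroup A t) t :=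
  hasDerivAt_exp_smul_const' A t

theorem expGroup_add (A : E →L[ℝ] E) (s t : ℝ) :
    expGroup A (s + t) = expGroup A s * expGroup A t := by
  let _ : NormedAlgebra ℚ (E →L[ℝ] E) := NormedAlgebra.restrictScalars ℚ ℝ _
  rw [expGroup, add_smul, NormedSpace.exp_add_of_commute]
  · rfl
  · exact ((Commute.refl A).smul_left s).smul_right t

theorem continuous_expGroup (A : E →L[ℝ] E) : Continuous (expGroup A) :=
  continuous_iff_continuousAt.2 fun t => (hasDerivAt_expGroup A t).continuousAt

theorem hasDerivAt_expGroup_neg (A : E →L[ℝ] E) (t : ℝ) :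
    HasDerivAt (fun t => expGroup A (-t)) (-(A * expGroup A (-t))) t := by
  have := HasDerivAt.scomp t (hasDerivAt_expGroup A (-t)) (hasDerivAt_neg t)
  exact this.congr_deriv (by simp)

/-- Energy estimate: `u(s) = e^{-sA} v` satisfies `(‖u‖²)' = -2⟪A u, u⟫ ≤ -2c ‖u‖²`. The growth
inequality is applied to `-‖u‖²` with rate `-2c`. -/
theorem norm_expGroup_neg_le {A : E →L[ℝ] E} {c : ℝ} (hA : ∀ v, c * ‖v‖ ^ 2 ≤ ⟪A v, v⟫) {t : ℝ}
    (ht : 0 ≤ t) : ‖expGroup A (-t)‖ ≤ Real.exp (-(c * t)) := by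
  refine ContinuousLinearMap.opNorm_le_bound _ (Real.exp_pos _).le fun v => ?_
  have hd : ∀ s : ℝ, HasDerivAt (fun s => expGroup A (-s) v) (-(A (expGroup A (-s) v))) s := by
    intro s
    have := (hasDerivAt_expGroup_neg A s).clm_apply (hasDerivAt_const s v)
    simpa using this
  have h := mul_exp_le_of_hasDerivWithinAt (f := fun s => -‖expGroup A (-s) v‖ ^ 2)
    (k := -(2 * c)) ht (fun s _ => (hd s).norm_sq.neg.hasDerivWithinAt) (fun s _ => by
      have := hA (expGroup A (-s) v)
      rw [inner_neg_right, real_inner_comm]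
      linarith)
  simp only [neg_zero, expGroup_zero, one_apply_eq_self, sub_zero] at h
  have h2 : Real.exp (-(2 * c) * t) = Real.exp (-(c * t)) ^ 2 := by
    rw [← Real.exp_nat_mul]; congr 1; push_cast; ring
  rw [h2] at h
  refine le_of_sq_le_sq ?_ (by positivity)
  rw [mul_pow]; linarith

open MeasureTheory BoundedContinuousFunction

variable {c : ℝ} (A : E →L[ℝ] E)

/-- The solution of `u' = -A u + g`, `u(0) = 0`, at time `t`. -/
noncomputable def forwardSolution (g : ℝ → E) (t : ℝ) : E :=
  expGroup A (-t) (∫ s in (0 : ℝ)..t, expGroup A s (g s))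

/-- The bounded solution of `w' = A w + g` on the half-line, at time `t`. -/
noncomputable def backwardSolution (g : ℝ → E) (t : ℝ) : E :=
  -expGroup A t ((∫ s in Ioi (0 : ℝ), expGroup A (-s) (g s)) -
    ∫ s in (0 : ℝ)..t, expGroup A (-s) (g s))

variable {A}

theorem hasDerivAt_forwardSolution {g : ℝ → E} (hg : Continuous g) (t : ℝ) :
    HasDerivAt (forwardSolution A g) (-A (forwardSolution A g t) + g t) t := by
  have hc : Continuous fun s => expGroup A s (g s) := (continuous_expGroup A).clm_apply hg
  have h1 := intervalIntegral.integral_hasDerivAt_right (hc.intervalIntegrable 0 t)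
    hc.aestronglyMeasurable.stronglyMeasurableAtFilter hc.continuousAt
  refine ((hasDerivAt_expGroup_neg A t).clm_apply h1).congr_deriv ?_
  have h2 : expGroup A (-t) (expGroup A t (g t)) = g t := by
    rw [← mul_apply_eq_comp, ← expGroup_add, neg_add_cancel, expGroup_zero]; rfl
  rw [h2]
  simp [forwardSolution]

theorem hasDerivAt_backwardSolution {g : ℝ → E} (hg : Continuous g) (t : ℝ) :
    HasDerivAt (backwardSolution A g) (A (backwardSolution A g t) + g t) t := by
  have hc : Continuous fun s => expGroup A (-s) (g s) :=
    ((continuous_expGroup A).comp continuous_neg).clm_apply hg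
  have h1 := intervalIntegral.integral_hasDerivAt_right (hc.intervalIntegrable 0 t)
    hc.aestronglyMeasurable.stronglyMeasurableAtFilter hc.continuousAt
  refine ((hasDerivAt_expGroup A t).clm_apply (h1.const_sub
    (∫ s in Ioi (0 : ℝ), expGroup A (-s) (g s)))).neg.congr_deriv ?_
  have h2 : expGroup A t (expGroup A (-t) (g t)) = g t := by
    rw [← mul_apply_eq_comp, ← expGroup_add, add_neg_cancel, expGroup_zero]; rfl
  rw [map_neg, h2]
  simp [backwardSolution]
  abel

theorem integral_exp_neg_mul_le (hc : 0 < c) (t : ℝ) :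
    ∫ s in (0 : ℝ)..t, Real.exp (-(c * (t - s))) ≤ 1 / c := by
  have h : ∀ s : ℝ, HasDerivAt (fun s => Real.exp (-(c * (t - s))) / c)
      (Real.exp (-(c * (t - s)))) s := by
    intro s
    have := ((((hasDerivAt_id s).const_sub t).const_mul c).neg.exp).div_const c
    exact this.congr_deriv (by simp; field_simp)
  rw [intervalIntegral.integral_eq_sub_of_hasDerivAt (fun s _ => h s)
    (Continuous.intervalIntegrable (by fun_prop) _ _)]
  simp only [sub_self, mul_zero, neg_zero, Real.exp_zero, one_div]
  have : 0 ≤ Real.exp (-(c * (t - 0))) / c := by positivity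
  linarith

/-- Duhamel's kernel `e^{-(t - s)A}` has norm at most `e^{-c(t - s)}`, whose integral over `[0, t]`
is at most `1 / c`. -/
theorem norm_forwardSolution_le (hc : 0 < c) (hA : ∀ v, c * ‖v‖ ^ 2 ≤ ⟪A v, v⟫) (g : ℝ →ᵇ E)
    {t : ℝ} (ht : 0 ≤ t) : ‖forwardSolution A g t‖ ≤ 1 / c * ‖g‖ := by
  have h0 : forwardSolution A g t = ∫ s in (0 : ℝ)..t, expGroup A (-(t - s)) (g s) := by
    have hc : Continuous fun s => expGroup A s (g s) :=
      (continuous_expGroup A).clm_apply g.continuous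
    rw [forwardSolution, ← ContinuousLinearMap.intervalIntegral_comp_comm _
      (hc.intervalIntegrable 0 t)]
    refine intervalIntegral.integral_congr fun s _ => ?_
    rw [← mul_apply_eq_comp, ← expGroup_add]
    congr 2; ring
  rw [h0]
  have h1 := intervalIntegral.norm_integral_le_of_norm_le ht
    (f := fun s => expGroup A (-(t - s)) (g s)) (g := fun s => Real.exp (-(c * (t - s))) * ‖g‖)
    (μ := volume) (.of_forall fun s hs => ?_) (Continuous.intervalIntegrable (by fun_prop) _ _)
  · refine h1.trans ?_
    rw [intervalIntegral.integral_mul_const]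
    gcongr
    exact integral_exp_neg_mul_le hc t
  · refine (ContinuousLinearMap.le_opNorm _ _).trans ?_
    gcongr
    · exact norm_expGroup_neg_le hA (sub_nonneg.2 hs.2)
    · exact g.norm_coe_le_norm s

theorem integrableOn_expGroup_neg_apply (hc : 0 < c) (hA : ∀ v, c * ‖v‖ ^ 2 ≤ ⟪A v, v⟫)
    (g : ℝ →ᵇ E) : IntegrableOn (fun s => expGroup A (-s) (g s)) (Ioi 0) := by
  have hcont : Continuous fun s => expGroup A (-s) (g s) :=
    ((continuous_expGroup A).comp continuous_neg).clm_apply g.continuous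
  have h : IntegrableOn (fun s => Real.exp (-c * s) * ‖g‖) (Ioi 0) :=
    (exp_neg_integrableOn_Ioi 0 hc).mul_const _
  refine Integrable.mono' h hcont.aestronglyMeasurable ?_
  refine (ae_restrict_iff' measurableSet_Ioi).2 (.of_forall fun s hs => ?_)
  refine (ContinuousLinearMap.le_opNorm _ _).trans ?_
  gcongr
  · rw [neg_mul]; exact norm_expGroup_neg_le hA (le_of_lt hs)
  · exact g.norm_coe_le_norm s

/-- Although `e^{tA}` grows, moving it under the integral gives `-∫_t^∞ e^{-(s - t)A} g(s) ds`,
whose kernel decays into the future. -/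
theorem norm_backwardSolution_le (hc : 0 < c) (hA : ∀ v, c * ‖v‖ ^ 2 ≤ ⟪A v, v⟫) (g : ℝ →ᵇ E)
    {t : ℝ} (ht : 0 ≤ t) : ‖backwardSolution A g t‖ ≤ 1 / c * ‖g‖ := by
  have hint := integrableOn_expGroup_neg_apply hc hA g
  have hint' := hint.mono_set (Ioi_subset_Ioi ht)
  have h0 : backwardSolution A g t = -∫ s in Ioi t, expGroup A (-(s - t)) (g s) := by
    have h1 : (∫ s in Ioi (0 : ℝ), expGroup A (-s) (g s)) -
        ∫ s in (0 : ℝ)..t, expGroup A (-s) (g s) = ∫ s in Ioi t, expGroup A (-s) (g s) := by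
      rw [← intervalIntegral.integral_Ioi_sub_Ioi hint ht]; abel
    rw [backwardSolution, h1, ← ContinuousLinearMap.integral_comp_comm _ hint']
    congr 2
    funext s
    rw [← mul_apply_eq_comp, ← expGroup_add]
    congr 2; ring
  rw [h0, norm_neg]
  have hI : IntegrableOn (fun s => Real.exp (c * t) * (Real.exp (-c * s) * ‖g‖)) (Ioi t) :=
    ((exp_neg_integrableOn_Ioi t hc).mul_const _).const_mul _
  have h1 := norm_integral_le_of_norm_le (f := fun s => expGroup A (-(s - t)) (g s))
    (μ := volume.restrict (Ioi t)) hI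
    ((ae_restrict_iff' measurableSet_Ioi).2 (.of_forall fun s hs => ?_))
  · refine h1.trans ?_
    rw [integral_const_mul, integral_mul_const, integral_exp_mul_Ioi (by linarith) t, ← mul_assoc]
    gcongr
    rw [neg_div_neg_eq, mul_div_assoc', ← Real.exp_add]
    simp
  · refine (ContinuousLinearMap.le_opNorm _ _).trans ?_
    have := norm_expGroup_neg_le hA (sub_nonneg.2 (le_of_lt hs))
    rw [← mul_assoc, ← Real.exp_add]
    gcongr
    · refine this.trans_eq ?_
      congr 1; ring
    · exact g.norm_coe_le_norm s

variable (A)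

/-- The operator `g ↦ forwardSolution g` on bounded functions, frozen at negative times. -/
noncomputable def forwardOperator (hc : 0 < c) (hA : ∀ v, c * ‖v‖ ^ 2 ≤ ⟪A v, v⟫) :
    (ℝ →ᵇ E) →L[ℝ] (ℝ →ᵇ E) :=
  LinearMap.mkContinuous
    { toFun := fun g => BoundedContinuousFunction.ofNormedAddCommGroup
        -- The estimate holds for `t ≥ 0` only; freezing keeps the function continuous and bounded
        -- on the whole line.
        (fun t => forwardSolution A g (max t 0))
        ((continuous_iff_continuousAt.2 fun t =>
          (hasDerivAt_forwardSolution g.continuous t).continuousAt).comp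
          (continuous_id.max continuous_const)) (1 / c * ‖g‖)
        (fun t => norm_forwardSolution_le hc hA g (le_max_right _ _))
      map_add' := fun f g => by
        ext t
        have hi : ∀ f : ℝ →ᵇ E, IntervalIntegrable (fun s => expGroup A s (f s)) volume 0
            (max t 0) :=
          fun f => ((continuous_expGroup A).clm_apply f.continuous).intervalIntegrable _ _
        simp [forwardSolution, intervalIntegral.integral_add (hi f) (hi g)]
      map_smul' := fun r g => by
        ext t
        simp [forwardSolution] }
    (1 / c) fun g => (BoundedContinuousFunction.norm_le (by positivity)).2 fun t =>
      norm_forwardSolution_le hc hA g (le_max_right _ _)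

/-- The operator `g ↦ backwardSolution g` on bounded functions, frozen at negative times. -/
noncomputable def backwardOperator (hc : 0 < c) (hA : ∀ v, c * ‖v‖ ^ 2 ≤ ⟪A v, v⟫) :
    (ℝ →ᵇ E) →L[ℝ] (ℝ →ᵇ E) :=
  LinearMap.mkContinuous
    { toFun := fun g => BoundedContinuousFunction.ofNormedAddCommGroup
        (fun t => backwardSolution A g (max t 0))
        ((continuous_iff_continuousAt.2 fun t =>
          (hasDerivAt_backwardSolution g.continuous t).continuousAt).comp
          (continuous_id.max continuous_const)) (1 / c * ‖g‖)
        (fun t => norm_backwardSolution_le hc hA g (le_max_right _ _))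
      map_add' := fun f g => by
        ext t
        have hi : ∀ f : ℝ →ᵇ E,
            IntervalIntegrable (fun s => expGroup A (-s) (f s)) volume 0 (max t 0) :=
          fun f => (((continuous_expGroup A).comp continuous_neg).clm_apply
            f.continuous).intervalIntegrable _ _
        have hj := fun f => integrableOn_expGroup_neg_apply hc hA f
        simp [backwardSolution, intervalIntegral.integral_add (hi f) (hi g),
          integral_add (hj f) (hj g)]
        abel
      map_smul' := fun r g => by
        ext t
        simp [backwardSolution, integral_smul, smul_sub] }
    (1 / c) fun g => (BoundedContinuousFunction.norm_le (by positivity)).2 fun t =>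
      norm_backwardSolution_le hc hA g (le_max_right _ _)

theorem forwardOperator_apply (hc : 0 < c) (hA : ∀ v, c * ‖v‖ ^ 2 ≤ ⟪A v, v⟫) (g : ℝ →ᵇ E)
    (t : ℝ) : forwardOperator A hc hA g t = forwardSolution A g (max t 0) := rfl

theorem backwardOperator_apply (hc : 0 < c) (hA : ∀ v, c * ‖v‖ ^ 2 ≤ ⟪A v, v⟫) (g : ℝ →ᵇ E)
    (t : ℝ) : backwardOperator A hc hA g t = backwardSolution A g (max t 0) := rfl

/-- The decaying trajectories `t ↦ e^{-tA} x` as bounded functions, frozen at negative times. -/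
noncomputable def decayOperator (hc : 0 < c) (hA : ∀ v, c * ‖v‖ ^ 2 ≤ ⟪A v, v⟫) :
    E →L[ℝ] (ℝ →ᵇ E) :=
  LinearMap.mkContinuous
    { toFun := fun x => BoundedContinuousFunction.ofNormedAddCommGroup
        (fun t => expGroup A (-(max t 0)) x)
        (((continuous_expGroup A).comp (continuous_id.max continuous_const).neg).clm_apply
          continuous_const) (1 * ‖x‖)
        (fun t => (ContinuousLinearMap.le_opNorm _ _).trans (mul_le_mul_of_nonneg_right
          ((norm_expGroup_neg_le hA (le_max_right _ _)).trans
            (Real.exp_le_one_iff.2 (neg_nonpos.2 (mul_nonneg hc.le (le_max_right _ _)))))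
          (norm_nonneg x)))
      map_add' := fun f g => by ext t; simp
      map_smul' := fun r g => by ext t; simp }
    1 fun x => (BoundedContinuousFunction.norm_le (by positivity)).2 fun t =>
      (ContinuousLinearMap.le_opNorm _ _).trans (mul_le_mul_of_nonneg_right
          ((norm_expGroup_neg_le hA (le_max_right _ _)).trans
            (Real.exp_le_one_iff.2 (neg_nonpos.2 (mul_nonneg hc.le (le_max_right _ _)))))
          (norm_nonneg x))

theorem decayOperator_apply (hc : 0 < c) (hA : ∀ v, c * ‖v‖ ^ 2 ≤ ⟪A v, v⟫) (x : E)
    (t : ℝ) : decayOperator A hc hA x t = expGroup A (-(max t 0)) x := rfl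

end Semigroup


/-! ### Lyapunov–Perron construction of bounded forward orbits -/

section StableGraph

open scoped RealInnerProductSpace
open BoundedContinuousFunction

universe u

/-- A smooth map with invertible derivative has a local inverse which is smooth on a
neighbourhood. -/
theorem exists_smooth_local_inverse {B : Type*} [NormedAddCommGroup B] [NormedSpace ℝ B]
    [CompleteSpace B] {Θ : B → B} (hΘ : ContDiff ℝ ∞ Θ) (h0 : Θ 0 = 0)
    (hD : HasFDerivAt Θ (ContinuousLinearMap.id ℝ B) 0) :
    ∃ (W : Set B) (Ψ : B → B), IsOpen W ∧ (0 : B) ∈ W ∧ ContDiffOn ℝ ∞ Ψ W ∧ Ψ 0 = 0 ∧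
      HasFDerivAt Ψ (ContinuousLinearMap.id ℝ B) 0 ∧ ∀ w ∈ W, Θ (Ψ w) = w := by
  have hD' : HasFDerivAt Θ ((ContinuousLinearEquiv.refl ℝ B : B ≃L[ℝ] B) : B →L[ℝ] B) 0 := hD
  let e := hΘ.contDiffAt.toOpenPartialHomeomorph Θ hD' (by simp)
  have he : ∀ x, e x = Θ x := fun x => rfl
  have h0s : (0 : B) ∈ e.source :=
    hΘ.contDiffAt.mem_toOpenPartialHomeomorph_source hD' (by simp)
  have h0t : (0 : B) ∈ e.target := by
    have := e.map_source h0s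
    rwa [he, h0] at this
  have hs0 : e.symm 0 = 0 := by
    have := e.left_inv h0s
    rwa [he, h0] at this
  -- The inverse is smooth at every point whose preimage has an invertible derivative. This
  -- condition is open, so smoothness holds on a whole neighbourhood.
  let N : Set B := {z | fderiv ℝ Θ z ∈ range ((↑) : (B ≃L[ℝ] B) → B →L[ℝ] B)}
  have hN : IsOpen N := (ContinuousLinearEquiv.isOpen).preimage
    (hΘ.continuous_fderiv (by simp))
  refine ⟨e.target ∩ e.symm ⁻¹' N, e.symm, e.symm.isOpen_inter_preimage hN, ⟨h0t, ?_⟩, ?_, hs0,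
    ?_, fun w hw => e.right_inv hw.1⟩
  · rw [mem_preimage, hs0]
    exact ⟨ContinuousLinearEquiv.refl ℝ B, hD'.fderiv.symm⟩
  · rintro w ⟨hw, L, hL⟩
    refine (e.contDiffAt_symm hw (f₀' := L) ?_ hΘ.contDiffAt).contDiffWithinAt
    rw [hL]
    exact (hΘ.differentiable (by simp) _).hasFDerivAt
  · have h1 : HasFDerivAt e ((ContinuousLinearEquiv.refl ℝ B : B ≃L[ℝ] B) : B →L[ℝ] B)
        (e.symm 0) := by rw [hs0]; exact hD'
    exact e.hasFDerivAt_symm h0t h1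

variable {E : Type u} [NormedAddCommGroup E] [InnerProductSpace ℝ E]

/-- The hyperbolic linear vector field `(x, y) ↦ (-A x, A y)`. -/
noncomputable def saddle (A : E →L[ℝ] E) : E × E →L[ℝ] E × E :=
  (-(A.comp (ContinuousLinearMap.fst ℝ E E))).prod (A.comp (ContinuousLinearMap.snd ℝ E E))

theorem saddle_apply (A : E →L[ℝ] E) (z : E × E) : saddle A z = (-A z.1, A z.2) := rfl

variable [FiniteDimensional ℝ E] {A : E →L[ℝ] E} {c : ℝ} {R : E × E → E × E}

/-- A smooth family of bounded forward orbits of a perturbed saddle, parametrized by the first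
component of the initial value. -/
theorem exists_smooth_family_of_bounded_orbits (hc : 0 < c) (hA : ∀ v, c * ‖v‖ ^ 2 ≤ ⟪A v, v⟫)
    (hR : ContDiff ℝ ∞ R) (hcs : HasCompactSupport R) (h0 : R 0 = 0)
    (hD : HasFDerivAt R (0 : E × E →L[ℝ] E × E) 0) :
    ∃ r > 0, ∃ Z : E → (ℝ →ᵇ E × E), ContDiffOn ℝ ∞ Z (Metric.ball 0 r) ∧ Z 0 = 0 ∧
      HasFDerivAt (fun x => (Z x 0).2) (0 : E →L[ℝ] E) 0 ∧
      ∀ x ∈ Metric.ball (0 : E) r, (Z x 0).1 = x ∧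
        ∀ t ∈ Ici (0 : ℝ), HasDerivWithinAt (Z x) (saddle A (Z x t) + R (Z x t)) (Ici 0) t := by
  have : CompleteSpace E := FiniteDimensional.complete ℝ E
  obtain ⟨G, hG⟩ := exists_boundedContinuousFunction_of_hasCompactSupport hR.continuous hcs
  have hGR : (G : E × E → E × E) = R := funext hG
  obtain ⟨DG, hDG⟩ := exists_boundedContinuousFunction_of_hasCompactSupport
    (hR.continuous_fderiv (by simp)) (hcs.fderiv (𝕜 := ℝ))
  let N : (ℝ →ᵇ E × E) → (ℝ →ᵇ E × E) := fun z => G.compContinuous z.toContinuousMap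
  have hN : ContDiff ℝ ∞ N := contDiff_superposition G (by rwa [hGR]) (by rwa [hGR])
  have hN0 : N 0 = 0 := by ext1 t; simp [N, hG, h0]
  have hNd : HasFDerivAt N (0 : (ℝ →ᵇ E × E) →L[ℝ] (ℝ →ᵇ E × E)) 0 := by
    have h1 := hasFDerivAt_superposition (T := ℝ) G (by rwa [hGR]) (by rwa [hGR]) DG
      (fun x => by rw [hDG, hGR]) 0
    refine h1.congr_fderiv ?_
    ext1 z; ext1 t
    simp [hDG, hD.fderiv]
  let fstL := (ContinuousLinearMap.fst ℝ E E).compLeftContinuousBounded ℝ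
  let sndL := (ContinuousLinearMap.snd ℝ E E).compLeftContinuousBounded ℝ
  let inlL := (ContinuousLinearMap.inl ℝ E E).compLeftContinuousBounded ℝ
  let inrL := (ContinuousLinearMap.inr ℝ E E).compLeftContinuousBounded ℝ
  -- Integration runs forward in the contracting directions and backward in the expanding ones. A
  -- solution of `z = ι x + K (N z)` is, for `t ≥ 0`, a bounded orbit whose first component starts
  -- at `x`.
  let K : (ℝ →ᵇ E × E) →L[ℝ] (ℝ →ᵇ E × E) :=
    inlL.comp ((forwardOperator A hc hA).comp fstL) +
      inrL.comp ((backwardOperator A hc hA).comp sndL)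
  let ι : E →L[ℝ] (ℝ →ᵇ E × E) := inlL.comp (decayOperator A hc hA)
  have hK : ∀ g t, K g t = (forwardSolution A (fun s => (g s).1) (max t 0),
      backwardSolution A (fun s => (g s).2) (max t 0)) := by
    intro g t
    simp [K, inlL, inrL, forwardOperator_apply, backwardOperator_apply]
    exact ⟨rfl, rfl⟩
  have hι : ∀ x t, ι x t = (expGroup A (-(max t 0)) x, 0) := by
    intro x t
    simp [ι, inlL, decayOperator_apply]
  -- Since `DN(0) = 0`, the map `z - K (N z)` has derivative the identity at `0`; its local inverse,
  -- applied to `ι x`, solves the equation.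
  obtain ⟨W, Ψ, hWo, hW0, hΨ, hΨ0, hΨd, hΨW⟩ := exists_smooth_local_inverse
    (Θ := fun z => z - K (N z)) (contDiff_id.sub (K.contDiff.comp hN)) (by simp [hN0]) (by
      have := (hasFDerivAt_id (𝕜 := ℝ) (0 : ℝ →ᵇ E × E)).sub
        (K.hasFDerivAt.comp (0 : ℝ →ᵇ E × E) hNd)
      refine this.congr_fderiv ?_
      simp)
  have hpre : ι ⁻¹' W ∈ 𝓝 (0 : E) :=
    ι.continuous.continuousAt.preimage_mem_nhds (by rw [map_zero]; exact hWo.mem_nhds hW0)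
  obtain ⟨r, hr, hrW⟩ := Metric.mem_nhds_iff.1 hpre
  refine ⟨r, hr, fun x => Ψ (ι x), hΨ.comp ι.contDiff.contDiffOn hrW, by simp [hΨ0], ?_, ?_⟩
  -- The family has derivative `ι` at `0`, and the second component of `ι` vanishes. This is the
  -- tangency of the graph to `y = 0`.
  · have h1 : HasFDerivAt (fun x => Ψ (ι x)) (ι : E →L[ℝ] (ℝ →ᵇ E × E)) 0 := by
      have hΨd' : HasFDerivAt Ψ (ContinuousLinearMap.id ℝ (ℝ →ᵇ E × E)) (ι 0) := by
        rwa [map_zero]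
      exact (hΨd'.comp (0 : E) ι.hasFDerivAt).congr_fderiv (by simp)
    let ev : (ℝ →ᵇ E × E) →L[ℝ] E :=
      (ContinuousLinearMap.snd ℝ E E).comp (BoundedContinuousFunction.evalCLM ℝ (0 : ℝ))
    have h2 := ev.hasFDerivAt.comp (0 : E) h1
    refine h2.congr_fderiv ?_
    ext1 x
    have : ev (ι x) = (ι x 0).2 := rfl
    simp [this, hι]
  · intro x hx
    have hfix := hΨW _ (hrW hx)
    set z := Ψ (ι x) with hz
    have hzt : ∀ t, z t = ι x t + K (N z) t := by
      intro t
      have := congrArg (fun w : ℝ →ᵇ E × E => w t) (sub_eq_iff_eq_add.1 hfix)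
      simpa using this
    have hzpos : ∀ t ∈ Ici (0 : ℝ), z t =
        (expGroup A (-t) x + forwardSolution A (fun s => (N z s).1) t,
          backwardSolution A (fun s => (N z s).2) t) := by
      intro t ht
      rw [hzt, hι, hK, max_eq_left ht]
      simp
    refine ⟨?_, fun t ht => ?_⟩
    · rw [hzpos 0 (mem_Ici.2 le_rfl)]
      simp [forwardSolution, expGroup_zero]
    · have h1 : HasDerivAt (fun t => expGroup A (-t) x + forwardSolution A (fun s => (N z s).1) t)
          (-A (expGroup A (-t) x) + (-A (forwardSolution A (fun s => (N z s).1) t) + (N z t).1))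
          t := by
        refine HasDerivAt.add ?_ (hasDerivAt_forwardSolution (by fun_prop) t)
        exact ((hasDerivAt_expGroup_neg A t).clm_apply (hasDerivAt_const t x)).congr_deriv
          (by simp)
      have h2 := hasDerivAt_backwardSolution (A := A) (g := fun s => (N z s).2) (by fun_prop) t
      have h3 := (h1.prodMk h2).hasDerivWithinAt (s := Ici 0)
      refine (h3.congr_of_mem (fun s hs => hzpos s hs) ht).congr_deriv ?_
      have hNz : N z t = R (z t) := hG _
      rw [← hNz, saddle_apply, hzpos t ht]
      ext <;> simp
      abel

end StableGraph


/-! ### Cone estimates and the local stable manifold theorem -/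

section StableGraphDynamics

open scoped RealInnerProductSpace

universe u

variable {E : Type u} [NormedAddCommGroup E] [InnerProductSpace ℝ E]
  {A : E →L[ℝ] E} {c : ℝ} {R : E × E → E × E} {D : Set (E × E)}

theorem hasDerivWithinAt_fst {z : ℝ → E × E} {z' : E × E} {s : Set ℝ} {t : ℝ}
    (h : HasDerivWithinAt z z' s t) : HasDerivWithinAt (fun t => (z t).1) z'.1 s t :=
  (ContinuousLinearMap.fst ℝ E E).hasFDerivAt.comp_hasDerivWithinAt t h

theorem hasDerivWithinAt_snd {z : ℝ → E × E} {z' : E × E} {s : Set ℝ} {t : ℝ}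
    (h : HasDerivWithinAt z z' s t) : HasDerivWithinAt (fun t => (z t).2) z'.2 s t :=
  (ContinuousLinearMap.snd ℝ E E).hasFDerivAt.comp_hasDerivWithinAt t h

/-- The difference of two bounded forward orbits in a region where the nonlinearity has a small
Lipschitz constant lies in the stable cone. -/
theorem norm_snd_sub_le_norm_fst_sub (hc : 0 < c) (hA : ∀ v, c * ‖v‖ ^ 2 ≤ ⟪A v, v⟫)
    {ρ : ℝ} (hD : D ⊆ Metric.ball 0 ρ)
    (hR : ∀ p ∈ D, ∀ q ∈ D, ‖R p - R q‖ ≤ c / 4 * ‖p - q‖) {z w : ℝ → E × E} {a : ℝ}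
    (hz : ∀ t ∈ Ici a, HasDerivWithinAt z (saddle A (z t) + R (z t)) (Ici a) t)
    (hw : ∀ t ∈ Ici a, HasDerivWithinAt w (saddle A (w t) + R (w t)) (Ici a) t)
    (hzD : ∀ t ∈ Ici a, z t ∈ D) (hwD : ∀ t ∈ Ici a, w t ∈ D) :
    ‖(z a).2 - (w a).2‖ ≤ ‖(z a).1 - (w a).1‖ := by
  by_contra! hlt
  -- Outside the cone `Q > 0`. With `x`, `y` the components of the difference and `m` its sup norm,
  -- the saddle contributes at least `2c (‖x‖² + ‖y‖²)` to `Q'`. The nonlinearity costs at most `4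
  -- (c / 4) m²`, and `m² ≤ ‖x‖² + ‖y‖²`. Hence `Q' ≥ c Q`, and exponential growth contradicts the
  -- boundedness of `D`.
  let Q : ℝ → ℝ := fun t => ‖(z t).2 - (w t).2‖ ^ 2 - ‖(z t).1 - (w t).1‖ ^ 2
  have hQa : 0 < Q a := by
    have : ‖(z a).1 - (w a).1‖ ^ 2 < ‖(z a).2 - (w a).2‖ ^ 2 := by gcongr
    simpa [Q] using this
  have hgrow : ∀ b ≥ a, Q a * Real.exp (c * (b - a)) ≤ Q b := by
    intro b hb
    refine mul_exp_le_of_hasDerivWithinAt hb (fun t ht => ?_) (fun t ht => ?_)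
      (f' := fun t => 2 * ⟪(z t).2 - (w t).2, A ((z t).2 - (w t).2) + (R (z t) - R (w t)).2⟫ -
        2 * ⟪(z t).1 - (w t).1, -A ((z t).1 - (w t).1) + (R (z t) - R (w t)).1⟫)
    · have hz' := (hz t ht.1).mono (Icc_subset_Ici_self : Icc a b ⊆ Ici a)
      have hw' := (hw t ht.1).mono (Icc_subset_Ici_self : Icc a b ⊆ Ici a)
      refine (((hasDerivWithinAt_snd hz').sub (hasDerivWithinAt_snd hw')).norm_sq.sub
        ((hasDerivWithinAt_fst hz').sub (hasDerivWithinAt_fst hw')).norm_sq).congr_deriv ?_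
      simp only [saddle_apply, Prod.fst_add, Prod.snd_add, Prod.fst_sub, Prod.snd_sub, map_sub]
      congr 4 <;> abel
    · have h1 := hR _ (hzD t ht.1) _ (hwD t ht.1)
      set x := (z t).1 - (w t).1 with hx
      set y := (z t).2 - (w t).2 with hy
      set m := ‖z t - w t‖ with hm
      have hmx : ‖x‖ ≤ m := norm_fst_le (z t - w t)
      have hmy : ‖y‖ ≤ m := norm_snd_le (z t - w t)
      have hmax : m = max ‖x‖ ‖y‖ := Prod.norm_def (z t - w t)
      have hr1 : ‖(R (z t) - R (w t)).1‖ ≤ c / 4 * m := (norm_fst_le _).trans h1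
      have hr2 : ‖(R (z t) - R (w t)).2‖ ≤ c / 4 * m := (norm_snd_le _).trans h1
      have hm0 : 0 ≤ m := norm_nonneg _
      have hb1 : |⟪x, (R (z t) - R (w t)).1⟫| ≤ c / 4 * m * m :=
        (abs_real_inner_le_norm _ _).trans (by
          calc _ ≤ m * (c / 4 * m) := by gcongr
            _ = _ := by ring)
      have hb2 : |⟪y, (R (z t) - R (w t)).2⟫| ≤ c / 4 * m * m :=
        (abs_real_inner_le_norm _ _).trans (by
          calc _ ≤ m * (c / 4 * m) := by gcongr
            _ = _ := by ring)
      have hm2 : m ^ 2 ≤ ‖x‖ ^ 2 + ‖y‖ ^ 2 := by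
        rcases max_choice ‖x‖ ‖y‖ with h | h <;> rw [hmax, h] <;>
          nlinarith [sq_nonneg ‖x‖, sq_nonneg ‖y‖]
      have hAx := hA x
      have hAy := hA y
      rw [real_inner_comm] at hAx hAy
      simp only [Q, inner_add_right, inner_neg_right, ← hx, ← hy]
      rw [abs_le] at hb1 hb2
      nlinarith [hb1.2, hb2.1, mul_le_mul_of_nonneg_left hm2 hc.le,
        mul_nonneg hc.le (sq_nonneg ‖x‖),
        mul_nonneg hc.le (sq_nonneg ‖y‖)]
  have hbound : ∀ b ≥ a, Q b ≤ (2 * ρ) ^ 2 := by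
    intro b hb
    have h1 : ‖(z b).2 - (w b).2‖ ≤ 2 * ρ := by
      refine (norm_snd_le (z b - w b)).trans ((norm_sub_le _ _).trans ?_)
      have h1 := hD (hzD b hb)
      have h2 := hD (hwD b hb)
      rw [mem_ball_zero_iff] at h1 h2
      linarith
    have h2 : ‖(z b).2 - (w b).2‖ ^ 2 ≤ (2 * ρ) ^ 2 := by gcongr
    have h3 := sq_nonneg ‖(z b).1 - (w b).1‖
    simp only [Q]; linarith
  have hlim : Tendsto (fun b => Q a * Real.exp (c * (b - a))) atTop atTop :=
    (Real.tendsto_exp_atTop.comp ((tendsto_atTop_add_const_right _ (-a) tendsto_id).const_mul_atTop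
      hc)).const_mul_atTop hQa
  obtain ⟨b, hb1, hb2⟩ := ((hlim.eventually_gt_atTop ((2 * ρ) ^ 2)).and
    (eventually_ge_atTop a)).exists
  linarith [hgrow b hb2, hbound b hb2]

/-- Exponential decay of the first component along orbits in the stable cone. -/
theorem norm_fst_sq_le_mul_exp (hc : 0 < c) (hA : ∀ v, c * ‖v‖ ^ 2 ≤ ⟪A v, v⟫)
    (h0 : R 0 = 0) (h0D : (0 : E × E) ∈ D)
    (hR : ∀ p ∈ D, ∀ q ∈ D, ‖R p - R q‖ ≤ c / 4 * ‖p - q‖) {z : ℝ → E × E} {a b : ℝ}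
    (hab : a ≤ b)
    (hz : ∀ t ∈ Icc a b, HasDerivWithinAt z (saddle A (z t) + R (z t)) (Icc a b) t)
    (hzD : ∀ t ∈ Icc a b, z t ∈ D) (hcone : ∀ t ∈ Icc a b, ‖(z t).2‖ ≤ ‖(z t).1‖) :
    ‖(z b).1‖ ^ 2 ≤ ‖(z a).1‖ ^ 2 * Real.exp (-c * (b - a)) := by
  have := mul_exp_le_of_hasDerivWithinAt (f := fun t => -‖(z t).1‖ ^ 2) (k := -c)
    hab (fun t ht => (hasDerivWithinAt_fst (hz t ht)).norm_sq.neg) (fun t ht => ?_)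
  · linarith
  · have h1 := hR _ (hzD t ht) _ h0D
    rw [h0, sub_zero, sub_zero] at h1
    -- In the cone the sup norm is that of the first component, so the nonlinearity costs at most `c
    -- / 2` of the rate `2c`.
    have hm : ‖z t‖ = ‖(z t).1‖ := by rw [Prod.norm_def, max_eq_left (hcone t ht)]
    have hb1 : |⟪(z t).1, (R (z t)).1⟫| ≤ ‖(z t).1‖ * (c / 4 * ‖(z t).1‖) := by
      refine (abs_real_inner_le_norm _ _).trans ?_
      gcongr
      rw [← hm]; exact (norm_fst_le _).trans h1
    have hAx := hA (z t).1
    rw [real_inner_comm] at hAx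
    rw [abs_le] at hb1
    simp only [saddle_apply, Prod.fst_add, inner_add_right, inner_neg_right]
    nlinarith [hb1.2, mul_nonneg hc.le (sq_nonneg ‖(z t).1‖)]

/-- Local stable manifold theorem for a vector field whose linearization at the origin is the
saddle `(-A, A)` with `A` coercive. -/
theorem exists_stable_graph [FiniteDimensional ℝ E] (hc : 0 < c)
    (hA : ∀ v, c * ‖v‖ ^ 2 ≤ ⟪A v, v⟫) {V : E × E → E × E} {U : Set (E × E)} (hU : IsOpen U)
    (h0U : (0 : E × E) ∈ U) (hV : ContDiffOn ℝ ∞ V U) (hV0 : V 0 = 0)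
    (hVd : HasFDerivAt V (saddle A) 0) :
    ∃ ε₀ > 0, Metric.ball 0 ε₀ ⊆ U ∧ ∃ ψ : E → E, ContDiffOn ℝ ∞ ψ (Metric.ball 0 ε₀) ∧
      ψ 0 = 0 ∧ HasFDerivAt ψ (0 : E →L[ℝ] E) 0 ∧
      (∀ x : E, ‖x‖ < ε₀ → ∃ z : ℝ → E × E, z 0 = (x, ψ x) ∧
        (∀ t ∈ Ici (0 : ℝ), HasDerivWithinAt z (V (z t)) (Ici 0) t) ∧
        (∀ t ∈ Ici (0 : ℝ), ‖z t‖ ≤ ‖x‖) ∧ Tendsto z atTop (𝓝 0)) ∧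
      (∀ z : ℝ → E × E, (∀ t ∈ Ici (0 : ℝ), HasDerivWithinAt z (V (z t)) (Ici 0) t) →
        (∀ t ∈ Ici (0 : ℝ), z t ∈ Metric.ball 0 ε₀) → (z 0).2 = ψ (z 0).1) ∧
      ∀ (z : ℝ → E × E) (a b : ℝ), a ≤ b →
        (∀ t ∈ Icc a b, HasDerivWithinAt z (V (z t)) (Icc a b) t) →
        (∀ t ∈ Icc a b, z t ∈ Metric.ball 0 ε₀) → (∀ t ∈ Icc a b, ‖(z t).2‖ ≤ ‖(z t).1‖) →
        ‖(z b).1‖ ≤ ‖(z a).1‖ := by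
  obtain ⟨ρ₁, hρ₁, hρU⟩ : ∃ ρ > 0, Metric.closedBall (0 : E × E) ρ ⊆ U := by
    obtain ⟨r, hr, h⟩ := Metric.isOpen_iff.1 hU 0 h0U
    exact ⟨r / 2, by positivity, (Metric.closedBall_subset_ball (by linarith)).trans h⟩
  -- Cutting off the nonlinear part makes it globally smooth with compact support, without changing
  -- the field near `0`.
  let χ : ContDiffBump (0 : E × E) := ⟨ρ₁ / 2, ρ₁, by positivity, by linarith⟩
  let R : E × E → E × E := fun z => χ z • (V z - saddle A z)
  have hRV : ∀ z ∈ Metric.ball (0 : E × E) (ρ₁ / 2), V z = saddle A z + R z := by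
    intro z hz
    have : χ z = 1 := χ.one_of_mem_closedBall (Metric.ball_subset_closedBall hz)
    simp [R, this]
  have hRsm : ContDiff ℝ ∞ R := by
    rw [contDiff_iff_contDiffAt]
    intro z
    by_cases hz : z ∈ U
    · exact χ.contDiffAt.smul ((hV.contDiffAt (hU.mem_nhds hz)).sub (saddle A).contDiff.contDiffAt)
    · have hz' : z ∉ tsupport χ := by
        rw [χ.tsupport_eq]; exact fun h => hz (hρU h)
      refine (contDiffAt_const (c := (0 : E × E))).congr_of_eventuallyEq ?_
      filter_upwards [notMem_tsupport_iff_eventuallyEq.1 hz'] with w hw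
      simp [R, hw]
  have hRc : HasCompactSupport R := χ.hasCompactSupport.smul_right
  have hR0 : R 0 = 0 := by simp [R, hV0]
  have hRd : HasFDerivAt R (0 : E × E →L[ℝ] E × E) 0 := by
    have h1 : HasFDerivAt (fun z => V z - saddle A z) (0 : E × E →L[ℝ] E × E) 0 :=
      (hVd.sub (saddle A).hasFDerivAt).congr_fderiv (by simp)
    refine h1.congr_of_eventuallyEq ?_
    filter_upwards [Metric.ball_mem_nhds (0 : E × E) (show 0 < ρ₁ / 2 by positivity)] with z hz
    rw [hRV z hz]; abel
  obtain ⟨ρ, hρ, hρ1, hLip⟩ : ∃ ρ > 0, ρ ≤ ρ₁ / 2 ∧ ∀ p ∈ Metric.ball (0 : E × E) ρ,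
      ∀ q ∈ Metric.ball (0 : E × E) ρ, ‖R p - R q‖ ≤ c / 4 * ‖p - q‖ := by
    -- Strict differentiability with zero derivative makes the Lipschitz constant near `0` as small
    -- as desired; `c / 4` is what the cone estimates need.
    have h1 := hRsm.contDiffAt.hasStrictFDerivAt' hRd (by simp)
    have h2 := h1.isLittleO.def (show 0 < c / 4 by positivity)
    rw [nhds_prod_eq] at h2
    obtain ⟨s, hs, h3⟩ := mem_prod_same_iff.1 h2
    obtain ⟨r, hr, h4⟩ := Metric.mem_nhds_iff.1 hs
    refine ⟨min r (ρ₁ / 2), by positivity, min_le_right _ _, fun p hp q hq => ?_⟩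
    have := h3 (mk_mem_prod (h4 (Metric.ball_subset_ball (min_le_left _ _) hp))
      (h4 (Metric.ball_subset_ball (min_le_left _ _) hq)))
    simpa using this
  have hρV : ∀ z ∈ Metric.ball (0 : E × E) ρ, V z = saddle A z + R z :=
    fun z hz => hRV z (Metric.ball_subset_ball hρ1 hz)
  have h0ρ : (0 : E × E) ∈ Metric.ball (0 : E × E) ρ := Metric.mem_ball_self hρ
  obtain ⟨r, hr, Z, hZ, hZ0, hZd, hZx⟩ :=
    exists_smooth_family_of_bounded_orbits hc hA hRsm hRc hR0 hRd
  obtain ⟨r', hr', hr'r, hZsmall⟩ : ∃ r' > 0, r' ≤ r ∧ ∀ x ∈ Metric.ball (0 : E) r', ‖Z x‖ < ρ := by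
    have h1 : ContinuousAt Z 0 :=
      hZ.continuousOn.continuousAt (Metric.ball_mem_nhds 0 hr)
    have h2 : ∀ᶠ x in 𝓝 (0 : E), ‖Z x‖ < ρ := by
      refine h1.norm.eventually_lt_const ?_
      simpa [hZ0] using hρ
    obtain ⟨r', hr', h⟩ := Metric.mem_nhds_iff.1 h2
    exact ⟨min r' r, by positivity, min_le_right _ _,
      fun x hx => h (Metric.ball_subset_ball (min_le_left _ _) hx)⟩
  have hερ : Metric.ball (0 : E × E) (min r' ρ) ⊆ Metric.ball 0 ρ :=
    Metric.ball_subset_ball (min_le_right _ _)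
  have hZball : ∀ x : E, ‖x‖ < min r' ρ → ∀ t, Z x t ∈ Metric.ball (0 : E × E) ρ := by
    intro x hx t
    rw [mem_ball_zero_iff]
    exact ((Z x).norm_coe_le_norm t).trans_lt
      (hZsmall x (mem_ball_zero_iff.2 (hx.trans_le (min_le_left _ _))))
  have hZeq : ∀ x : E, ‖x‖ < min r' ρ → (Z x 0).1 = x ∧
      ∀ t ∈ Ici (0 : ℝ), HasDerivWithinAt (Z x) (saddle A (Z x t) + R (Z x t)) (Ici 0) t :=
    fun x hx => hZx x (mem_ball_zero_iff.2 ((hx.trans_le (min_le_left _ _)).trans_le hr'r))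
  refine ⟨min r' ρ, by positivity, ?_, fun x => (Z x 0).2, ?_, by simp [hZ0], hZd, ?_, ?_, ?_⟩
  · exact fun z hz => hρU (Metric.closedBall_subset_closedBall (by linarith)
      (Metric.ball_subset_closedBall (hερ hz)))
  · let ev : (BoundedContinuousFunction ℝ (E × E)) →L[ℝ] E :=
      (ContinuousLinearMap.snd ℝ E E).comp (BoundedContinuousFunction.evalCLM ℝ (0 : ℝ))
    exact ev.contDiff.comp_contDiffOn (hZ.mono (Metric.ball_subset_ball
      ((min_le_left _ _).trans hr'r)))
  · intro x hx
    obtain ⟨hx0, hode⟩ := hZeq x hx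
    have hzero : ∀ a : ℝ, ∀ t ∈ Ici a, HasDerivWithinAt (fun _ : ℝ => (0 : E × E))
        (saddle A 0 + R 0) (Ici a) t := by
      intro a t _
      rw [map_zero, hR0, zero_add]
      exact hasDerivWithinAt_const _ _ _
    -- Comparison with the zero orbit, restarted at each time `t`.
    have hcone : ∀ t ∈ Ici (0 : ℝ), ‖(Z x t).2‖ ≤ ‖(Z x t).1‖ := by
      intro t ht
      have := norm_snd_sub_le_norm_fst_sub hc hA subset_rfl hLip (z := Z x) (w := fun _ => 0)
        (a := t) (fun s hs => (hode s (mem_Ici.2 (le_trans (mem_Ici.1 ht) (mem_Ici.1 hs)))).mono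
          (Ici_subset_Ici.2 ht)) (hzero t)
        (fun s _ => hZball x hx s) (fun s _ => h0ρ)
      simpa using this
    have hdecay : ∀ t ∈ Ici (0 : ℝ), ‖(Z x t).1‖ ^ 2 ≤ ‖x‖ ^ 2 * Real.exp (-c * t) := by
      intro t ht
      have := norm_fst_sq_le_mul_exp hc hA hR0 h0ρ hLip ht
        (fun s hs => (hode s hs.1).mono Icc_subset_Ici_self) (fun s _ => hZball x hx s)
        (fun s hs => hcone s hs.1)
      rwa [hx0, sub_zero] at this
    have hnorm : ∀ t ∈ Ici (0 : ℝ), ‖Z x t‖ = ‖(Z x t).1‖ := fun t ht => by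
      rw [Prod.norm_def, max_eq_left (hcone t ht)]
    refine ⟨Z x, Prod.ext hx0 rfl, fun t ht => ?_, fun t ht => ?_, ?_⟩
    · rw [hρV _ (hZball x hx t)]; exact hode t ht
    · rw [hnorm t ht]
      refine le_of_sq_le_sq ((hdecay t ht).trans ?_) (norm_nonneg _)
      refine mul_le_of_le_one_right (sq_nonneg _) (Real.exp_le_one_iff.2 ?_)
      nlinarith [mul_nonneg hc.le (show (0 : ℝ) ≤ t from ht)]
    · have h1 : Tendsto (fun t : ℝ => ‖x‖ ^ 2 * Real.exp (-c * t)) atTop (𝓝 0) := by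
        have h2 : Tendsto (fun t : ℝ => -c * t) atTop atBot :=
          tendsto_id.const_mul_atTop_of_neg (by linarith)
        simpa using (Real.tendsto_exp_atBot.comp h2).const_mul (‖x‖ ^ 2)
      have h2 : Tendsto (fun t : ℝ => ‖Z x t‖ ^ 2) atTop (𝓝 0) := by
        refine squeeze_zero' (.of_forall fun t => sq_nonneg _) ?_ h1
        filter_upwards [eventually_ge_atTop (0 : ℝ)] with t ht
        rw [hnorm t ht]; exact hdecay t ht
      rw [tendsto_zero_iff_norm_tendsto_zero]
      simpa using h2.sqrt
  · intro z hz hzb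
    have hx : ‖(z 0).1‖ < min r' ρ :=
      (norm_fst_le _).trans_lt (mem_ball_zero_iff.1 (hzb 0 (mem_Ici.2 le_rfl)))
    obtain ⟨hx0, hode⟩ := hZeq _ hx
    -- The given orbit and the constructed one share their first component at time `0`, so the cone
    -- estimate forces equal second components.
    have := norm_snd_sub_le_norm_fst_sub hc hA subset_rfl hLip (z := z) (w := Z (z 0).1) (a := 0)
      (fun t ht => by rw [← hρV _ (hερ (hzb t ht))]; exact hz t ht) hode
      (fun t ht => hερ (hzb t ht)) (fun t _ => hZball _ hx t)
    rw [hx0, sub_self, norm_zero] at this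
    exact sub_eq_zero.1 (norm_le_zero_iff.1 this)
  · intro z a b hab hz hzb hcone
    have := norm_fst_sq_le_mul_exp hc hA hR0 h0ρ hLip hab
      (fun t ht => by rw [← hρV _ (hερ (hzb t ht))]; exact hz t ht)
      (fun t ht => hερ (hzb t ht)) hcone
    refine le_of_sq_le_sq (this.trans ?_) (norm_nonneg _)
    refine mul_le_of_le_one_right (sq_nonneg _) (Real.exp_le_one_iff.2 ?_)
    nlinarith [mul_nonneg hc.le (sub_nonneg.2 hab)]

end StableGraphDynamics


/-! ### Autonne–Takagi factorization -/

section Takagi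

open scoped InnerProductSpace

universe u

/-- A nonzero symmetric bilinear form on a complex inner product space has a vector `u` with
`B(u, u) = 1` whose `B`-orthogonal complement is its orthogonal complement. -/
theorem exists_takagi_vector {V : Type u} [NormedAddCommGroup V] [InnerProductSpace ℂ V]
    [FiniteDimensional ℂ V] [Nontrivial V] (B : V →ₗ[ℂ] V →ₗ[ℂ] ℂ) (hB : ∀ v w, B v w = B w v)
    (hnd : ∀ v, (∀ w, B v w = 0) → v = 0) :
    ∃ u : V, B u u = 1 ∧ ∀ w, B u w = 0 ↔ ⟪u, w⟫_ℂ = 0 := by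
  have : CompleteSpace V := FiniteDimensional.complete ℂ V
  let _ : InnerProductSpace ℝ V := InnerProductSpace.complexToReal
  -- `T` represents `B` through the inner product. It is conjugate-linear, hence real-linear, and
  -- the symmetry of `B` makes it self-adjoint for the real inner product. The real spectral theorem
  -- then provides an eigenvector.
  let T : V →ₗ[ℝ] V :=
    { toFun := fun v => (InnerProductSpace.toDual ℂ V).symm (LinearMap.toContinuousLinearMap (B v))
      map_add' := fun v w => by simp
      map_smul' := fun r v => by
        have h1 : B (r • v) = (r : ℂ) • B v := by
          rw [← map_smul, Complex.coe_smul]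
        rw [h1, map_smul, map_smulₛₗ]
        simp }
  have hT : ∀ v w, ⟪T v, w⟫_ℂ = B v w := fun v w => InnerProductSpace.toDual_symm_apply
  have hsymm : LinearMap.IsSymmetric (𝕜 := ℝ) (E := V) T := by
    intro v w
    rw [real_inner_comm, real_inner_eq_re_inner ℂ, real_inner_eq_re_inner ℂ, ← inner_conj_symm, hT,
      RCLike.conj_re, ← RCLike.conj_re ⟪v, T w⟫_ℂ, inner_conj_symm, hT, hB]
  have hpos : 0 < Module.finrank ℝ V := by
    have : Nontrivial V := inferInstance
    exact Module.finrank_pos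
  obtain ⟨hev, hne⟩ := hsymm.hasEigenvector_eigenvectorBasis rfl ⟨0, hpos⟩
  set v := hsymm.eigenvectorBasis rfl ⟨0, hpos⟩
  set l : ℝ := hsymm.eigenvalues rfl ⟨0, hpos⟩
  have hTv : T v = (l : ℂ) • v := by
    rw [Complex.coe_smul]; exact Module.End.mem_eigenspace_iff.1 hev
  have hBv : ∀ w, B v w = l * ⟪v, w⟫_ℂ := fun w => by
    rw [← hT, hTv, inner_smul_left, Complex.conj_ofReal]
  have hl : (l : ℂ) ≠ 0 := by
    intro h
    exact hne (hnd v fun w => by rw [hBv, h, zero_mul])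
  have hBvv : B v v ≠ 0 := by
    rw [hBv]
    exact mul_ne_zero hl (inner_self_ne_zero.2 hne)
  -- A complex square root of `1 / B(v, v)` normalizes both modulus and phase.
  obtain ⟨μ, hμ⟩ := IsAlgClosed.exists_eq_mul_self (B v v)⁻¹
  have hμ0 : μ ≠ 0 := by
    rintro rfl
    exact inv_ne_zero hBvv (by simpa using hμ)
  refine ⟨μ • v, ?_, fun w => ?_⟩
  · simp only [map_smul, LinearMap.smul_apply, smul_eq_mul]
    rw [← mul_assoc, ← hμ, inv_mul_cancel₀ hBvv]
  · simp only [map_smul, LinearMap.smul_apply, smul_eq_mul, hBv, inner_smul_left, mul_eq_zero, hμ0,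
      hl, false_or, map_eq_zero]

/-- **Autonne–Takagi factorization**: a nondegenerate symmetric bilinear form on a complex inner
product space has an orthonormal basis of orthogonal vectors. -/
theorem exists_takagi_family (n : ℕ) {V : Type u} [NormedAddCommGroup V] [InnerProductSpace ℂ V]
    [FiniteDimensional ℂ V] (hn : Module.finrank ℂ V = n) (B : V →ₗ[ℂ] V →ₗ[ℂ] ℂ)
    (hB : ∀ v w, B v w = B w v) (hnd : ∀ v, (∀ w, B v w = 0) → v = 0) :
    ∃ b : Fin n → V, (∀ i j, B (b i) (b j) = if i = j then 1 else 0) ∧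
      ∀ i j, i ≠ j → ⟪b i, b j⟫_ℂ = 0 := by
  induction n generalizing V with
  | zero => exact ⟨Fin.elim0, fun i => i.elim0, fun i => i.elim0⟩
  | succ n ih =>
    have : Nontrivial V := Module.nontrivial_of_finrank_pos (R := ℂ) (by omega)
    obtain ⟨u, hu1, hu⟩ := exists_takagi_vector B hB hnd
    have hu0 : u ≠ 0 := by rintro rfl; simp at hu1
    let W : Submodule ℂ V := (ℂ ∙ u)ᗮ
    have hW : ∀ w ∈ W, B u w = 0 := fun w hw =>
      (hu w).2 (Submodule.mem_orthogonal_singleton_iff_inner_right.1 hw)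
    have hfr : Module.finrank ℂ W = n := by
      have : Fact (Module.finrank ℂ V = n + 1) := ⟨hn⟩
      exact Submodule.finrank_orthogonal_span_singleton hu0
    obtain ⟨b, hb1, hb2⟩ := ih hfr (B.domRestrict₁₂ W W) (fun v w => hB _ _) (by
      rintro ⟨v, hv⟩ h
      refine Subtype.ext (hnd v fun w => ?_)
      -- Because `B(u, u) = 1`, subtracting the `B`-component along `u` lands in `W`. Nondegeneracy
      -- on `V` thus passes to `W`.
      have hw : w - B u w • u ∈ W := by
        refine Submodule.mem_orthogonal_singleton_iff_inner_right.2 ((hu _).1 ?_)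
        simp [hu1]
      have h1 : B v (w - B u w • u) = 0 := h ⟨_, hw⟩
      rw [map_sub, map_smul, hB v u, hW v hv, smul_zero, sub_zero] at h1
      exact h1)
    refine ⟨Fin.cons u fun i => (b i : V), fun i j => ?_, fun i j => ?_⟩
    · refine Fin.cases ?_ (fun i => ?_) i <;> refine Fin.cases ?_ (fun j => ?_) j
      · simpa using hu1
      · simpa [(Fin.succ_ne_zero j).symm] using hW _ (b j).2
      · simpa [hB _ u] using hW _ (b i).2
      · simpa [LinearMap.domRestrict₁₂_apply] using hb1 i j
    · refine Fin.cases ?_ (fun i => ?_) i <;> refine Fin.cases ?_ (fun j => ?_) j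
      · simp
      · intro _
        simpa using (hu _).1 (hW _ (b j).2)
      · intro _
        simpa using inner_eq_zero_symm.1 ((hu _).1 (hW _ (b i).2))
      · intro hij
        simpa using hb2 i j (fun h => hij (congrArg _ h))

/-- Autonne–Takagi factorization for a pair of a nondegenerate symmetric bilinear form and a
positive definite Hermitian form. -/
theorem exists_takagi_family_of_form {n : ℕ} {V : Type u} [AddCommGroup V] [Module ℂ V]
    [FiniteDimensional ℂ V] (hn : Module.finrank ℂ V = n)
    (B : V →ₗ[ℂ] V →ₗ[ℂ] ℂ) (hB : ∀ v w, B v w = B w v) (hnd : ∀ v, (∀ w, B v w = 0) → v = 0)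
    (H : V →ₗ[ℂ] V →ₗ⋆[ℂ] ℂ) (hH : ∀ v w, H v w = conj (H w v))
    (hpos : ∀ v, v ≠ 0 → 0 < (H v v).re) :
    ∃ b : Fin n → V, (∀ i j, B (b i) (b j) = if i = j then 1 else 0) ∧
      ∀ i j, (H (b i) (b j)).im = 0 := by
  let core : InnerProductSpace.Core ℂ V :=
    -- The arguments are swapped because the inner product is conjugate-linear in the first variable
    -- and `H` in the second.
    { inner := fun v w => H w v
      conj_inner_symm := fun v w => (hH w v).symm
      re_inner_nonneg := fun v => by
        rcases eq_or_ne v 0 with rfl | h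
        · simp
        · exact (hpos v h).le
      add_left := fun v w z => by simp
      smul_left := fun v w r => by simp
      definite := fun v hv => by
        by_contra h
        have := hpos v h
        rw [hv] at this
        simp at this }
  let _ : NormedAddCommGroup V := core.toNormedAddCommGroup
  let _ : InnerProductSpace ℂ V := InnerProductSpace.ofCore core.toCore
  obtain ⟨b, hb1, hb2⟩ := exists_takagi_family n hn B hB hnd
  refine ⟨b, hb1, fun i j => ?_⟩
  rcases eq_or_ne j i with rfl | h
  · exact Complex.conj_eq_iff_im.1 (hH _ _).symm
  · have h1 : H (b i) (b j) = 0 := hb2 j i h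
    simp [h1]

end Takagi


/-! ### The holomorphic Morse lemma -/

section MorseLemma

/-- Square roots near the identity of a complete normed algebra. -/
theorem exists_local_sqrt (𝔸 : Type*) [NormedRing 𝔸] [NormedAlgebra ℂ 𝔸] [CompleteSpace 𝔸] :
    ∃ s : 𝔸 → 𝔸, s 1 = 1 ∧ (∀ᶠ M in 𝓝 1, DifferentiableAt ℂ s M) ∧
      (∀ᶠ M in 𝓝 1, s M * s M = M) ∧ ∀ᶠ Y in 𝓝 1, s (Y * Y) = Y := by
  have hsm : ContDiffAt ℂ 1 (fun Y : 𝔸 => Y * Y) 1 := contDiffAt_id.mul contDiffAt_id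
  -- The derivative of squaring at `1` is multiplication by `2`, so the inverse function theorem
  -- applies even in a noncommutative algebra.
  let L : 𝔸 ≃L[ℂ] 𝔸 := ContinuousLinearEquiv.smulLeft (Units.mk0 (2 : ℂ) two_ne_zero)
  have hd : HasFDerivAt (fun Y : 𝔸 => Y * Y) (L : 𝔸 →L[ℂ] 𝔸) 1 := by
    have := (hasFDerivAt_id (𝕜 := ℂ) (1 : 𝔸)).mul' (hasFDerivAt_id (𝕜 := ℂ) (1 : 𝔸))
    refine this.congr_fderiv ?_
    ext x
    simp [L, two_smul, Units.smul_def]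
  have hst := hsm.hasStrictFDerivAt' hd one_ne_zero
  have h1 := hsm.to_localInverse hd one_ne_zero
  have h2 := hst.eventually_right_inverse
  simp only [mul_one] at h1 h2
  refine ⟨hsm.localInverse hd one_ne_zero, ?_, ?_, h2, hst.eventually_left_inverse⟩
  · simpa using hsm.localInverse_apply_image hd one_ne_zero
  · filter_upwards [h1.eventually (by simp)] with M hM using hM.differentiableAt one_ne_zero

variable {E F : Type*} [NormedAddCommGroup E] [NormedSpace ℂ E] [NormedAddCommGroup F]
  [NormedSpace ℂ F]

/-- The weighted averages along rays `z ↦ ∫₀¹ (1 - t) g(tz) dt` of a holomorphic function. -/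
theorem differentiableOn_integral_ray [FiniteDimensional ℂ E] [CompleteSpace F] {g : E → F} {r : ℝ}
    (hg : ContDiffOn ℂ 1 g (Metric.ball 0 r)) :
    DifferentiableOn ℂ (fun z => ∫ t in (0 : ℝ)..1, (1 - (t : ℂ)) • g ((t : ℂ) • z))
      (Metric.ball 0 r) := by
  have : ProperSpace E := FiniteDimensional.proper ℂ E
  intro z₀ hz₀
  rw [mem_ball_zero_iff] at hz₀
  obtain ⟨ρ, hρ0, hρ⟩ := exists_between hz₀
  have hsub : Metric.closedBall (0 : E) ρ ⊆ Metric.ball 0 r := Metric.closedBall_subset_ball hρ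
  have hcd : ContinuousOn (fderiv ℂ g) (Metric.ball 0 r) :=
    hg.continuousOn_fderiv_of_isOpen Metric.isOpen_ball le_rfl
  obtain ⟨C, hC⟩ := (isCompact_closedBall (0 : E) ρ).exists_bound_of_continuousOn (hcd.mono hsub)
  have hball : ∀ z ∈ Metric.ball (0 : E) ρ, ∀ t : ℝ, t ∈ Icc (0 : ℝ) 1 →
      (t : ℂ) • z ∈ Metric.closedBall (0 : E) ρ := by
    intro z hz t ht
    rw [mem_ball_zero_iff] at hz
    rw [mem_closedBall_zero_iff, norm_smul, Complex.norm_real, Real.norm_of_nonneg ht.1]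
    nlinarith [ht.1, ht.2, norm_nonneg z]
  have hmaps : ∀ z ∈ Metric.ball (0 : E) ρ,
      MapsTo (fun t : ℝ => (t : ℂ) • z) (Icc (0 : ℝ) 1) (Metric.ball 0 r) :=
    fun z hz t ht => hsub (hball z hz t ht)
  have hz₀' : z₀ ∈ Metric.ball (0 : E) ρ := mem_ball_zero_iff.2 hρ0
  have hcont : ∀ z ∈ Metric.ball (0 : E) ρ,
      ContinuousOn (fun t : ℝ => (1 - (t : ℂ)) • g ((t : ℂ) • z)) (Icc (0 : ℝ) 1) := by
    intro z hz
    refine ContinuousOn.smul (by fun_prop) (hg.continuousOn.comp ?_ (hmaps z hz))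
    exact Continuous.continuousOn (by fun_prop)
  have huIoc : uIoc (0 : ℝ) 1 ⊆ Icc 0 1 := by
    rw [uIoc_of_le zero_le_one]; exact Ioc_subset_Icc_self
  have huIcc : uIcc (0 : ℝ) 1 = Icc 0 1 := uIcc_of_le zero_le_one
  refine (intervalIntegral.hasFDerivAt_integral_of_dominated_of_fderiv_le
    (F' := fun z t => ((1 - (t : ℂ)) * t) • fderiv ℂ g ((t : ℂ) • z)) (bound := fun _ => C)
    (Metric.isOpen_ball.mem_nhds hz₀') ?_ ?_ ?_ ?_ ?_
    ?_).differentiableAt.differentiableWithinAt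
  · filter_upwards [Metric.isOpen_ball.mem_nhds hz₀'] with z hz
    exact ((hcont z hz).mono huIoc).aestronglyMeasurable measurableSet_uIoc
  · exact ContinuousOn.intervalIntegrable (by rw [huIcc]; exact hcont z₀ hz₀')
  · refine ContinuousOn.aestronglyMeasurable (ContinuousOn.mono ?_ huIoc) measurableSet_uIoc
    have h0 : ContinuousOn (fun t : ℝ => (1 - (t : ℂ)) * t) (Icc 0 1) := by fun_prop
    refine h0.smul (hcd.comp ?_ (hmaps z₀ hz₀'))
    exact Continuous.continuousOn (by fun_prop)
  · refine .of_forall fun t ht z hz => ?_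
    have ht' := huIoc ht
    have h1 := hC _ (hball z hz t ht')
    have h2 : ‖(1 - (t : ℂ)) * t‖ ≤ 1 := by
      rw [← Complex.ofReal_one, ← Complex.ofReal_sub, ← Complex.ofReal_mul, Complex.norm_real,
        Real.norm_of_nonneg (mul_nonneg (by linarith [ht'.2]) ht'.1)]
      nlinarith [ht'.1, ht'.2]
    rw [norm_smul]
    calc _ ≤ 1 * C := by gcongr
      _ = C := one_mul C
  · exact intervalIntegrable_const
  · refine .of_forall fun t ht z hz => ?_
    have ht' := huIoc ht
    have h1 : HasFDerivAt g (fderiv ℂ g ((t : ℂ) • z)) ((t : ℂ) • z) :=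
      ((hg.differentiableOn one_ne_zero).differentiableAt
        (Metric.isOpen_ball.mem_nhds (hmaps z hz ht'))).hasFDerivAt
    have h2 := (h1.comp z ((hasFDerivAt_id (𝕜 := ℂ) z).const_smul (t : ℂ))).const_smul (1 - (t : ℂ))
    refine h2.congr_fderiv ?_
    rw [ContinuousLinearMap.comp_smul, ContinuousLinearMap.comp_id, smul_smul]

/-- Taylor's formula of order two at a critical point, with integral remainder. -/
theorem eq_add_integral_of_fderiv_eq_zero {f : E → ℂ} {r : ℝ}
    (hf : ContDiffOn ℂ 2 f (Metric.ball 0 r)) (h0 : fderiv ℂ f 0 = 0) {z : E}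
    (hz : z ∈ Metric.ball (0 : E) r) :
    f z = f 0 + ∫ t in (0 : ℝ)..1, (1 - (t : ℂ)) • fderiv ℂ (fderiv ℂ f) ((t : ℂ) • z) z z := by
  have hmaps : ∀ t ∈ Icc (0 : ℝ) 1, (t : ℂ) • z ∈ Metric.ball (0 : E) r := by
    intro t ht
    rw [mem_ball_zero_iff] at *
    rw [norm_smul, Complex.norm_real, Real.norm_of_nonneg ht.1]
    nlinarith [ht.1, ht.2, norm_nonneg z]
  have huIcc : uIcc (0 : ℝ) 1 = Icc 0 1 := uIcc_of_le zero_le_one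
  have hf1 : ContDiffOn ℂ 1 (fderiv ℂ f) (Metric.ball 0 r) :=
    hf.fderiv_of_isOpen Metric.isOpen_ball (by norm_num)
  have hray : ∀ t : ℝ, HasDerivAt (fun t : ℝ => (t : ℂ) • z) z t := by
    intro t
    have := (Complex.ofRealCLM.hasDerivAt (x := t)).smul_const z
    simpa using this
  -- An explicit antiderivative of the remainder: its value is `f z` at `t = 1` and `Df(0) z + f 0 =
  -- f 0` at `t = 0`.
  have hd : ∀ t ∈ uIcc (0 : ℝ) 1, HasDerivAt
      (fun t : ℝ => (1 - (t : ℂ)) * fderiv ℂ f ((t : ℂ) • z) z + f ((t : ℂ) • z))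
      ((1 - (t : ℂ)) • fderiv ℂ (fderiv ℂ f) ((t : ℂ) • z) z z) t := by
    intro t ht
    rw [huIcc] at ht
    have hnhds := Metric.isOpen_ball.mem_nhds (hmaps t ht)
    have h1 : HasDerivAt (fun t : ℝ => f ((t : ℂ) • z)) (fderiv ℂ f ((t : ℂ) • z) z) t := by
      have := ((hf.differentiableOn two_ne_zero).differentiableAt hnhds).hasFDerivAt
      exact (this.restrictScalars ℝ).comp_hasDerivAt t (hray t)
    have h2 : HasDerivAt (fun t : ℝ => fderiv ℂ f ((t : ℂ) • z))
        (fderiv ℂ (fderiv ℂ f) ((t : ℂ) • z) z) t := by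
      have := ((hf1.differentiableOn one_ne_zero).differentiableAt hnhds).hasFDerivAt
      exact (this.restrictScalars ℝ).comp_hasDerivAt t (hray t)
    have h3 : HasDerivAt (fun t : ℝ => fderiv ℂ f ((t : ℂ) • z) z)
        (fderiv ℂ (fderiv ℂ f) ((t : ℂ) • z) z z) t :=
      ((((ContinuousLinearMap.apply ℂ ℂ z).hasFDerivAt).restrictScalars ℝ).comp_hasDerivAt t h2)
    have h4 : HasDerivAt (fun t : ℝ => 1 - (t : ℂ)) (-1) t := by
      have := (Complex.ofRealCLM.hasDerivAt (x := t)).const_sub 1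
      simpa using this
    refine ((h4.mul h3).add h1).congr_deriv ?_
    simp
  have hint : IntervalIntegrable
      (fun t : ℝ => (1 - (t : ℂ)) • fderiv ℂ (fderiv ℂ f) ((t : ℂ) • z) z z)
      MeasureTheory.volume 0 1 := by
    refine ContinuousOn.intervalIntegrable ?_
    rw [huIcc]
    have h0 : ContinuousOn (fun t : ℝ => 1 - (t : ℂ)) (Icc 0 1) := by fun_prop
    refine h0.smul ?_
    have h1 := (hf1.continuousOn_fderiv_of_isOpen Metric.isOpen_ball le_rfl).comp
      (Continuous.continuousOn (s := Icc (0 : ℝ) 1) (f := fun t : ℝ => (t : ℂ) • z) (by fun_prop))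
      hmaps
    exact (h1.clm_apply continuousOn_const).clm_apply continuousOn_const
  rw [intervalIntegral.integral_eq_sub_of_hasDerivAt hd hint]
  simp [h0]

/-- The holomorphic inverse function theorem, with a chart as conclusion. -/
theorem exists_analytic_chart [FiniteDimensional ℂ E] {φ : E → E} {W : Set E} (hW : IsOpen W)
    (h0 : (0 : E) ∈ W) (hφ : DifferentiableOn ℂ φ W)
    (hd : HasFDerivAt φ (ContinuousLinearMap.id ℂ E) 0) :
    ∃ e : OpenPartialHomeomorph E E, ⇑e = φ ∧ 0 ∈ e.source ∧ e.source ⊆ W ∧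
      ContDiffOn ℂ ω e e.source ∧ ContDiffOn ℂ ω e.symm e.target := by
  have : CompleteSpace E := FiniteDimensional.complete ℂ E
  have hsm : ContDiffOn ℂ ω φ W := (hφ.analyticOnNhd_of_isOpen hW).contDiffOn hW.uniqueDiffOn
  have hat : ContDiffAt ℂ ω φ 0 := hsm.contDiffAt (hW.mem_nhds h0)
  have hd' : HasFDerivAt φ ((ContinuousLinearEquiv.refl ℂ E : E ≃L[ℂ] E) : E →L[ℂ] E) 0 := hd
  let e := hat.toOpenPartialHomeomorph φ hd' (by simp)
  have he : ∀ x, e x = φ x := fun x => rfl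
  -- The source is shrunk to points with invertible derivative, so that the inverse is analytic on
  -- the whole target.
  let N : Set E := W ∩ fderiv ℂ φ ⁻¹' range ((↑) : (E ≃L[ℂ] E) → E →L[ℂ] E)
  have hN : IsOpen N := (hsm.continuousOn_fderiv_of_isOpen hW (by simp)).isOpen_inter_preimage hW
    ContinuousLinearEquiv.isOpen
  have hsub : (e.restrOpen N hN).source ⊆ N := by
    rw [OpenPartialHomeomorph.restrOpen_source]; exact inter_subset_right
  refine ⟨e.restrOpen N hN, rfl, ?_, hsub.trans inter_subset_left,
    hsm.mono (hsub.trans inter_subset_left), fun w hw => ?_⟩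
  · rw [OpenPartialHomeomorph.restrOpen_source]
    exact ⟨hat.mem_toOpenPartialHomeomorph_source hd' (by simp), h0,
      ⟨ContinuousLinearEquiv.refl ℂ E, hd'.fderiv.symm⟩⟩
  · obtain ⟨hwW, L, hL⟩ := hsub ((e.restrOpen N hN).map_target hw)
    refine ((e.restrOpen N hN).contDiffAt_symm hw (f₀' := L) ?_
      (hsm.contDiffAt (hW.mem_nhds hwW))).contDiffWithinAt
    rw [hL]
    exact (hφ.differentiableAt (hW.mem_nhds hwW)).hasFDerivAt

open scoped Matrix Matrix.Norms.Operator in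
/-- **Holomorphic Morse lemma**, normalized so that the derivative of the chart is the identity. -/
theorem exists_morse_chart {n : ℕ} {f : CSpace n → ℂ} {U : Set (CSpace n)} (hU : IsOpen U)
    (h0U : (0 : CSpace n) ∈ U) (hf : DifferentiableOn ℂ f U) (hf0 : fderiv ℂ f 0 = 0)
    (hH : ∀ v w : CSpace n, fderiv ℂ (fderiv ℂ f) 0 v w = ∑ j, v j * w j) :
    ∃ e : OpenPartialHomeomorph (CSpace n) (CSpace n), 0 ∈ e.source ∧ e.source ⊆ U ∧ e 0 = 0 ∧
      ContDiffOn ℂ ω e e.source ∧ ContDiffOn ℂ ω e.symm e.target ∧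
      HasFDerivAt e (ContinuousLinearMap.id ℂ (CSpace n)) 0 ∧
      ∀ z ∈ e.source, f z = f 0 + (1 / 2 : ℂ) * ∑ j, (e z j) ^ 2 := by
  obtain ⟨r, hr, hrU⟩ := Metric.isOpen_iff.1 hU 0 h0U
  have hfω : ContDiffOn ℂ ω f (Metric.ball 0 r) :=
    ((hf.mono hrU).analyticOnNhd_of_isOpen Metric.isOpen_ball).contDiffOn
      Metric.isOpen_ball.uniqueDiffOn
  have hf1 : ContDiffOn ℂ ω (fderiv ℂ f) (Metric.ball 0 r) :=
    hfω.fderiv_of_isOpen Metric.isOpen_ball (by simp)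
  have hf2 : ContDiffOn ℂ ω (fderiv ℂ (fderiv ℂ f)) (Metric.ball 0 r) :=
    hf1.fderiv_of_isOpen Metric.isOpen_ball (by simp)
  let b : Fin n → CSpace n := fun j => EuclideanSpace.single j 1
  -- the matrix of averaged second derivatives
  let m : Fin n → Fin n → CSpace n → ℂ := fun i j z =>
    2 * ∫ t in (0 : ℝ)..1, (1 - (t : ℂ)) • fderiv ℂ (fderiv ℂ f) ((t : ℂ) • z) (b i) (b j)
  let M : CSpace n → Matrix (Fin n) (Fin n) ℂ := fun z => Matrix.of fun i j => m i j z
  have hMd : DifferentiableOn ℂ M (Metric.ball 0 r) := by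
    have hm : ∀ i j, DifferentiableOn ℂ (m i j) (Metric.ball 0 r) := fun i j =>
      (differentiableOn_integral_ray (g := fun z => fderiv ℂ (fderiv ℂ f) z (b i) (b j))
        (((hf2.of_le le_top).clm_apply contDiffOn_const).clm_apply contDiffOn_const)).const_mul 2
    have h1 : M = fun z => ∑ i, ∑ j, m i j z • Matrix.single i j (1 : ℂ) := by
      funext z
      rw [Matrix.matrix_eq_sum_single (M z)]
      simp [M]
    rw [h1]
    exact DifferentiableOn.fun_sum fun i _ => DifferentiableOn.fun_sum fun j _ =>
      (hm i j).smul_const _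
  -- The factor `2` in `m` compensates `∫₀¹ (1 - t) dt = 1 / 2`, so `M 0` is the Hessian itself,
  -- here the identity.
  have hM0 : M 0 = 1 := by
    ext i j
    have : ∫ t in (0 : ℝ)..1, (1 - (t : ℂ)) = 1 / 2 := by
      have h1 : ∀ t : ℝ, (1 - (t : ℂ)) = ((1 - t : ℝ) : ℂ) := fun t => by push_cast; rfl
      simp_rw [h1]
      rw [intervalIntegral.integral_ofReal, intervalIntegral.integral_sub (by simp) (by simp)]
      norm_num
    simp only [M, m, Matrix.of_apply, smul_zero, hH]
    rw [intervalIntegral.integral_smul_const, this]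
    simp [b, Matrix.one_apply, eq_comm]
  have hMT : ∀ z ∈ Metric.ball (0 : CSpace n) r, (M z)ᵀ = M z := by
    intro z hz
    ext i j
    simp only [M, m, Matrix.transpose_apply, Matrix.of_apply]
    congr 1
    refine intervalIntegral.integral_congr fun t ht => ?_
    rw [uIcc_of_le zero_le_one] at ht
    have hmem : (t : ℂ) • z ∈ Metric.ball (0 : CSpace n) r := by
      rw [mem_ball_zero_iff] at *
      rw [norm_smul, Complex.norm_real, Real.norm_of_nonneg ht.1]
      nlinarith [ht.1, ht.2, norm_nonneg z]
    have hs := (hfω.contDiffAt (Metric.isOpen_ball.mem_nhds hmem)).isSymmSndFDerivAt (by simp)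
    simp only [hs.eq (b j) (b i)]
  have hfM : ∀ z ∈ Metric.ball (0 : CSpace n) r,
      f z = f 0 + (1 / 2 : ℂ) * ∑ i, ∑ j, z i * z j * M z i j := by
    intro z hz
    rw [eq_add_integral_of_fderiv_eq_zero (hfω.of_le le_top) hf0 hz]
    have hzb : z = ∑ i, z i • b i := by
      ext j
      simp [b, Finset.sum_apply, Pi.single_apply]
    have hexp : ∀ w, fderiv ℂ (fderiv ℂ f) w z z =
        ∑ i, ∑ j, z i * z j * fderiv ℂ (fderiv ℂ f) w (b i) (b j) := by
      intro w
      conv_lhs => rw [hzb]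
      simp only [map_sum, map_smul, sum_apply, smul_apply,
        smul_eq_mul, Finset.mul_sum]
      rw [Finset.sum_comm]
      exact Finset.sum_congr rfl fun i _ => Finset.sum_congr rfl fun j _ => by ring
    have hmaps : ∀ t ∈ Icc (0 : ℝ) 1, (t : ℂ) • z ∈ Metric.ball (0 : CSpace n) r := by
      intro t ht
      rw [mem_ball_zero_iff] at *
      rw [norm_smul, Complex.norm_real, Real.norm_of_nonneg ht.1]
      nlinarith [ht.1, ht.2, norm_nonneg z]
    have hint : ∀ i j, IntervalIntegrable (fun t : ℝ => z i * z j * ((1 - (t : ℂ)) •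
        fderiv ℂ (fderiv ℂ f) ((t : ℂ) • z) (b i) (b j))) MeasureTheory.volume 0 1 := by
      intro i j
      refine ContinuousOn.intervalIntegrable ?_
      rw [uIcc_of_le zero_le_one]
      have h0 : ContinuousOn (fun t : ℝ => 1 - (t : ℂ)) (Icc 0 1) := by fun_prop
      have h1 := hf2.continuousOn.comp
        (Continuous.continuousOn (s := Icc (0 : ℝ) 1) (f := fun t : ℝ => (t : ℂ) • z) (by fun_prop))
        hmaps
      exact continuousOn_const.mul
        (h0.smul ((h1.clm_apply continuousOn_const).clm_apply continuousOn_const))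
    have hsum : ∀ t : ℝ, (1 - (t : ℂ)) • fderiv ℂ (fderiv ℂ f) ((t : ℂ) • z) z z =
        ∑ i, ∑ j, z i * z j * ((1 - (t : ℂ)) •
          fderiv ℂ (fderiv ℂ f) ((t : ℂ) • z) (b i) (b j)) := by
      intro t
      rw [hexp, smul_eq_mul, Finset.mul_sum]
      refine Finset.sum_congr rfl fun i _ => ?_
      rw [Finset.mul_sum]
      exact Finset.sum_congr rfl fun j _ => by rw [smul_eq_mul]; ring
    simp_rw [hsum]
    rw [intervalIntegral.integral_finsetSum fun i _ => ?_]
    · rw [Finset.mul_sum]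
      congr 1
      refine Finset.sum_congr rfl fun i _ => ?_
      rw [intervalIntegral.integral_finsetSum fun j _ => hint i j, Finset.mul_sum]
      refine Finset.sum_congr rfl fun j _ => ?_
      rw [intervalIntegral.integral_const_mul]
      simp only [M, m, Matrix.of_apply]
      ring
    · simpa only [Finset.sum_fn] using! IntervalIntegrable.sum Finset.univ fun j _ => hint i j
  obtain ⟨s, hs1, hsd, hsq, hsu⟩ := exists_local_sqrt (Matrix (Fin n) (Fin n) ℂ)
  have hMc : ContinuousAt M 0 :=
    hMd.continuousOn.continuousAt (Metric.isOpen_ball.mem_nhds (Metric.mem_ball_self hr))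
  have hMt : Tendsto M (𝓝 0) (𝓝 1) := by rw [← hM0]; exact hMc
  -- Used to show that the root `Y` of a symmetric `A` is symmetric: `Yᵀ Yᵀ = (Y Y)ᵀ = A`, and `Yᵀ`
  -- is near `1`, where roots are unique.
  have hsT : ∀ᶠ A in 𝓝 (1 : Matrix (Fin n) (Fin n) ℂ), s ((s A)ᵀ * (s A)ᵀ) = (s A)ᵀ := by
    have h1 : ContinuousAt s 1 := hsd.self_of_nhds.continuousAt
    have h2 : Tendsto (fun A => (s A)ᵀ) (𝓝 1) (𝓝 (1 : Matrix (Fin n) (Fin n) ℂ)) := by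
      have h3 : Continuous (Matrix.transpose : Matrix (Fin n) (Fin n) ℂ → _) :=
        continuous_id.matrix_transpose
      have h4 := h3.continuousAt.tendsto.comp h1.tendsto
      rwa [hs1, Matrix.transpose_one] at h4
    exact h2.eventually hsu
  have hev : ∀ᶠ z in 𝓝 (0 : CSpace n), z ∈ Metric.ball (0 : CSpace n) r ∧
      DifferentiableAt ℂ s (M z) ∧ s (M z) * s (M z) = M z ∧ (s (M z))ᵀ = s (M z) := by
    filter_upwards [Metric.isOpen_ball.mem_nhds (Metric.mem_ball_self hr), hMt.eventually hsd,
      hMt.eventually hsq, hMt.eventually hsT] with z h1 h2 h3 h4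
    refine ⟨h1, h2, h3, ?_⟩
    rw [← Matrix.transpose_mul, h3, hMT z h1] at h4
    exact h4.symm
  obtain ⟨W, hW, hWo, h0W⟩ := mem_nhds_iff.1 hev
  let Λ : Matrix (Fin n) (Fin n) ℂ →L[ℂ] (CSpace n →L[ℂ] CSpace n) :=
    LinearMap.toContinuousLinearMap
      (Matrix.toEuclideanCLM (n := Fin n) (𝕜 := ℂ)).toAlgEquiv.toLinearMap
  have hΛ : ∀ A z, Λ A z = WithLp.toLp 2 (A *ᵥ z.ofLp) := fun A z => rfl
  -- With `Y = s (M z)` symmetric, the squares of the coordinates of `Y z` add up to `zᵀ Y Y z = zᵀ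
  -- M(z) z`, which is `2 (f z - f 0)`.
  let φ : CSpace n → CSpace n := fun z => Λ (s (M z)) z
  have hΛd : ∀ z ∈ W, DifferentiableAt ℂ (fun z => Λ (s (M z))) z := by
    intro z hz
    have h1 := hMd.differentiableAt (Metric.isOpen_ball.mem_nhds (hW hz).1)
    exact Λ.differentiableAt.comp z ((hW hz).2.1.comp z h1)
  have hφd : DifferentiableOn ℂ φ W := fun z hz =>
    ((hΛd z hz).clm_apply differentiableAt_id).differentiableWithinAt
  have hΛ1 : Λ 1 = ContinuousLinearMap.id ℂ (CSpace n) := by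
    ext z : 1
    rw [hΛ, Matrix.one_mulVec]
    rfl
  have hφ0 : HasFDerivAt φ (ContinuousLinearMap.id ℂ (CSpace n)) 0 := by
    -- The product-rule term with the derivative of the root is applied to the vector `0` and drops
    -- out.
    refine ((hΛd 0 h0W).hasFDerivAt.clm_apply (hasFDerivAt_id 0)).congr_fderiv ?_
    rw [hM0, hs1, hΛ1]
    ext v : 1
    simp
  obtain ⟨e, he, h0e, heW, he1, he2⟩ := exists_analytic_chart hWo h0W hφd hφ0
  refine ⟨e, h0e, fun z hz => hrU (hW (heW hz)).1, ?_, he1, he2, he ▸ hφ0, fun z hz => ?_⟩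
  · rw [he]; exact map_zero (Λ (s (M 0)))
  · obtain ⟨h1, -, h3, h4⟩ := hW (heW hz)
    rw [hfM z h1]
    congr 2
    have h5 : ∀ j, (e z j) ^ 2 = (s (M z) *ᵥ z.ofLp) j * (s (M z) *ᵥ z.ofLp) j := fun j => by
      rw [he, sq]; rfl
    simp_rw [h5]
    change _ = (s (M z) *ᵥ z.ofLp) ⬝ᵥ (s (M z) *ᵥ z.ofLp)
    rw [Matrix.dotProduct_mulVec, ← Matrix.mulVec_transpose, Matrix.mulVec_mulVec, h4, h3]
    simp only [dotProduct, Matrix.mulVec]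
    refine Finset.sum_congr rfl fun i _ => ?_
    rw [Finset.sum_mul]
    exact Finset.sum_congr rfl fun j _ => by ring

end MorseLemma


/-! ### Holomorphic charts as real charts; velocities read in a chart -/

section HolomorphicCharts

theorem mem_contDiffGroupoid_self_iff {𝕜 E : Type*} [NontriviallyNormedField 𝕜]
    [NormedAddCommGroup E] [NormedSpace 𝕜 E] {m : WithTop ℕ∞} {e : OpenPartialHomeomorph E E} :
    e ∈ contDiffGroupoid m 𝓘(𝕜, E) ↔
      ContDiffOn 𝕜 m e e.source ∧ ContDiffOn 𝕜 m e.symm e.target := by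
  rw [contDiffGroupoid, mem_groupoid_of_pregroupoid]
  simp [contDiffPregroupoid]

theorem StructureGroupoid.trans_mem_maximalAtlas {H M : Type*} [TopologicalSpace H]
    [TopologicalSpace M] [ChartedSpace H M] {G : StructureGroupoid H}
    {e : OpenPartialHomeomorph M H} (he : e ∈ G.maximalAtlas M) {φ : OpenPartialHomeomorph H H}
    (hφ : φ ∈ G) : e ≫ₕ φ ∈ G.maximalAtlas M := by
  intro e' he'
  obtain ⟨h1, h2⟩ := he e' he'
  refine ⟨?_, ?_⟩
  · rw [OpenPartialHomeomorph.trans_symm_eq_symm_trans_symm, OpenPartialHomeomorph.trans_assoc]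
    exact G.trans (G.symm hφ) h1
  · rw [← OpenPartialHomeomorph.trans_assoc]
    exact G.trans h2 hφ

theorem contDiffGroupoid_complex_le_real (n : ℕ) :
    contDiffGroupoid ω 𝓘(ℂ, CSpace n) ≤ contDiffGroupoid ∞ 𝓘(ℝ, CSpace n) := by
  intro e he
  obtain ⟨h1, h2⟩ := mem_contDiffGroupoid_self_iff.1 he
  exact mem_contDiffGroupoid_self_iff.2
    ⟨(h1.restrict_scalars ℝ).of_le le_top, (h2.restrict_scalars ℝ).of_le le_top⟩

theorem HasMFDerivAt.restrictScalars_real {E F M M' : Type*} [NormedAddCommGroup E]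
    [NormedSpace ℂ E] [NormedAddCommGroup F] [NormedSpace ℂ F]
    [TopologicalSpace M] [ChartedSpace E M] [TopologicalSpace M'] [ChartedSpace F M']
    {f : M → M'} {x : M} {f' : E →L[ℂ] F} (h : HasMFDerivAt 𝓘(ℂ, E) 𝓘(ℂ, F) f x f') :
    HasMFDerivAt 𝓘(ℝ, E) 𝓘(ℝ, F) f x (f'.restrictScalars ℝ) :=
  ⟨h.1, HasFDerivWithinAt.restrictScalars ℝ h.2⟩

variable {n : ℕ} {X : Type*} [TopologicalSpace X] [ChartedSpace (CSpace n) X]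

theorem holoCharts_subset_real :
    holoCharts n X ⊆ IsManifold.maximalAtlas 𝓘(ℝ, CSpace n) ∞ X :=
  StructureGroupoid.maximalAtlas_mono (contDiffGroupoid_complex_le_real n)

theorem trans_mem_holoCharts {e : OpenPartialHomeomorph X (CSpace n)} (he : e ∈ holoCharts n X)
    {φ : OpenPartialHomeomorph (CSpace n) (CSpace n)} (h1 : ContDiffOn ℂ ω φ φ.source)
    (h2 : ContDiffOn ℂ ω φ.symm φ.target) : e ≫ₕ φ ∈ holoCharts n X :=
  StructureGroupoid.trans_mem_maximalAtlas he (mem_contDiffGroupoid_self_iff.2 ⟨h1, h2⟩)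

/-- The Hermitian form at a point, on the model space. -/
def HermitianMetric.bilin (h : HermitianMetric n X) (x : X) :
    CSpace n →ₗ[ℂ] CSpace n →ₗ⋆[ℂ] ℂ := h.form x

/-- The derivative of the inverse of a chart, on the model space. -/
noncomputable def chartDeriv (e : OpenPartialHomeomorph X (CSpace n)) (z : CSpace n) :
    CSpace n →L[ℂ] CSpace n := mfderiv 𝓘(ℂ, CSpace n) 𝓘(ℂ, CSpace n) e.symm z

theorem HermitianMetric.coeff_eq (h : HermitianMetric n X)
    (e : OpenPartialHomeomorph X (CSpace n)) (i j : Fin n) (z : CSpace n) :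
    h.coeff e i j z = h.bilin (e.symm z) (chartDeriv e z (EuclideanSpace.single i 1))
      (chartDeriv e z (EuclideanSpace.single j 1)) := rfl

theorem HermitianMetric.bilin_conj_symm (h : HermitianMetric n X) (x : X) (v w : CSpace n) :
    h.bilin x v w = conj (h.bilin x w v) := h.conj_symm x v w

theorem HermitianMetric.bilin_pos (h : HermitianMetric n X) (x : X) {v : CSpace n} (hv : v ≠ 0) :
    0 < (h.bilin x v v).re := h.pos x v hv

variable {e : OpenPartialHomeomorph X (CSpace n)}

theorem hasMFDerivAt_chart_symm (he : e ∈ holoCharts n X) {z : CSpace n} (hz : z ∈ e.target) :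
    HasMFDerivAt 𝓘(ℂ, CSpace n) 𝓘(ℂ, CSpace n) e.symm z (chartDeriv e z) :=
  ((contMDiffAt_symm_of_mem_maximalAtlas he hz).mdifferentiableAt (by simp)).hasMFDerivAt

/-- The derivative of `e ∘ e.symm = id`. Besides the invertibility of `chartDeriv`, this left
inverse serves to read velocities and differentials in the chart. -/
theorem exists_hasMFDerivAt_chart (he : e ∈ holoCharts n X) {z : CSpace n} (hz : z ∈ e.target) :
    ∃ L : CSpace n →L[ℂ] CSpace n, HasMFDerivAt 𝓘(ℂ, CSpace n) 𝓘(ℂ, CSpace n) e (e.symm z) L ∧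
      ∀ v, L (chartDeriv e z v) = v := by
  let L : CSpace n →L[ℂ] CSpace n := mfderiv 𝓘(ℂ, CSpace n) 𝓘(ℂ, CSpace n) e (e.symm z)
  have h1 : HasMFDerivAt 𝓘(ℂ, CSpace n) 𝓘(ℂ, CSpace n) e (e.symm z) L :=
    ((contMDiffAt_of_mem_maximalAtlas he (e.map_target hz)).mdifferentiableAt
      (by simp)).hasMFDerivAt
  refine ⟨L, h1, fun v => ?_⟩
  have h2 : HasFDerivAt (e ∘ e.symm) (L.comp (chartDeriv e z)) z :=
    (HasMFDerivAt.comp z h1 (hasMFDerivAt_chart_symm he hz)).hasFDerivAt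
  have h3 : HasFDerivAt (e ∘ e.symm) (ContinuousLinearMap.id ℂ (CSpace n)) z := by
    refine (hasFDerivAt_id z).congr_of_eventuallyEq ?_
    filter_upwards [e.open_target.mem_nhds hz] with w hw using e.right_inv hw
  exact congrArg (fun A : CSpace n →L[ℂ] CSpace n => A v) (h2.unique h3)

theorem chartDeriv_injective (he : e ∈ holoCharts n X) {z : CSpace n} (hz : z ∈ e.target) :
    Function.Injective (chartDeriv e z) := by
  obtain ⟨L, -, hL⟩ := exists_hasMFDerivAt_chart he hz
  exact Function.LeftInverse.injective hL

theorem chartDeriv_surjective (he : e ∈ holoCharts n X) {z : CSpace n} (hz : z ∈ e.target) :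
    Function.Surjective (chartDeriv e z) :=
  (LinearMap.injective_iff_surjective (f := (chartDeriv e z).toLinearMap)).1
    (chartDeriv_injective he hz)

/-- Velocities of curves, read in a chart. -/
theorem hasDerivWithinAt_chart_comp (he : e ∈ holoCharts n X) {γ : ℝ → X} {T : Set ℝ} {t : ℝ}
    (ht : γ t ∈ e.source) {w : CSpace n}
    (hγ : HasMFDerivWithinAt 𝓘(ℝ, ℝ) 𝓘(ℝ, CSpace n) γ T t
      ((1 : ℝ →L[ℝ] ℝ).smulRight (chartDeriv e (e (γ t)) w))) :
    HasDerivWithinAt (fun s => e (γ s)) w T t := by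
  obtain ⟨L, hL, hL'⟩ := exists_hasMFDerivAt_chart he (e.map_source ht)
  rw [e.left_inv ht] at hL
  have h1 := (hL.restrictScalars_real.comp_hasMFDerivWithinAt t hγ).hasFDerivWithinAt
  have h2 : (L.restrictScalars ℝ).comp
      ((1 : ℝ →L[ℝ] ℝ).smulRight (chartDeriv e (e (γ t)) w)) = (1 : ℝ →L[ℝ] ℝ).smulRight w := by
    ext1
    simp [hL']
  have h3 : HasFDerivWithinAt (e ∘ γ) ((1 : ℝ →L[ℝ] ℝ).smulRight w) T t := h2 ▸ h1
  simpa using! h3.hasDerivWithinAt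

/-- Velocities of curves given in a chart. -/
theorem hasMFDerivWithinAt_symm_comp (he : e ∈ holoCharts n X) {z : ℝ → CSpace n} {T : Set ℝ}
    {t : ℝ} (ht : z t ∈ e.target) {w : CSpace n} (hz : HasDerivWithinAt z w T t) :
    HasMFDerivWithinAt 𝓘(ℝ, ℝ) 𝓘(ℝ, CSpace n) (fun s => e.symm (z s)) T t
      ((1 : ℝ →L[ℝ] ℝ).smulRight (chartDeriv e (z t) w)) := by
  have h0 := hz.hasFDerivWithinAt.hasMFDerivWithinAt
  have h1 := (hasMFDerivAt_chart_symm he ht).restrictScalars_real.comp_hasMFDerivWithinAt t h0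
  have h2 : ((chartDeriv e (z t)).restrictScalars ℝ).comp
      (ContinuousLinearMap.toSpanSingleton ℝ w) =
        (1 : ℝ →L[ℝ] ℝ).smulRight (chartDeriv e (z t) w) := by
    ext1
    simp
  exact h2 ▸ h1

end HolomorphicCharts


/-! ### The descending gradient field in a Morse chart -/

section DescentField

variable {n : ℕ} {X : Type*} [TopologicalSpace X] [ChartedSpace (CSpace n) X]

/-- The transposed coefficient matrix of a Hermitian metric in a chart. -/
noncomputable def HermitianMetric.coeffMatrix (h : HermitianMetric n X)
    (e : OpenPartialHomeomorph X (CSpace n)) (z : CSpace n) : Matrix (Fin n) (Fin n) ℂ :=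
  Matrix.of fun j i => h.coeff e i j z

/-- The coordinate expression `-(hᵀ)⁻¹ z̄` of the descending gradient field in a Morse chart. -/
noncomputable def HermitianMetric.descentField (h : HermitianMetric n X)
    (e : OpenPartialHomeomorph X (CSpace n)) (z : CSpace n) : CSpace n :=
  -WithLp.toLp 2 ((h.coeffMatrix e z)⁻¹.mulVec fun j => conj (z j))

variable {h : HermitianMetric n X} {e : OpenPartialHomeomorph X (CSpace n)}

theorem euclidean_eq_sum_single (v : CSpace n) :
    v = ∑ i, v i • (EuclideanSpace.single i (1 : ℂ) : CSpace n) := by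
  ext j
  simp [Finset.sum_apply, Pi.single_apply]

theorem HermitianMetric.bilin_chartDeriv (h : HermitianMetric n X)
    (e : OpenPartialHomeomorph X (CSpace n)) (z v w : CSpace n) :
    h.bilin (e.symm z) (chartDeriv e z v) (chartDeriv e z w) =
      ∑ j, conj (w j) * ((h.coeffMatrix e z).mulVec v) j := by
  conv_lhs => rw [euclidean_eq_sum_single v, euclidean_eq_sum_single w]
  simp only [map_sum, map_smul, LinearMap.sum_apply, LinearMap.smul_apply, map_smulₛₗ,
    Matrix.mulVec, dotProduct, coeffMatrix, Matrix.of_apply, HermitianMetric.coeff_eq, smul_eq_mul,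
    Finset.mul_sum]
  exact Finset.sum_congr rfl fun j _ => Finset.sum_congr rfl fun i _ => by ring

/-- A nonzero vector in the kernel would have vanishing Hermitian square. -/
theorem HermitianMetric.isUnit_coeffMatrix (h : HermitianMetric n X) (he : e ∈ holoCharts n X)
    {z : CSpace n} (hz : z ∈ e.target) : IsUnit (h.coeffMatrix e z) := by
  rw [← Matrix.mulVec_injective_iff_isUnit]
  refine (injective_iff_map_eq_zero (h.coeffMatrix e z).mulVecLin).2 fun v hv => ?_
  by_contra hne
  have hne' : (WithLp.toLp 2 v : CSpace n) ≠ 0 := fun h0 => hne (by simpa using h0)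
  have h1 : chartDeriv e z (WithLp.toLp 2 v) ≠ 0 := fun h0 =>
    hne' (chartDeriv_injective he hz (by rw [h0, map_zero]))
  have h2 := h.bilin_pos (e.symm z) h1
  rw [Matrix.mulVecLin_apply] at hv
  rw [h.bilin_chartDeriv, hv] at h2
  simp at h2

theorem HermitianMetric.coeffMatrix_mulVec_descentField (h : HermitianMetric n X)
    (he : e ∈ holoCharts n X) {z : CSpace n} (hz : z ∈ e.target) :
    (h.coeffMatrix e z).mulVec (h.descentField e z) = fun j => -conj (z j) := by
  have hu := (Matrix.isUnit_iff_isUnit_det _).1 (h.isUnit_coeffMatrix he hz)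
  rw [descentField, WithLp.ofLp_neg, Matrix.mulVec_neg, Matrix.mulVec_mulVec,
    Matrix.mul_nonsing_inv _ hu, Matrix.one_mulVec]
  rfl

variable {S : X → ℂ} {θ : ℝ} {p : X}

/-- The derivative of `F_θ` in a Morse chart. -/
theorem mfderiv_actionRe_chartDeriv (hM : IsMorseChart S θ p e) {z : CSpace n}
    (hz : z ∈ e.target) (ξ : CSpace n) :
    (mfderiv 𝓘(ℝ, CSpace n) 𝓘(ℝ, ℝ) (actionRe S θ) (e.symm z) : CSpace n →L[ℝ] ℝ)
      (chartDeriv e z ξ) = (∑ j, z j * ξ j).re := by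
  obtain ⟨he, -, -, hS⟩ := hM
  obtain ⟨L, hL, hL'⟩ := exists_hasMFDerivAt_chart he hz
  let Q : CSpace n →L[ℂ] ℂ := ∑ j, z j • (EuclideanSpace.proj j : CSpace n →L[ℂ] ℂ)
  have hQ : ∀ ξ, Q ξ = ∑ j, z j * ξ j := fun ξ => by simp [Q, sum_apply]
  have h1 : HasFDerivAt (fun w : CSpace n => rotAction S θ p + (1 / 2 : ℂ) * ∑ j, (w j) ^ 2)
      Q (e (e.symm z)) := by
    rw [e.right_inv hz]
    have h2 : ∀ j, HasFDerivAt (fun w : CSpace n => (w j) ^ 2)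
        ((2 * z j) • (EuclideanSpace.proj j : CSpace n →L[ℂ] ℂ)) z := by
      intro j
      have := ((EuclideanSpace.proj j : CSpace n →L[ℂ] ℂ).hasFDerivAt (x := z)).pow 2
      refine this.congr_fderiv ?_
      simp
    refine (((HasFDerivAt.fun_sum fun j _ => h2 j).const_mul (1 / 2 : ℂ)).const_add
      (rotAction S θ p)).congr_fderiv ?_
    simp only [Q, Finset.smul_sum, smul_smul]
    exact Finset.sum_congr rfl fun j _ => by congr 1; ring
  have h2 : HasFDerivAt
      (fun w : CSpace n => (rotAction S θ p + (1 / 2 : ℂ) * ∑ j, (w j) ^ 2).re)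
      (Complex.reCLM.comp (Q.restrictScalars ℝ)) (e (e.symm z)) :=
    Complex.reCLM.hasFDerivAt.comp _ (h1.restrictScalars ℝ)
  have h3 : HasMFDerivAt 𝓘(ℝ, CSpace n) 𝓘(ℝ, ℝ)
      ((fun w : CSpace n => (rotAction S θ p + (1 / 2 : ℂ) * ∑ j, (w j) ^ 2).re) ∘ e) (e.symm z)
      ((Complex.reCLM.comp (Q.restrictScalars ℝ)).comp (L.restrictScalars ℝ)) :=
    HasMFDerivAt.comp _ h2.hasMFDerivAt hL.restrictScalars_real
  have h4 : HasMFDerivAt 𝓘(ℝ, CSpace n) 𝓘(ℝ, ℝ) (actionRe S θ) (e.symm z)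
      ((Complex.reCLM.comp (Q.restrictScalars ℝ)).comp (L.restrictScalars ℝ)) := by
    refine h3.congr_of_eventuallyEq ?_
    filter_upwards [e.open_source.mem_nhds (e.map_target hz)] with q hq
    simp only [actionRe, hS q hq, Function.comp]
  have h5 : (mfderiv 𝓘(ℝ, CSpace n) 𝓘(ℝ, ℝ) (actionRe S θ) (e.symm z) : CSpace n →L[ℝ] ℝ) =
      (Complex.reCLM.comp (Q.restrictScalars ℝ)).comp (L.restrictScalars ℝ) := h4.mfderiv
  rw [h5]
  change (Q (L (chartDeriv e z ξ))).re = _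
  rw [hL', hQ]

/-- The descending gradient of `F_θ` in a Morse chart. -/
theorem neg_gradient_eq_chartDeriv (h : HermitianMetric n X) (hM : IsMorseChart S θ p e)
    {z : CSpace n} (hz : z ∈ e.target) :
    (-h.gradient (actionRe S θ) (e.symm z) : CSpace n) =
      chartDeriv e z (h.descentField e z) := by
  set v : CSpace n := h.gradient (actionRe S θ) (e.symm z) with hv
  have h1 : ∀ ξ : CSpace n, (h.bilin (e.symm z) v (chartDeriv e z ξ)).re =
      (∑ j, z j * ξ j).re := fun ξ => by
    rw [← mfderiv_actionRe_chartDeriv hM hz]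
    exact h.riem_gradient (actionRe S θ) (e.symm z) (chartDeriv e z ξ)
  have h2 : ∀ ξ : CSpace n,
      (h.bilin (e.symm z) (chartDeriv e z (h.descentField e z)) (chartDeriv e z ξ)).re =
        -(∑ j, z j * ξ j).re := fun ξ => by
    rw [h.bilin_chartDeriv, h.coeffMatrix_mulVec_descentField hM.1 hz, ← Complex.neg_re,
      ← Complex.conj_re]
    congr 1
    simp only [map_sum, map_mul, map_neg, Complex.conj_conj]
    rw [← Finset.sum_neg_distrib]
    exact Finset.sum_congr rfl fun j _ => by ring
  have h3 : ∀ ξ : CSpace n,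
      (h.bilin (e.symm z) (-v - chartDeriv e z (h.descentField e z)) (chartDeriv e z ξ)).re = 0 :=
    fun ξ => by
      have h4 := h1 ξ
      have h5 := h2 ξ
      rw [map_sub, map_neg, LinearMap.sub_apply, LinearMap.neg_apply, Complex.sub_re,
        Complex.neg_re]
      linarith
  -- Since `chartDeriv` is onto, the difference of the two vectors is itself an admissible test
  -- vector, and positivity forces it to vanish.
  obtain ⟨ξ, hξ⟩ := chartDeriv_surjective hM.1 hz (-v - chartDeriv e z (h.descentField e z))
  have h4 := h3 ξ
  rw [hξ] at h4
  by_contra hne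
  have h5 := h.bilin_pos (e.symm z) (sub_ne_zero.2 hne)
  exact absurd h4 h5.ne'

open scoped Matrix.Norms.Operator in
theorem contDiffOn_inv_coeffMatrix (h : HermitianMetric n X) (he : e ∈ holoCharts n X) :
    ContDiffOn ℝ ∞ (fun z => (h.coeffMatrix e z)⁻¹) e.target := by
  have h1 : ContDiffOn ℝ ∞ (h.coeffMatrix e) e.target := by
    have h2 : h.coeffMatrix e =
        fun z => ∑ j, ∑ i, h.coeff e i j z • Matrix.single j i (1 : ℂ) := by
      funext z
      rw [Matrix.matrix_eq_sum_single (h.coeffMatrix e z)]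
      simp [HermitianMetric.coeffMatrix]
    rw [h2]
    exact ContDiffOn.sum fun j _ => ContDiffOn.sum fun i _ =>
      (h.smooth e he i j).smul contDiffOn_const
  intro z hz
  obtain ⟨u, hu⟩ := h.isUnit_coeffMatrix he hz
  have h3 : ContDiffAt ℝ ∞ (Ring.inverse : Matrix (Fin n) (Fin n) ℂ → _) (h.coeffMatrix e z) := by
    rw [← hu]; exact contDiffAt_ringInverse ℝ u
  simp_rw [Matrix.nonsing_inv_eq_ringInverse]
  exact h3.comp_contDiffWithinAt z (h1 z hz)

theorem contDiffOn_conj_coord (s : Set (CSpace n)) (j : Fin n) :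
    ContDiffOn ℝ ∞ (fun z : CSpace n => conj (z j)) s := by
  have h1 : ContDiff ℝ ∞ (fun z : CSpace n => z j) :=
    (EuclideanSpace.proj j : CSpace n →L[ℂ] ℂ).contDiff.restrict_scalars ℝ
  exact (Complex.conjCLE.contDiff.comp h1).contDiffOn

theorem contDiffOn_descentField (h : HermitianMetric n X) (he : e ∈ holoCharts n X) :
    ContDiffOn ℝ ∞ (h.descentField e) e.target := by
  have h1 : ∀ i j, ContDiffOn ℝ ∞ (fun z => (h.coeffMatrix e z)⁻¹ i j) e.target := by
    intro i j
    let L : Matrix (Fin n) (Fin n) ℂ →ₗ[ℝ] ℂ :=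
      { toFun := fun A => A i j, map_add' := fun A B => rfl, map_smul' := fun r A => rfl }
    open scoped Matrix.Norms.Operator in
    exact (LinearMap.toContinuousLinearMap L).contDiff.comp_contDiffOn
      (contDiffOn_inv_coeffMatrix h he)
  have h2 : h.descentField e = fun z => -∑ i, ∑ j, ((h.coeffMatrix e z)⁻¹ i j * conj (z j)) •
      (EuclideanSpace.single i (1 : ℂ) : CSpace n) := by
    funext z
    rw [HermitianMetric.descentField, euclidean_eq_sum_single (WithLp.toLp 2 _)]
    simp only [Matrix.mulVec, dotProduct, Finset.sum_smul]
  rw [h2]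
  exact (ContDiffOn.sum fun i _ => ContDiffOn.sum fun j _ =>
    ((h1 i j).mul (contDiffOn_conj_coord _ j)).smul contDiffOn_const).neg

end DescentField


/-! ### Real coordinates and the linearization at the critical point -/

section RealCoordinates

open scoped RealInnerProductSpace

/-- `c` is the minimum of the quadratic form on the compact unit sphere; an empty sphere means that
the space is zero. -/
theorem exists_coercivity_constant {E : Type*} [NormedAddCommGroup E] [InnerProductSpace ℝ E]
    [FiniteDimensional ℝ E] (A : E →L[ℝ] E) (hA : ∀ v, v ≠ 0 → 0 < ⟪A v, v⟫) :
    ∃ c > 0, ∀ v, c * ‖v‖ ^ 2 ≤ ⟪A v, v⟫ := by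
  have : ProperSpace E := FiniteDimensional.proper ℝ E
  rcases (Metric.sphere (0 : E) 1).eq_empty_or_nonempty with hem | hne
  · refine ⟨1, one_pos, fun v => ?_⟩
    have hv : v = 0 := by
      by_contra h
      have : ‖v‖⁻¹ • v ∈ Metric.sphere (0 : E) 1 := by
        rw [mem_sphere_zero_iff_norm, norm_smul, norm_inv, norm_norm,
          inv_mul_cancel₀ (norm_ne_zero_iff.2 h)]
      rw [hem] at this
      exact this
    simp [hv]
  · obtain ⟨v₀, hv₀, hmin⟩ := (isCompact_sphere (0 : E) 1).exists_isMinOn hne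
      (f := fun v => ⟪A v, v⟫) (by fun_prop)
    have hv₀1 : v₀ ≠ 0 := by
      rintro rfl
      simp at hv₀
    refine ⟨_, hA v₀ hv₀1, fun v => ?_⟩
    rcases eq_or_ne v 0 with rfl | hv
    · simp
    have hn : 0 < ‖v‖ := norm_pos_iff.2 hv
    have h1 : ⟪A v₀, v₀⟫ ≤ ⟪A (‖v‖⁻¹ • v), ‖v‖⁻¹ • v⟫ := hmin (by
      rw [mem_sphere_zero_iff_norm, norm_smul, norm_inv, norm_norm, inv_mul_cancel₀ hn.ne'])
    rw [map_smul, real_inner_smul_left, real_inner_smul_right] at h1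
    calc ⟪A v₀, v₀⟫ * ‖v‖ ^ 2 ≤ (‖v‖⁻¹ * (‖v‖⁻¹ * ⟪A v, v⟫)) * ‖v‖ ^ 2 := by gcongr
      _ = ⟪A v, v⟫ := by field_simp

/-- The real coordinates `(x, y) ↦ x + i y` of `ℂⁿ`. -/
noncomputable def cvecEquiv (n : ℕ) : (RSpace n × RSpace n) ≃L[ℝ] CSpace n :=
  LinearEquiv.toContinuousLinearEquiv
    { toFun := fun q => cvec q.1 q.2
      invFun := fun w => (WithLp.toLp 2 fun j => (w j).re, WithLp.toLp 2 fun j => (w j).im)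
      map_add' := fun q r => by
        ext j
        simp [cvec]
        ring
      map_smul' := fun a q => by
        ext j
        simp [cvec]
        ring
      left_inv := fun q => by
        ext j <;> simp [cvec]
      right_inv := fun w => by
        ext j
        simp [cvec, mul_comm Complex.I, Complex.re_add_im] }

variable {n : ℕ}

theorem cvecEquiv_apply (q : RSpace n × RSpace n) : cvecEquiv n q = cvec q.1 q.2 := rfl

theorem cvecEquiv_symm_cvec (x y : RSpace n) : (cvecEquiv n).symm (cvec x y) = (x, y) :=
  (cvecEquiv n).symm_apply_apply (x, y)

theorem cvecEquiv_symm_fst_apply (w : CSpace n) (j : Fin n) :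
    ((cvecEquiv n).symm w).1 j = (w j).re := rfl

theorem cvecEquiv_symm_snd_apply (w : CSpace n) (j : Fin n) :
    ((cvecEquiv n).symm w).2 j = (w j).im := rfl

theorem mem_coordBall_iff {ε : ℝ} {w : CSpace n} :
    w ∈ coordBall n ε ↔ ‖(cvecEquiv n).symm w‖ < ε := by
  constructor
  · rintro ⟨x, y, hx, hy, rfl⟩
    rw [cvecEquiv_symm_cvec]
    exact max_lt hx hy
  · intro h
    have h1 := (cvecEquiv n).apply_symm_apply w
    exact ⟨_, _, (norm_fst_le _).trans_lt h, (norm_snd_le _).trans_lt h, h1.symm⟩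

theorem isOpen_coordBall (ε : ℝ) : IsOpen (coordBall n ε) := by
  have h : coordBall n ε = {w | ‖(cvecEquiv n).symm w‖ < ε} := by
    ext w; exact mem_coordBall_iff
  rw [h]
  exact isOpen_lt (by fun_prop) continuous_const

/-- The quadratic form `∑ w_j²` in real coordinates. -/
theorem sum_sq_re_im (w : CSpace n) :
    (∑ j, (w j) ^ 2).re = ‖((cvecEquiv n).symm w).1‖ ^ 2 - ‖((cvecEquiv n).symm w).2‖ ^ 2 := by
  rw [EuclideanSpace.norm_sq_eq, EuclideanSpace.norm_sq_eq, Complex.re_sum,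
    ← Finset.sum_sub_distrib]
  refine Finset.sum_congr rfl fun j _ => ?_
  rw [cvecEquiv_symm_fst_apply, cvecEquiv_symm_snd_apply, sq, Complex.mul_re, Real.norm_eq_abs,
    Real.norm_eq_abs, sq_abs, sq_abs]
  ring

variable {X : Type*} [TopologicalSpace X] [ChartedSpace (CSpace n) X]
variable {h : HermitianMetric n X} {e : OpenPartialHomeomorph X (CSpace n)}

/-- The linearization of the descending gradient field at the center of a Morse chart. -/
theorem exists_hasFDerivAt_descentField (h : HermitianMetric n X) (he : e ∈ holoCharts n X)
    (h0 : (0 : CSpace n) ∈ e.target) :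
    ∃ L : CSpace n →L[ℝ] CSpace n, HasFDerivAt (h.descentField e) L 0 ∧
      ∀ ξ : CSpace n, (h.coeffMatrix e 0).mulVec (L ξ) = fun j => -conj (ξ j) := by
  have hd := ((contDiffOn_descentField h he).contDiffAt
    (e.open_target.mem_nhds h0)).differentiableAt (by simp)
  refine ⟨_, hd.hasFDerivAt, fun ξ => ?_⟩
  have hline : HasDerivAt (fun t : ℝ => t • ξ) ξ 0 := by
    simpa using (hasDerivAt_id (0 : ℝ)).smul_const ξ
  have h1 : HasDerivAt (fun t : ℝ => h.descentField e (t • ξ))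
      (fderiv ℝ (h.descentField e) 0 ξ) 0 :=
    HasFDerivAt.comp_hasDerivAt_of_eq (l := h.descentField e) (0 : ℝ) hd.hasFDerivAt hline
      (zero_smul ℝ ξ).symm
  have hc : ∀ i j, ContinuousAt (fun t : ℝ => h.coeffMatrix e (t • ξ) i j) 0 := by
    intro i j
    have h2 : ContinuousAt (h.coeff e j i) ((0 : ℝ) • ξ) := by
      rw [zero_smul]
      exact ((h.smooth e he j i).continuousOn).continuousAt (e.open_target.mem_nhds h0)
    exact ContinuousAt.comp (f := fun t : ℝ => t • ξ) h2 hline.continuousAt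
  have hmem : ∀ᶠ t : ℝ in 𝓝 0, t • ξ ∈ e.target :=
    hline.continuousAt.eventually_mem (by simpa using e.open_target.mem_nhds h0)
  have hslope := hasDerivAt_iff_tendsto_slope.1 h1
  have h00 : h.descentField e 0 = 0 := by
    ext j
    simp [HermitianMetric.descentField, Matrix.mulVec, dotProduct]
  funext j
  -- The identity `G(z) V(z) = -z̄` is divided by `t` along the ray `z = t ξ`. As `V(0) = 0`, only
  -- continuity of `G` at `0` is needed to pass to the limit.
  have hlim : Tendsto (fun t : ℝ => ∑ i, h.coeffMatrix e (t • ξ) j i *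
      (slope (fun t : ℝ => h.descentField e (t • ξ)) 0 t) i) (𝓝[≠] 0)
      (𝓝 (∑ i, h.coeffMatrix e 0 j i * (fderiv ℝ (h.descentField e) 0 ξ) i)) := by
    refine tendsto_finsetSum _ fun i _ => ?_
    have h2 := (hc j i).tendsto.mono_left (nhdsWithin_le_nhds (s := {0}ᶜ))
    rw [zero_smul] at h2
    exact h2.mul (((EuclideanSpace.proj i : CSpace n →L[ℂ] ℂ).continuous.tendsto _).comp hslope)
  refine tendsto_nhds_unique hlim (tendsto_const_nhds.congr' ?_)
  filter_upwards [self_mem_nhdsWithin, hmem.filter_mono nhdsWithin_le_nhds] with t ht htm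
  have ht' : (t : ℂ) ≠ 0 := by exact_mod_cast ht
  have h3 := congrFun (h.coeffMatrix_mulVec_descentField he htm) j
  simp only [Matrix.mulVec, dotProduct] at h3
  simp only [slope_def_module, zero_smul, h00, sub_zero, PiLp.smul_apply, Complex.real_smul]
  have h4 : ∀ i, h.coeffMatrix e (t • ξ) j i * ((t⁻¹ : ℝ) * h.descentField e (t • ξ) i) =
      (t : ℂ)⁻¹ * (h.coeffMatrix e (t • ξ) j i * h.descentField e (t • ξ) i) := fun i => by
    push_cast; ring
  simp_rw [h4]
  rw [← Finset.mul_sum, h3]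
  simp [ht']

/-- In real coordinates, the linearization of the descending gradient field at the center of an
adapted Morse chart is a saddle. -/
theorem exists_saddle_linearization (h : HermitianMetric n X) (he : e ∈ holoCharts n X)
    (h0 : (0 : CSpace n) ∈ e.target) (hr : h.IsRealAtCenter e) :
    ∃ (A : RSpace n →L[ℝ] RSpace n) (c : ℝ), 0 < c ∧ (∀ v, c * ‖v‖ ^ 2 ≤ ⟪A v, v⟫) ∧
      HasFDerivAt (fun q => (cvecEquiv n).symm (h.descentField e (cvecEquiv n q)))
        (saddle A) 0 := by
  obtain ⟨L, hL, hL'⟩ := exists_hasFDerivAt_descentField h he h0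
  set G := h.coeffMatrix e 0 with hG
  have hGre : ∀ i j, G i j = ((G i j).re : ℂ) := fun i j =>
    Complex.ext rfl (by simpa [hG, HermitianMetric.coeffMatrix] using hr j i)
  have hGinj : Function.Injective G.mulVec :=
    Matrix.mulVec_injective_iff_isUnit.2 (h.isUnit_coeffMatrix he h0)
  -- real and imaginary parts of `G *ᵥ w`
  have hre : ∀ (w : Fin n → ℂ) j, (G.mulVec w j).re = ∑ i, (G j i).re * (w i).re := fun w j => by
    simp only [Matrix.mulVec, dotProduct, Complex.re_sum]
    refine Finset.sum_congr rfl fun i _ => ?_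
    rw [hGre j i, Complex.re_ofReal_mul, Complex.ofReal_re]
  have him : ∀ (w : Fin n → ℂ) j, (G.mulVec w j).im = ∑ i, (G j i).re * (w i).im := fun w j => by
    simp only [Matrix.mulVec, dotProduct, Complex.im_sum]
    refine Finset.sum_congr rfl fun i _ => ?_
    rw [hGre j i, Complex.im_ofReal_mul, Complex.ofReal_re]
  let P : RSpace n × RSpace n →L[ℝ] RSpace n × RSpace n :=
    ((cvecEquiv n).symm : CSpace n →L[ℝ] RSpace n × RSpace n).comp
      (L.comp ((cvecEquiv n) : RSpace n × RSpace n →L[ℝ] CSpace n))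
  have hP : ∀ q, P q = (cvecEquiv n).symm (L (cvecEquiv n q)) := fun q => rfl
  -- The block of `L` on imaginary parts. As `G` is real, `G (L ξ) = -ξ̄` splits into a real part
  -- `-x` and an imaginary part `y`. Both are solved by `A = G⁻¹`, up to sign.
  let A : RSpace n →L[ℝ] RSpace n :=
    (ContinuousLinearMap.snd ℝ _ _).comp (P.comp (ContinuousLinearMap.inr ℝ _ _))
  -- the real matrix times `A v` is `v`
  have hA1 : ∀ (v : RSpace n) j, ∑ i, (G j i).re * A v i = v j := by
    intro v j
    have h1 := congrArg Complex.im (congrFun (hL' (cvec 0 v)) j)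
    rw [him] at h1
    have h2 : ∀ i, A v i = (L (cvec 0 v) i).im := fun i => rfl
    simp_rw [h2]
    rw [h1]
    simp [cvec]
  have hLq : ∀ x y : RSpace n, L (cvec x y) = cvec (-A x) (A y) := by
    intro x y
    have h1 : G.mulVec (L (cvec x y)) = G.mulVec (cvec (-A x) (A y)) := by
      funext j
      rw [hL']
      apply Complex.ext
      · rw [hre]
        have h2 : ∀ i, (G j i).re * (cvec (-A x) (A y) i).re = -((G j i).re * A x i) := fun i => by
          simp [cvec]
        simp_rw [h2]
        rw [Finset.sum_neg_distrib, hA1]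
        simp [cvec]
      · rw [him]
        have h2 : ∀ i, (G j i).re * (cvec (-A x) (A y) i).im = (G j i).re * A y i := fun i => by
          simp [cvec]
        simp_rw [h2]
        rw [hA1]
        simp [cvec]
    exact PiLp.ext (congrFun (hGinj h1))
  have hPs : P = saddle A := by
    refine ContinuousLinearMap.ext fun q => ?_
    rw [hP, cvecEquiv_apply, hLq, cvecEquiv_symm_cvec, saddle_apply]
  -- Since `v = G (A v)`, the number `⟪A v, v⟫` is the Hermitian square of the tangent vector with
  -- coordinates `A v`.
  have hpos : ∀ v : RSpace n, v ≠ 0 → 0 < ⟪A v, v⟫ := by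
    intro v hv
    have hAv : (cvec (A v) 0 : CSpace n) ≠ 0 := by
      intro h1
      refine hv ?_
      have h2 : A v = 0 := by
        have := cvecEquiv_symm_cvec (A v) 0
        rw [h1, map_zero] at this
        exact (congrArg Prod.fst this).symm
      ext j
      rw [← hA1 v j, h2]
      simp
    have h1 := h.bilin_pos (e.symm 0) (v := chartDeriv e 0 (cvec (A v) 0)) fun h1 =>
      hAv (chartDeriv_injective he h0 (by rw [h1, map_zero]))
    rw [h.bilin_chartDeriv, Complex.re_sum] at h1
    have h2 : ∀ j, (conj (cvec (A v) 0 j) * (G.mulVec (cvec (A v) 0)) j).re = A v j * v j := by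
      intro j
      have h3 : conj ((cvec (A v) 0 : CSpace n) j) = ((A v j : ℝ) : ℂ) := by simp [cvec]
      rw [h3, Complex.re_ofReal_mul, hre, ← hA1 v j]
      simp [cvec]
    simp_rw [← hG, h2] at h1
    rw [PiLp.inner_apply]
    simpa [mul_comm] using h1
  obtain ⟨c, hc, hcA⟩ := exists_coercivity_constant A hpos
  refine ⟨A, c, hc, hcA, ?_⟩
  rw [← hPs]
  have hL0 : HasFDerivAt (h.descentField e) L (cvecEquiv n 0) := by rw [map_zero]; exact hL
  exact (cvecEquiv n).symm.hasFDerivAt.comp 0 (hL0.comp 0 (cvecEquiv n).hasFDerivAt)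

end RealCoordinates


/-! ### Monotonicity and conservation along flow lines -/

section FlowLines

variable {n : ℕ} {X : Type*} [TopologicalSpace X] [ChartedSpace (CSpace n) X]
variable {h : HermitianMetric n X} {e : OpenPartialHomeomorph X (CSpace n)}
variable {S : X → ℂ} {θ : ℝ} {p : X} {T : Set ℝ}

theorem mdifferentiable_actionRe (hS : MDifferentiable 𝓘(ℂ, CSpace n) 𝓘(ℂ, ℂ) S) (θ : ℝ) :
    MDifferentiable 𝓘(ℝ, CSpace n) 𝓘(ℝ, ℝ) (actionRe S θ) := by
  intro x
  have h1 : HasMFDerivAt 𝓘(ℝ, CSpace n) 𝓘(ℝ, ℂ) S x _ := (hS x).hasMFDerivAt.restrictScalars_real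
  have h2 : DifferentiableAt ℝ (fun s : ℂ => (Complex.exp (-(Complex.I * (θ : ℂ))) * s).re) (S x) :=
    Complex.reCLM.differentiableAt.comp
      (f := fun s : ℂ => Complex.exp (-(Complex.I * (θ : ℂ))) * s) _ (by fun_prop)
  exact h2.mdifferentiableAt.comp x h1.mdifferentiableAt

theorem IsFlowLineOn.mono {γ : ℝ → X} {T' : Set ℝ} (hγ : IsFlowLineOn h S θ γ T) (hT : T' ⊆ T) :
    IsFlowLineOn h S θ γ T' :=
  IsMIntegralCurveOn.mono hγ hT

/-- The real part of the action does not increase along flow lines. -/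
theorem IsFlowLineOn.exists_hasDerivWithinAt_actionRe
    (hS : MDifferentiable 𝓘(ℂ, CSpace n) 𝓘(ℂ, ℂ) S) {γ : ℝ → X} (hγ : IsFlowLineOn h S θ γ T)
    {t : ℝ} (ht : t ∈ T) :
    ∃ d ≤ 0, HasDerivWithinAt (fun s => actionRe S θ (γ s)) d T t := by
  have h1 := (mdifferentiable_actionRe hS θ (γ t)).hasMFDerivAt
  have h2 := (h1.comp_hasMFDerivWithinAt t (hγ t ht)).hasFDerivWithinAt
  set v : CSpace n := h.gradient (actionRe S θ) (γ t) with hv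
  refine ⟨-(h.bilin (γ t) v v).re, ?_, ?_⟩
  · rcases eq_or_ne v 0 with h0 | h0
    · simp [h0]
    · exact neg_nonpos.2 (h.bilin_pos _ h0).le
  · refine HasDerivWithinAt.congr_deriv (f := fun s => actionRe S θ (γ s))
      (HasFDerivWithinAt.hasDerivWithinAt h2) ?_
    let D : CSpace n →L[ℝ] ℝ := mfderiv 𝓘(ℝ, CSpace n) 𝓘(ℝ, ℝ) (actionRe S θ) (γ t)
    have h3 : D v = (h.bilin (γ t) v v).re := (h.riem_gradient (actionRe S θ) (γ t) v).symm
    have h4 : D ((1 : ℝ) • (-v)) = -(h.bilin (γ t) v v).re := by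
      rw [one_smul, map_neg, h3]
    exact h4

/-- `F_θ` does not increase along the flow and tends to its value at `p`, so it can never be below
that value. -/
theorem IsFlowLineOn.le_actionRe (hS : MDifferentiable 𝓘(ℂ, CSpace n) 𝓘(ℂ, ℂ) S) {γ : ℝ → X}
    (hγ : IsFlowLineOn h S θ γ (Ici 0)) (hp : Tendsto γ atTop (𝓝 p)) {t : ℝ} (ht : 0 ≤ t) :
    actionRe S θ p ≤ actionRe S θ (γ t) := by
  choose! d hd hd' using fun t (ht : t ∈ Ici (0 : ℝ)) => hγ.exists_hasDerivWithinAt_actionRe hS ht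
  have hanti : AntitoneOn (fun s => actionRe S θ (γ s)) (Ici 0) := by
    refine antitoneOn_of_hasDerivWithinAt_nonpos (convex_Ici 0)
      (fun t ht => (hd' t ht).continuousWithinAt)
      (fun t ht => (hd' t (interior_subset ht)).mono interior_subset)
      (fun t ht => hd t (interior_subset ht))
  have hlim : Tendsto (fun s => actionRe S θ (γ s)) atTop (𝓝 (actionRe S θ p)) :=
    ((mdifferentiable_actionRe hS θ p).continuousAt.tendsto).comp hp
  refine le_of_tendsto hlim ?_
  filter_upwards [eventually_ge_atTop t] with s hs
  exact hanti ht (ht.trans hs) hs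

/-- A flow line, read in a Morse chart. -/
theorem IsFlowLineOn.hasDerivWithinAt_chart (hM : IsMorseChart S θ p e) {γ : ℝ → X}
    (hγ : IsFlowLineOn h S θ γ T) {t : ℝ} (ht : t ∈ T) (hs : γ t ∈ e.source) :
    HasDerivWithinAt (fun s => e (γ s)) (h.descentField e (e (γ t))) T t := by
  refine hasDerivWithinAt_chart_comp hM.1 hs ?_
  rw [← neg_gradient_eq_chartDeriv h hM (e.map_source hs)]
  have h1 := hγ t ht
  rw [e.left_inv hs]
  exact h1

/-- A coordinate solution in a Morse chart is a flow line. -/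
theorem isFlowLineOn_symm (hM : IsMorseChart S θ p e) {z : ℝ → CSpace n}
    (ht : ∀ t ∈ T, z t ∈ e.target)
    (hz : ∀ t ∈ T, HasDerivWithinAt z (h.descentField e (z t)) T t) :
    IsFlowLineOn h S θ (fun s => e.symm (z s)) T := by
  intro t htT
  have h1 := hasMFDerivWithinAt_symm_comp hM.1 (ht t htT) (hz t htT)
  rw [← neg_gradient_eq_chartDeriv h hM (ht t htT)] at h1
  exact h1

theorem IsMorseChart.zero_mem_target (hM : IsMorseChart S θ p e) : (0 : CSpace n) ∈ e.target := by
  have := e.map_source hM.2.1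
  rwa [hM.2.2.1] at this

theorem IsMorseChart.symm_zero (hM : IsMorseChart S θ p e) : e.symm 0 = p := by
  rw [← hM.2.2.1, e.left_inv hM.2.1]

theorem IsMorseChart.actionRe_eq (hM : IsMorseChart S θ p e) {q : X} (hq : q ∈ e.source) :
    actionRe S θ q = actionRe S θ p + (1 / 2) *
      (‖((cvecEquiv n).symm (e q)).1‖ ^ 2 - ‖((cvecEquiv n).symm (e q)).2‖ ^ 2) := by
  rw [actionRe, hM.2.2.2 q hq, ← sum_sq_re_im, Complex.add_re]
  congr 1
  have : (1 / 2 : ℂ) = ((1 / 2 : ℝ) : ℂ) := by norm_num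
  rw [this, Complex.re_ofReal_mul]

theorem IsMorseChart.actionIm_eq (hM : IsMorseChart S θ p e) {q : X} (hq : q ∈ e.source) :
    actionIm S θ q = actionIm S θ p + (1 / 2) * (∑ j, (e q j) ^ 2).im := by
  rw [actionIm, hM.2.2.2 q hq, Complex.add_im]
  congr 1
  have : (1 / 2 : ℂ) = ((1 / 2 : ℝ) : ℂ) := by norm_num
  rw [this, Complex.im_ofReal_mul]

/-- The holomorphic action decreases in a real direction along the descending gradient field. -/
theorem HermitianMetric.sum_mul_descentField_im (h : HermitianMetric n X) (he : e ∈ holoCharts n X)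
    {z : CSpace n} (hz : z ∈ e.target) : (∑ j, z j * h.descentField e z j).im = 0 := by
  have h1 := h.bilin_chartDeriv e z (h.descentField e z) (h.descentField e z)
  rw [h.coeffMatrix_mulVec_descentField he hz] at h1
  -- By `G V = -z̄`, the sum `-∑ z_j V_j` is the conjugate of the Hermitian square of `V`, which is
  -- real.
  have h2 : conj (h.bilin (e.symm z) (chartDeriv e z (h.descentField e z))
      (chartDeriv e z (h.descentField e z))) = -∑ j, z j * h.descentField e z j := by
    rw [h1, map_sum, ← Finset.sum_neg_distrib]
    refine Finset.sum_congr rfl fun j _ => ?_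
    simp [mul_comm]
  have h3 := h.bilin_conj_symm (e.symm z) (chartDeriv e z (h.descentField e z))
    (chartDeriv e z (h.descentField e z))
  rw [h2] at h3
  rw [h3] at h2
  have h4 := congrArg Complex.im h2
  simp only [map_neg, Complex.neg_im, Complex.conj_im] at h4
  linarith

/-- The imaginary part of `∑ w_j²` vanishes on coordinate solutions that converge to `0`. -/
theorem sum_sq_im_eq_zero (he : e ∈ holoCharts n X) {z : ℝ → CSpace n}
    (ht : ∀ t ∈ Ici (0 : ℝ), z t ∈ e.target)
    (hz : ∀ t ∈ Ici (0 : ℝ), HasDerivWithinAt z (h.descentField e (z t)) (Ici 0) t)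
    (hlim : Tendsto z atTop (𝓝 0)) : (∑ j, (z 0 j) ^ 2).im = 0 := by
  -- The derivative of `∑ z_j²` is `2 ∑ z_j V_j`, which is real. The imaginary part is therefore
  -- constant and equal to its limit `0`.
  have hd : ∀ t ∈ Ici (0 : ℝ), HasDerivWithinAt (fun s => (∑ j, (z s j) ^ 2).im) 0 (Ici 0) t := by
    intro t htT
    have h1 : ∀ j, HasDerivWithinAt (fun s => z s j) (h.descentField e (z t) j) (Ici 0) t :=
      fun j => ((EuclideanSpace.proj j : CSpace n →L[ℂ] ℂ).restrictScalars
        ℝ).hasFDerivAt.comp_hasDerivWithinAt t (hz t htT)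
    have h2 : HasDerivWithinAt (fun s => ∑ j, (z s j) ^ 2)
        (∑ j, 2 * (z t j * h.descentField e (z t) j)) (Ici 0) t :=
      HasDerivWithinAt.fun_sum fun j _ => ((h1 j).pow 2).congr_deriv (by simp; ring)
    have h3 := Complex.imCLM.hasFDerivAt.comp_hasDerivWithinAt t h2
    refine HasDerivWithinAt.congr_deriv h3 ?_
    have h4 := h.sum_mul_descentField_im he (ht t htT)
    rw [← Finset.mul_sum, Complex.imCLM_apply, Complex.mul_im, h4]
    simp
  have hconst : ∀ t ∈ Ici (0 : ℝ), (∑ j, (z t j) ^ 2).im = (∑ j, (z 0 j) ^ 2).im := by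
    intro t htT
    exact (convex_Ici (0 : ℝ)).is_const_of_fderivWithin_eq_zero (𝕜 := ℝ)
      (fun s hs => (hd s hs).differentiableWithinAt)
      (fun s hs => by
        rw [(hd s hs).hasFDerivWithinAt.fderivWithin (uniqueDiffOn_Ici 0 s hs)]
        ext; simp) htT self_mem_Ici
  have hcont : Continuous (fun w : CSpace n => (∑ j, (w j) ^ 2).im) :=
    Complex.continuous_im.comp (by fun_prop)
  have hl := (hcont.tendsto 0).comp hlim
  have hl' : Tendsto (fun t => (∑ j, (z t j) ^ 2).im) atTop (𝓝 (∑ j, (z 0 j) ^ 2).im) :=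
    tendsto_const_nhds.congr' (by
      filter_upwards [eventually_ge_atTop 0] with t ht0 using (hconst t ht0).symm)
  rw [← tendsto_nhds_unique hl hl']
  simp

end FlowLines


/-! ### The stable manifold as a graph -/

section StableDisk

variable {n : ℕ} {X : Type*} [TopologicalSpace X] [ChartedSpace (CSpace n) X]
variable {h : HermitianMetric n X} {e : OpenPartialHomeomorph X (CSpace n)}
variable {S : X → ℂ} {θ : ℝ} {p : X} {T : Set ℝ}

/-- The descending gradient field in the real coordinates of a chart. -/
noncomputable def HermitianMetric.realField (h : HermitianMetric n X)
    (e : OpenPartialHomeomorph X (CSpace n)) (q : RSpace n × RSpace n) : RSpace n × RSpace n :=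
  (cvecEquiv n).symm (h.descentField e (cvecEquiv n q))

theorem IsFlowLineOn.hasDerivWithinAt_realField (hM : IsMorseChart S θ p e) {γ : ℝ → X}
    (hγ : IsFlowLineOn h S θ γ T) {t : ℝ} (ht : t ∈ T) (hs : γ t ∈ e.source) :
    HasDerivWithinAt (fun s => (cvecEquiv n).symm (e (γ s)))
      (h.realField e ((cvecEquiv n).symm (e (γ t)))) T t := by
  rw [HermitianMetric.realField, ContinuousLinearEquiv.apply_symm_apply]
  exact (cvecEquiv n).symm.hasFDerivAt.comp_hasDerivWithinAt t
    (hγ.hasDerivWithinAt_chart hM ht hs)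

theorem hasDerivWithinAt_cvecEquiv {z : ℝ → RSpace n × RSpace n} {t : ℝ}
    (hz : HasDerivWithinAt z (h.realField e (z t)) T t) :
    HasDerivWithinAt (fun s => cvecEquiv n (z s)) (h.descentField e (cvecEquiv n (z t))) T t := by
  have h1 := (cvecEquiv n).hasFDerivAt.comp_hasDerivWithinAt t hz
  refine HasDerivWithinAt.congr_deriv h1 ?_
  exact (cvecEquiv n).apply_symm_apply _

/-- In the chart `F_θ - F_θ(p) = (‖x‖² - ‖y‖²) / 2`, so the lower bound on `F_θ` is the cone
condition. -/
theorem IsFlowLineOn.norm_snd_le_norm_fst (hS : MDifferentiable 𝓘(ℂ, CSpace n) 𝓘(ℂ, ℂ) S)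
    (hM : IsMorseChart S θ p e) {γ : ℝ → X} (hγ : IsFlowLineOn h S θ γ (Ici 0))
    (hp : Tendsto γ atTop (𝓝 p)) {t : ℝ} (ht : 0 ≤ t) (hs : γ t ∈ e.source) :
    ‖((cvecEquiv n).symm (e (γ t))).2‖ ≤ ‖((cvecEquiv n).symm (e (γ t))).1‖ := by
  have h1 := hγ.le_actionRe hS hp ht
  rw [hM.actionRe_eq hs] at h1
  exact le_of_sq_le_sq (by linarith) (norm_nonneg _)

/-- A flow line that converges to `p` and starts in a small box stays in that box. -/
theorem IsFlowLineOn.mem_closedBall [T2Space X] (hS : MDifferentiable 𝓘(ℂ, CSpace n) 𝓘(ℂ, ℂ) S)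
    (hM : IsMorseChart S θ p e) {ε₀ : ℝ}
    (hsub : Metric.ball 0 ε₀ ⊆ cvecEquiv n ⁻¹' e.target)
    (hmono : ∀ (z : ℝ → RSpace n × RSpace n) (a b : ℝ), a ≤ b →
      (∀ t ∈ Icc a b, HasDerivWithinAt z (h.realField e (z t)) (Icc a b) t) →
      (∀ t ∈ Icc a b, z t ∈ Metric.ball 0 ε₀) → (∀ t ∈ Icc a b, ‖(z t).2‖ ≤ ‖(z t).1‖) →
      ‖(z b).1‖ ≤ ‖(z a).1‖)
    {γ : ℝ → X} (hγ : IsFlowLineOn h S θ γ (Ici 0)) (hp : Tendsto γ atTop (𝓝 p))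
    (h0 : γ 0 ∈ e.source) {r : ℝ} (hr : r < ε₀) (hr0 : ‖((cvecEquiv n).symm (e (γ 0))).1‖ ≤ r)
    {t : ℝ} (ht : 0 ≤ t) :
    γ t ∈ e.source ∧ (cvecEquiv n).symm (e (γ t)) ∈ Metric.closedBall 0 r := by
  have hsub' : ∀ ρ, ρ < ε₀ → Metric.closedBall (0 : RSpace n × RSpace n) ρ ⊆
      cvecEquiv n ⁻¹' e.target := fun ρ hρ => (Metric.closedBall_subset_ball hρ).trans hsub
  have hcont : ContinuousOn γ (Ici 0) := fun t ht => (hγ t ht).continuousWithinAt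
  have key : ∀ (s : Set (RSpace n × RSpace n)), s ⊆ cvecEquiv n ⁻¹' e.target →
      (fun q => e.symm (cvecEquiv n q)) '' s =
        {x | x ∈ e.source ∧ (cvecEquiv n).symm (e x) ∈ s} := by
    intro s hs
    ext x
    constructor
    · rintro ⟨q, hq, rfl⟩
      refine ⟨e.map_target (hs hq), ?_⟩
      rw [e.right_inv (hs hq), ContinuousLinearEquiv.symm_apply_apply]
      exact hq
    · rintro ⟨hx, hq⟩
      exact ⟨_, hq, by simp [e.left_inv hx]⟩
  set K : Set X := {x | x ∈ e.source ∧ (cvecEquiv n).symm (e x) ∈ Metric.closedBall 0 r} with hK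
  -- Compactness and the Hausdorff property make `K` closed in `X` and not just in the chart domain,
  -- so a limit of times spent in `K` is again such a time.
  have hKc : IsClosed K := by
    rw [hK, ← key _ (hsub' r hr)]
    refine ((isCompact_closedBall (0 : RSpace n × RSpace n) r).image_of_continuousOn ?_).isClosed
    exact e.continuousOn_symm.comp (cvecEquiv n).continuous.continuousOn (hsub' r hr)
  let W : Set X := {x | x ∈ e.source ∧ (cvecEquiv n).symm (e x) ∈ Metric.ball 0 ε₀}
  have hWo : IsOpen W := by
    have : W = e.source ∩ e ⁻¹' ((cvecEquiv n).symm ⁻¹' Metric.ball 0 ε₀) := rfl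
    rw [this]
    exact e.isOpen_inter_preimage (Metric.isOpen_ball.preimage (cvecEquiv n).symm.continuous)
  -- Continuity argument on `[0, t]`. Shortly after a time in `K` the curve is still in the larger
  -- box `W`. There `‖x‖` does not increase and `‖y‖ ≤ ‖x‖`, so the curve is still in `K`.
  have hstep : Icc 0 t ⊆ γ ⁻¹' K := by
    refine IsClosed.Icc_subset_of_forall_mem_nhdsWithin ?_ ?_ ?_
    · rw [inter_comm]
      exact (hcont.mono Icc_subset_Ici_self).preimage_isClosed_of_isClosed isClosed_Icc hKc
    · refine ⟨h0, mem_closedBall_zero_iff.2 (max_le hr0 ?_)⟩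
      exact (hγ.norm_snd_le_norm_fst hS hM hp le_rfl h0).trans hr0
    · rintro a ⟨haK, ha⟩
      have haW : γ a ∈ W := ⟨haK.1, Metric.closedBall_subset_ball hr haK.2⟩
      have h1 : ∀ᶠ s in 𝓝[≥] a, γ s ∈ W :=
        (((hcont a ha.1).mono (Ici_subset_Ici.2 ha.1)).tendsto).eventually (hWo.mem_nhds haW)
      obtain ⟨u, hu, hu'⟩ := mem_nhdsGE_iff_exists_Ico_subset.1 h1
      refine mem_of_superset (Ioo_mem_nhdsGT hu) fun b hb => ?_
      have hI : ∀ s ∈ Icc a b, γ s ∈ W := fun s hs => hu' ⟨hs.1, hs.2.trans_lt hb.2⟩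
      have hI0 : Icc a b ⊆ Ici 0 := fun s hs => ha.1.trans hs.1
      have h2 := hmono (fun s => (cvecEquiv n).symm (e (γ s))) a b hb.1.le
        (fun s hs => (hγ.mono hI0).hasDerivWithinAt_realField hM hs (hI s hs).1)
        (fun s hs => (hI s hs).2)
        (fun s hs => hγ.norm_snd_le_norm_fst hS hM hp (hI0 hs) (hI s hs).1)
      have hbI : b ∈ Icc a b := right_mem_Icc.2 hb.1.le
      have h3 : ‖((cvecEquiv n).symm (e (γ b))).1‖ ≤ r :=
        h2.trans ((norm_fst_le _).trans (mem_closedBall_zero_iff.1 haK.2))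
      exact ⟨(hI b hbI).1, mem_closedBall_zero_iff.2 (max_le h3
        ((hγ.norm_snd_le_norm_fst hS hM hp (hI0 hbI) (hI b hbI).1).trans h3))⟩
  exact hstep (right_mem_Icc.2 ht)

theorem localStableSet_subset (U : Set X) :
    localStableSet h S θ p U ⊆ stableSet h S θ p ∩ U := by
  rintro _ ⟨γ, rfl, hγ, hU, hp⟩
  exact ⟨⟨γ, rfl, hγ, hp⟩, hU 0 le_rfl⟩

/-- The local stable manifold of `p` is a graph in every adapted Morse chart. -/
theorem exists_stableDisk [T2Space X] (hS : MDifferentiable 𝓘(ℂ, CSpace n) 𝓘(ℂ, ℂ) S)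
    (hM : IsMorseChart S θ p e) (hr : h.IsRealAtCenter e) :
    ∃ ε₀ > 0, coordBall n ε₀ ⊆ e.target ∧ ∃ ψ : RSpace n → RSpace n,
      ContDiffOn ℝ ∞ ψ (Metric.ball 0 ε₀) ∧ ψ 0 = 0 ∧
      HasFDerivAt ψ (0 : RSpace n →L[ℝ] RSpace n) 0 ∧
      (∀ x, ‖x‖ < ε₀ → ‖ψ x‖ ≤ ‖x‖) ∧
      (∀ x, ‖x‖ < ε₀ → (∑ j, (cvec x (ψ x) j) ^ 2).im = 0) ∧
      ∀ ε, 0 < ε → ε ≤ ε₀ →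
        localStableSet h S θ p (e.symm '' coordBall n ε) = stableDisk e ψ ε ∧
        stableSet h S θ p ∩ e.symm '' coordBall n ε = stableDisk e ψ ε := by
  obtain ⟨A, c, hc, hA, hd⟩ := exists_saddle_linearization h hM.1 hM.zero_mem_target hr
  have hU : IsOpen (cvecEquiv n ⁻¹' e.target) := e.open_target.preimage (cvecEquiv n).continuous
  have h00 : h.descentField e 0 = 0 := by
    ext j
    simp [HermitianMetric.descentField, Matrix.mulVec, dotProduct]
  obtain ⟨ε₀, hε₀, hsub, ψ, hψ, hψ0, hψd, ha, hb, hmono⟩ := exists_stable_graph hc hA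
    (V := h.realField e) hU (by simpa using hM.zero_mem_target)
    ((cvecEquiv n).symm.contDiff.comp_contDiffOn ((contDiffOn_descentField h hM.1).comp
      (cvecEquiv n).contDiff.contDiffOn (fun _ hq => hq)))
    (by simp [HermitianMetric.realField, h00]) hd
  refine ⟨ε₀, hε₀, ?_, ψ, hψ, hψ0, hψd, ?_, ?_, ?_⟩
  · intro w hw
    simpa using hsub (mem_ball_zero_iff.2 (mem_coordBall_iff.1 hw))
  · intro x hx
    obtain ⟨z, hz0, -, hz, -⟩ := ha x hx
    have h1 := hz 0 self_mem_Ici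
    rw [hz0] at h1
    exact (norm_snd_le (x, ψ x)).trans h1
  · intro x hx
    obtain ⟨z, hz0, hz1, hz2, hz3⟩ := ha x hx
    have h1 := sum_sq_im_eq_zero (h := h) (z := fun t => cvecEquiv n (z t)) hM.1
      (fun t ht => hsub (mem_ball_zero_iff.2 ((hz2 t ht).trans_lt hx)))
      (fun t ht => hasDerivWithinAt_cvecEquiv (hz1 t ht))
      (by simpa using! ((cvecEquiv n).continuous.tendsto 0).comp hz3)
    rw [hz0] at h1
    exact h1
  · intro ε hε hεε
    have hsub1 : stableDisk e ψ ε ⊆ localStableSet h S θ p (e.symm '' coordBall n ε) := by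
      rintro _ ⟨x, hx, rfl⟩
      obtain ⟨z, hz0, hz1, hz2, hz3⟩ := ha x (hx.trans_le hεε)
      have hzt : ∀ t ∈ Ici (0 : ℝ), cvecEquiv n (z t) ∈ e.target := fun t ht =>
        hsub (mem_ball_zero_iff.2 ((hz2 t ht).trans_lt (hx.trans_le hεε)))
      refine ⟨fun t => e.symm (cvecEquiv n (z t)), ?_, ?_, ?_, ?_⟩
      · simp only [hz0, cvecEquiv_apply]
      · exact isFlowLineOn_symm hM hzt fun t ht => hasDerivWithinAt_cvecEquiv (hz1 t ht)
      · intro t ht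
        refine ⟨_, mem_coordBall_iff.2 ?_, rfl⟩
        rw [ContinuousLinearEquiv.symm_apply_apply]
        exact (hz2 t ht).trans_lt hx
      · have h1 : Tendsto (fun t => cvecEquiv n (z t)) atTop (𝓝 0) := by
          simpa using! ((cvecEquiv n).continuous.tendsto 0).comp hz3
        have h2 := ((e.continuousAt_symm hM.zero_mem_target).tendsto).comp h1
        rwa [hM.symm_zero] at h2
    have hsub2 : stableSet h S θ p ∩ e.symm '' coordBall n ε ⊆ stableDisk e ψ ε := by
      rintro _ ⟨⟨γ, rfl, hγ, hp⟩, w, hw, hwγ⟩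
      have hw' := mem_coordBall_iff.1 hw
      have hwt : w ∈ e.target := by
        simpa using hsub (mem_ball_zero_iff.2 (hw'.trans_le hεε))
      have h0 : γ 0 ∈ e.source := hwγ ▸ e.map_target hwt
      have hew : e (γ 0) = w := by rw [← hwγ, e.right_inv hwt]
      have hlt : ‖((cvecEquiv n).symm (e (γ 0))).1‖ < ε := by
        rw [hew]; exact (norm_fst_le _).trans_lt hw'
      -- Here `r` is the initial value of `‖x‖`. Confinement turns mere convergence to `p` into the
      -- hypothesis of staying in the box, under which the initial point must lie on the graph.
      have hconf := fun t (ht : (0 : ℝ) ≤ t) => hγ.mem_closedBall hS hM hsub hmono hp h0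
        (hlt.trans_le hεε) le_rfl ht
      have h1 := hb (fun s => (cvecEquiv n).symm (e (γ s)))
        (fun t ht => hγ.hasDerivWithinAt_realField hM ht (hconf t ht).1)
        (fun t ht => Metric.closedBall_subset_ball (hlt.trans_le hεε) (hconf t ht).2)
      refine ⟨_, hlt, ?_⟩
      rw [← h1, ← cvecEquiv_apply, ContinuousLinearEquiv.apply_symm_apply, e.left_inv h0]
    exact ⟨(localStableSet_subset _ |>.trans hsub2).antisymm hsub1,
      hsub2.antisymm (hsub1.trans (localStableSet_subset _))⟩

end StableDisk


/-! ### Graphs as real submanifolds and their tangent spaces -/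

section GraphGeometry

variable {n : ℕ} {X : Type*} [TopologicalSpace X]
variable {e : OpenPartialHomeomorph X (CSpace n)} {p : X} {ψ : RSpace n → RSpace n} {ε : ℝ}

/-- The vertical shear `x + i y ↦ x + i (y + ψ x)`. -/
noncomputable def shear (ψ : RSpace n → RSpace n) (w : CSpace n) : CSpace n :=
  w + cvec 0 (ψ ((cvecEquiv n).symm w).1)

theorem shear_cvec (ψ : RSpace n → RSpace n) (x y : RSpace n) :
    shear ψ (cvec x y) = cvec x (y + ψ x) := by
  rw [shear, cvecEquiv_symm_cvec, ← cvecEquiv_apply (x, y), ← cvecEquiv_apply (0, ψ x), ← map_add,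
    Prod.mk_add_mk, add_zero]
  rfl

theorem exists_cvec_eq (w : CSpace n) : ∃ x y : RSpace n, w = cvec x y :=
  ⟨_, _, ((cvecEquiv n).apply_symm_apply w).symm⟩

theorem shear_shear_neg (ψ : RSpace n → RSpace n) (w : CSpace n) :
    shear ψ (shear (fun x => -ψ x) w) = w := by
  obtain ⟨x, y, rfl⟩ := exists_cvec_eq w
  rw [shear_cvec, shear_cvec, neg_add_cancel_right]

theorem shear_neg_shear (ψ : RSpace n → RSpace n) (w : CSpace n) :
    shear (fun x => -ψ x) (shear ψ w) = w := by
  obtain ⟨x, y, rfl⟩ := exists_cvec_eq w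
  rw [shear_cvec, shear_cvec, add_neg_cancel_right]

theorem contDiffOn_shear {U : Set (RSpace n)} (hψ : ContDiffOn ℝ ∞ ψ U) :
    ContDiffOn ℝ ∞ (shear ψ) {w | ((cvecEquiv n).symm w).1 ∈ U} := by
  refine contDiffOn_id.add ?_
  have h1 : ContDiffOn ℝ ∞ (fun w : CSpace n => ψ ((cvecEquiv n).symm w).1)
      {w | ((cvecEquiv n).symm w).1 ∈ U} :=
    hψ.comp (contDiff_fst.comp (cvecEquiv n).symm.contDiff).contDiffOn fun _ hw => hw
  exact (cvecEquiv n).contDiff.comp_contDiffOn ((contDiffOn_const (c := (0 : RSpace n))).prodMk h1)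

/-- The vertical shear over an open set, as a partial homeomorphism. -/
noncomputable def shearHomeomorph (ψ : RSpace n → RSpace n) {U : Set (RSpace n)} (hU : IsOpen U)
    (hψ : ContDiffOn ℝ ∞ ψ U) : OpenPartialHomeomorph (CSpace n) (CSpace n) where
  toFun := shear fun x => -ψ x
  invFun := shear ψ
  source := {w | ((cvecEquiv n).symm w).1 ∈ U}
  target := {w | ((cvecEquiv n).symm w).1 ∈ U}
  map_source' := fun w hw => by
    obtain ⟨x, y, rfl⟩ := exists_cvec_eq w
    simpa only [mem_ofPred_eq, shear_cvec, cvecEquiv_symm_cvec] using hw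
  map_target' := fun w hw => by
    obtain ⟨x, y, rfl⟩ := exists_cvec_eq w
    simpa only [mem_ofPred_eq, shear_cvec, cvecEquiv_symm_cvec] using hw
  left_inv' := fun w _ => shear_shear_neg ψ w
  right_inv' := fun w _ => shear_neg_shear ψ w
  open_source := hU.preimage (continuous_fst.comp (cvecEquiv n).symm.continuous)
  open_target := hU.preimage (continuous_fst.comp (cvecEquiv n).symm.continuous)
  continuousOn_toFun := (contDiffOn_shear hψ.neg).continuousOn
  continuousOn_invFun := (contDiffOn_shear hψ).continuousOn

theorem mem_shearHomeomorph_source {U : Set (RSpace n)} (hU : IsOpen U)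
    (hψ : ContDiffOn ℝ ∞ ψ U) (w : CSpace n) :
    w ∈ (shearHomeomorph ψ hU hψ).source ↔ ((cvecEquiv n).symm w).1 ∈ U := Iff.rfl

theorem mem_shearHomeomorph_target {U : Set (RSpace n)} (hU : IsOpen U)
    (hψ : ContDiffOn ℝ ∞ ψ U) (w : CSpace n) :
    w ∈ (shearHomeomorph ψ hU hψ).target ↔ ((cvecEquiv n).symm w).1 ∈ U := Iff.rfl

theorem shearHomeomorph_cvec {U : Set (RSpace n)} (hU : IsOpen U)
    (hψ : ContDiffOn ℝ ∞ ψ U) (x y : RSpace n) :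
    shearHomeomorph ψ hU hψ (cvec x y) = cvec x (y - ψ x) := by
  rw [sub_eq_add_neg]
  exact shear_cvec (fun x => -ψ x) x y

theorem shearHomeomorph_mem_contDiffGroupoid {U : Set (RSpace n)} (hU : IsOpen U)
    (hψ : ContDiffOn ℝ ∞ ψ U) :
    shearHomeomorph ψ hU hψ ∈ contDiffGroupoid ∞ 𝓘(ℝ, CSpace n) := by
  have h1 : ContDiffOn ℝ ∞ (shearHomeomorph ψ hU hψ) (shearHomeomorph ψ hU hψ).source :=
    contDiffOn_shear (ψ := fun x => -ψ x) hψ.neg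
  have h2 : ContDiffOn ℝ ∞ (shearHomeomorph ψ hU hψ).symm (shearHomeomorph ψ hU hψ).target :=
    contDiffOn_shear hψ
  exact mem_contDiffGroupoid_self_iff.2 ⟨h1, h2⟩

/-- The real subspace `ℝⁿ` of `ℂⁿ`. -/
noncomputable def realSlice (n : ℕ) : Submodule ℝ (CSpace n) :=
  LinearMap.range ((cvecEquiv n).toLinearEquiv.toLinearMap ∘ₗ LinearMap.inl ℝ _ _)

theorem finrank_realSlice : Module.finrank ℝ (realSlice n) = n := by
  rw [realSlice, LinearMap.finrank_range_of_inj]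
  · simp
  · exact (cvecEquiv n).injective.comp LinearMap.inl_injective

theorem cvec_mem_realSlice_iff {x y : RSpace n} : cvec x y ∈ realSlice n ↔ y = 0 := by
  constructor
  · rintro ⟨v, hv⟩
    have h1 := congrArg (cvecEquiv n).symm hv
    rw [cvecEquiv_symm_cvec] at h1
    have h2 : ((v, 0) : RSpace n × RSpace n) = (x, y) := by simpa using h1
    exact (congrArg Prod.snd h2).symm
  · rintro rfl
    exact ⟨x, rfl⟩

/-- Subtracting `ψ x` from the imaginary part flattens the graph to `y = 0`. The last clause, due to
the shear preserving `x`, ensures that every slice point of the target comes from the graph. -/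
theorem exists_straightening_chart [ChartedSpace (CSpace n) X]
    (he : e ∈ holoCharts n X) (hε : coordBall n ε ⊆ e.target)
    (hψ : ContDiffOn ℝ ∞ ψ (Metric.ball 0 ε)) :
    ∃ φ ∈ IsManifold.maximalAtlas 𝓘(ℝ, CSpace n) ∞ X,
      (∀ x y : RSpace n, cvec x y ∈ coordBall n ε → e.symm (cvec x y) ∈ φ.source ∧
        φ (e.symm (cvec x y)) = cvec x (y - ψ x)) ∧
      ∀ x y : RSpace n, cvec x y ∈ φ.target → ‖x‖ < ε := by
  obtain ⟨ρ, hρ⟩ : ∃ ρ, ρ = OpenPartialHomeomorph.ofSet (coordBall n ε) (isOpen_coordBall ε) :=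
    ⟨_, rfl⟩
  have h1 : e ≫ₕ ρ ∈ IsManifold.maximalAtlas 𝓘(ℝ, CSpace n) ∞ X :=
    StructureGroupoid.trans_mem_maximalAtlas (holoCharts_subset_real he)
      (hρ ▸ ofSet_mem_contDiffGroupoid _)
  obtain ⟨σ, hσ⟩ : ∃ σ, σ = shearHomeomorph ψ Metric.isOpen_ball hψ := ⟨_, rfl⟩
  have hσg : σ ∈ contDiffGroupoid ∞ 𝓘(ℝ, CSpace n) := by
    rw [hσ]
    exact shearHomeomorph_mem_contDiffGroupoid Metric.isOpen_ball hψ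
  have hσs : ∀ w, w ∈ σ.source ↔ ‖((cvecEquiv n).symm w).1‖ < ε := fun w => by
    rw [hσ, mem_shearHomeomorph_source, mem_ball_zero_iff]
  have hσt : ∀ w, w ∈ σ.target ↔ ‖((cvecEquiv n).symm w).1‖ < ε := fun w => by
    rw [hσ, mem_shearHomeomorph_target, mem_ball_zero_iff]
  have hσv : ∀ x y : RSpace n, σ (cvec x y) = cvec x (y - ψ x) := fun x y => by
    rw [hσ, shearHomeomorph_cvec]
  refine ⟨(e ≫ₕ ρ) ≫ₕ σ, StructureGroupoid.trans_mem_maximalAtlas h1 hσg, fun x y hxy => ?_,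
    fun x y hxy => ?_⟩
  · have h2 : (e ≫ₕ ρ) (e.symm (cvec x y)) = cvec x y := by
      rw [hρ]
      exact e.right_inv (hε hxy)
    refine ⟨?_, ?_⟩
    · rw [OpenPartialHomeomorph.trans_source, OpenPartialHomeomorph.trans_source]
      refine ⟨⟨e.map_target (hε hxy), ?_⟩, ?_⟩
      · rw [mem_preimage, e.right_inv (hε hxy), hρ]
        exact hxy
      · rw [mem_preimage, h2, hσs]
        exact (norm_fst_le _).trans_lt (mem_coordBall_iff.1 hxy)
    · rw [OpenPartialHomeomorph.trans_apply, h2, hσv]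
  · rw [OpenPartialHomeomorph.trans_target] at hxy
    have := (hσt _).1 hxy.1
    rwa [cvecEquiv_symm_cvec] at this

/-- A graph in a holomorphic chart is a real submanifold of middle dimension. -/
theorem isRealSubmanifold_stableDisk [ChartedSpace (CSpace n) X]
    (he : e ∈ holoCharts n X) (hε : coordBall n ε ⊆ e.target)
    (hψ : ContDiffOn ℝ ∞ ψ (Metric.ball 0 ε)) (hle : ∀ x, ‖x‖ < ε → ‖ψ x‖ ≤ ‖x‖) :
    IsRealSubmanifold n n (stableDisk e ψ ε) := by
  have hmem : ∀ x, ‖x‖ < ε → cvec x (ψ x) ∈ coordBall n ε := fun x hx =>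
    ⟨x, ψ x, hx, (hle x hx).trans_lt hx, rfl⟩
  obtain ⟨φ, hφ, hφ1, hφ2⟩ := exists_straightening_chart he hε hψ
  rintro _ ⟨x₀, hx₀, rfl⟩
  refine ⟨φ, hφ, (hφ1 _ _ (hmem x₀ hx₀)).1, realSlice n, finrank_realSlice, ?_⟩
  ext w
  constructor
  · rintro ⟨_, ⟨⟨x, hx, rfl⟩, hs⟩, rfl⟩
    refine ⟨φ.map_source hs, ?_⟩
    rw [(hφ1 _ _ (hmem x hx)).2, SetLike.mem_coe, cvec_mem_realSlice_iff, sub_self]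
  · rintro ⟨hw, hw'⟩
    obtain ⟨x, y, rfl⟩ := exists_cvec_eq w
    obtain rfl := cvec_mem_realSlice_iff.1 hw'
    have hx : ‖x‖ < ε := hφ2 _ _ hw
    obtain ⟨h1, h2⟩ := hφ1 _ _ (hmem x hx)
    exact ⟨_, ⟨⟨x, hx, rfl⟩, h1⟩, by rw [h2, sub_self]⟩

theorem HasFDerivAt.comp_hasDerivAt_eq_zero {F G : Type*} [NormedAddCommGroup F] [NormedSpace ℝ F]
    [NormedAddCommGroup G] [NormedSpace ℝ G] {g : F → G} {f : ℝ → F} {f' : F}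
    (hg : HasFDerivAt g (0 : F →L[ℝ] G) (f 0)) (hf : HasDerivAt f f' 0) :
    HasDerivAt (fun t => g (f t)) 0 0 :=
  hg.comp_hasDerivAt (0 : ℝ) hf

/-- The tangent space of a graph with vanishing differential. -/
theorem coordTangent_stableDisk (h0 : (0 : CSpace n) ∈ e.target) (hp : e.symm 0 = p)
    (hε0 : 0 < ε) (hε : coordBall n ε ⊆ e.target) (hψ0 : ψ 0 = 0)
    (hψd : HasFDerivAt ψ (0 : RSpace n →L[ℝ] RSpace n) 0)
    (hle : ∀ x, ‖x‖ < ε → ‖ψ x‖ ≤ ‖x‖) :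
    coordTangent e (stableDisk e ψ ε) p = {w : CSpace n | ∀ j, (w j).im = 0} := by
  have hmem : ∀ x, ‖x‖ < ε → cvec x (ψ x) ∈ e.target := fun x hx =>
    hε ⟨x, ψ x, hx, (hle x hx).trans_lt hx, rfl⟩
  have h00 : e p = 0 := by rw [← hp, e.right_inv h0]
  ext w
  constructor
  · rintro ⟨γ, hγ0, -, hγ, hd⟩
    have h1 : HasDerivAt (fun t => (cvecEquiv n).symm (e (γ t))) ((cvecEquiv n).symm w) 0 :=
      (cvecEquiv n).symm.hasFDerivAt.comp_hasDerivAt (0 : ℝ) hd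
    have h2 : HasDerivAt (fun t => ((cvecEquiv n).symm (e (γ t))).1) ((cvecEquiv n).symm w).1 0 :=
      (ContinuousLinearMap.fst ℝ (RSpace n) (RSpace n)).hasFDerivAt.comp_hasDerivAt (0 : ℝ) h1
    have h3 : HasDerivAt (fun t => ((cvecEquiv n).symm (e (γ t))).2) ((cvecEquiv n).symm w).2 0 :=
      (ContinuousLinearMap.snd ℝ (RSpace n) (RSpace n)).hasFDerivAt.comp_hasDerivAt (0 : ℝ) h1
    have h4 : HasDerivAt (fun t => ψ ((cvecEquiv n).symm (e (γ t))).1) 0 0 := by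
      refine HasFDerivAt.comp_hasDerivAt_eq_zero ?_ h2
      simpa [hγ0, h00] using hψd
    -- On the graph the imaginary part is `ψ` of the real part, and `Dψ(0) = 0`.
    have h5 : ((cvecEquiv n).symm w).2 = 0 := by
      refine h3.unique (h4.congr_of_eventuallyEq ?_)
      filter_upwards [hγ] with t ht
      obtain ⟨x, hx, hxt⟩ := ht
      rw [hxt, e.right_inv (hmem x hx), cvecEquiv_symm_cvec]
    intro j
    rw [← cvecEquiv_symm_snd_apply, h5]
    rfl
  · intro hw
    obtain ⟨x, y, rfl⟩ := exists_cvec_eq w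
    have hy : y = 0 := by
      ext j
      have := hw j
      rwa [← cvecEquiv_symm_snd_apply, cvecEquiv_symm_cvec] at this
    subst hy
    have h1 : HasDerivAt (fun t : ℝ => t • x) x 0 := by
      simpa using (hasDerivAt_id (0 : ℝ)).smul_const x
    have h2 : HasDerivAt (fun t : ℝ => ψ (t • x)) 0 0 :=
      HasFDerivAt.comp_hasDerivAt_eq_zero (by simpa using hψd) h1
    have h3 : HasDerivAt (fun t : ℝ => cvec (t • x) (ψ (t • x))) (cvec x 0) 0 :=
      (cvecEquiv n).hasFDerivAt.comp_hasDerivAt (0 : ℝ) (h1.prodMk h2)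
    have hev : ∀ᶠ t in 𝓝 (0 : ℝ), ‖t • x‖ < ε := by
      refine (h1.continuousAt.norm).eventually_lt continuousAt_const ?_
      simpa using hε0
    have hc0 : cvec ((0 : ℝ) • x) (ψ ((0 : ℝ) • x)) = 0 := by
      rw [zero_smul, hψ0]
      exact map_zero (cvecEquiv n)
    -- The ray `t x` is lifted to the graph, which has the same velocity at `0`.
    refine ⟨fun t => e.symm (cvec (t • x) (ψ (t • x))), ?_, ?_, ?_, ?_⟩
    · change e.symm (cvec ((0 : ℝ) • x) (ψ ((0 : ℝ) • x))) = p
      rw [hc0, hp]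
    · refine ContinuousAt.comp (f := fun t : ℝ => cvec (t • x) (ψ (t • x))) ?_ h3.continuousAt
      rw [hc0]
      exact e.continuousAt_symm h0
    · filter_upwards [hev] with t ht using ⟨_, ht, rfl⟩
    · refine h3.congr_of_eventuallyEq ?_
      filter_upwards [hev] with t ht using e.right_inv (hmem _ ht)

end GraphGeometry


/-! ### The rotation `θ ↦ θ + π`, `w ↦ -i w` -/

section Rotation

theorem rotAction_add_pi {X : Type*} (S : X → ℂ) (θ : ℝ) (x : X) :
    rotAction S (θ + Real.pi) x = -rotAction S θ x := by
  have h1 : -(Complex.I * ((θ + Real.pi : ℝ) : ℂ)) =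
      -(Complex.I * θ) - Real.pi * Complex.I := by
    push_cast; ring
  rw [rotAction, rotAction, h1, Complex.exp_sub_pi_mul_I]
  ring

theorem actionRe_add_pi {X : Type*} (S : X → ℂ) (θ : ℝ) :
    actionRe S (θ + Real.pi) = fun x => -actionRe S θ x := by
  funext x
  rw [actionRe, rotAction_add_pi, Complex.neg_re, actionRe]

theorem actionIm_add_pi {X : Type*} (S : X → ℂ) (θ : ℝ) (x : X) :
    actionIm S (θ + Real.pi) x = -actionIm S θ x := by
  rw [actionIm, rotAction_add_pi, Complex.neg_im, actionIm]

variable {n : ℕ} {X : Type*} [TopologicalSpace X] {e : OpenPartialHomeomorph X (CSpace n)} {p : X}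

/-- The rotation `w ↦ -i w`. -/
noncomputable def rotEquiv (n : ℕ) : CSpace n ≃L[ℂ] CSpace n :=
  ContinuousLinearEquiv.equivOfInverse (-Complex.I • ContinuousLinearMap.id ℂ _)
    (Complex.I • ContinuousLinearMap.id ℂ _) (fun w => by simp [smul_smul])
    (fun w => by simp [smul_smul])

theorem rotEquiv_apply (w : CSpace n) (j : Fin n) : rotEquiv n w j = -(Complex.I * w j) := by
  simp [rotEquiv]

theorem rotEquiv_symm_apply (w : CSpace n) : (rotEquiv n).symm w = Complex.I • w := rfl

theorem rotEquiv_symm_cvec (x y : RSpace n) : (rotEquiv n).symm (cvec x y) = cvec (-y) x := by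
  rw [rotEquiv_symm_apply]
  ext j
  simp only [cvec, PiLp.smul_apply, smul_eq_mul, PiLp.neg_apply, Complex.ofReal_neg, mul_add]
  rw [← mul_assoc, Complex.I_mul_I]
  ring

theorem rotEquiv_symm_image_coordBall (ε : ℝ) :
    (rotEquiv n).symm '' coordBall n ε = coordBall n ε := by
  ext w
  constructor
  · rintro ⟨_, ⟨x, y, hx, hy, rfl⟩, rfl⟩
    exact ⟨-y, x, by rwa [norm_neg], hx, rotEquiv_symm_cvec x y⟩
  · rintro ⟨x, y, hx, hy, rfl⟩
    exact ⟨cvec y (-x), ⟨y, -x, hy, by rwa [norm_neg], rfl⟩, by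
      rw [rotEquiv_symm_cvec, neg_neg]⟩

/-- The chart `-i e`. -/
noncomputable def rotChart (e : OpenPartialHomeomorph X (CSpace n)) :
    OpenPartialHomeomorph X (CSpace n) :=
  e ≫ₕ (rotEquiv n).toHomeomorph.toOpenPartialHomeomorph

theorem rotChart_apply (e : OpenPartialHomeomorph X (CSpace n)) (q : X) :
    rotChart e q = rotEquiv n (e q) := rfl

theorem rotChart_symm_apply (e : OpenPartialHomeomorph X (CSpace n)) (w : CSpace n) :
    (rotChart e).symm w = e.symm ((rotEquiv n).symm w) := rfl

theorem rotChart_source (e : OpenPartialHomeomorph X (CSpace n)) :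
    (rotChart e).source = e.source := by
  simp [rotChart]

theorem mem_rotChart_target {w : CSpace n} :
    w ∈ (rotChart e).target ↔ (rotEquiv n).symm w ∈ e.target := by
  simp [rotChart]

theorem rotChart_symm_image (s : Set (CSpace n)) :
    (rotChart e).symm '' s = e.symm '' ((rotEquiv n).symm '' s) := by
  rw [image_image]
  rfl

/-- Undoing the rotation multiplies by `i`, and `i (x + i ψ(x)) = -ψ(x) + i x`. -/
theorem stableDisk_rotChart (ψ : RSpace n → RSpace n) (ε : ℝ) :
    stableDisk (rotChart e) ψ ε = unstableDisk e (fun y => -ψ y) ε := by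
  simp only [stableDisk, unstableDisk, rotChart_symm_apply, rotEquiv_symm_cvec]

theorem coordTangent_eq_preimage_rotChart (A : Set X) :
    coordTangent e A p = rotEquiv n ⁻¹' coordTangent (rotChart e) A p := by
  ext w
  constructor
  · rintro ⟨γ, h0, hc, hA, hd⟩
    exact ⟨γ, h0, hc, hA, ((rotEquiv n).restrictScalars ℝ).hasFDerivAt.comp_hasDerivAt (0 : ℝ) hd⟩
  · rintro ⟨γ, h0, hc, hA, hd⟩
    refine ⟨γ, h0, hc, hA, ?_⟩
    have h1 := ((rotEquiv n).symm.restrictScalars ℝ).hasFDerivAt.comp_hasDerivAt (0 : ℝ) hd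
    have h2 : HasDerivAt (fun t => (rotEquiv n).symm (rotEquiv n (e (γ t))))
      ((rotEquiv n).symm (rotEquiv n w)) 0 := h1
    simpa using h2

end Rotation

/-! ### The unstable manifold by time reversal -/

section UnstableDisk

variable {n : ℕ} {X : Type*} [TopologicalSpace X] [ChartedSpace (CSpace n) X]
variable {h : HermitianMetric n X} {e : OpenPartialHomeomorph X (CSpace n)}
variable {S : X → ℂ} {θ : ℝ} {p : X} {T : Set ℝ}

theorem exists_stable_submanifold [T2Space X] (hS : MDifferentiable 𝓘(ℂ, CSpace n) 𝓘(ℂ, ℂ) S)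
    (hM : IsMorseChart S θ p e) (hr : h.IsRealAtCenter e) :
    ∃ ε₀ > 0, coordBall n ε₀ ⊆ e.target ∧ ∃ ψ : RSpace n → RSpace n,
      ContDiffOn ℝ ∞ ψ (Metric.ball 0 ε₀) ∧ ψ 0 = 0 ∧
      HasFDerivAt ψ (0 : RSpace n →L[ℝ] RSpace n) 0 ∧
      ∀ ε, 0 < ε → ε ≤ ε₀ →
        localStableSet h S θ p (e.symm '' coordBall n ε) = stableDisk e ψ ε ∧
        stableSet h S θ p ∩ e.symm '' coordBall n ε = stableDisk e ψ ε ∧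
        IsRealSubmanifold n n (stableDisk e ψ ε) ∧
        coordTangent e (stableDisk e ψ ε) p = {w : CSpace n | ∀ j, (w j).im = 0} ∧
        ∀ q ∈ stableDisk e ψ ε, actionIm S θ q = actionIm S θ p := by
  obtain ⟨ε₀, hε₀, hsub, ψ, hψ, hψ0, hψd, hle, him, hmain⟩ := exists_stableDisk hS hM hr
  refine ⟨ε₀, hε₀, hsub, ψ, hψ, hψ0, hψd, fun ε hε hεε => ?_⟩
  have hsub' : coordBall n ε ⊆ e.target := fun w hw =>
    hsub (mem_coordBall_iff.2 ((mem_coordBall_iff.1 hw).trans_le hεε))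
  have hle' : ∀ x, ‖x‖ < ε → ‖ψ x‖ ≤ ‖x‖ := fun x hx => hle x (hx.trans_le hεε)
  refine ⟨(hmain ε hε hεε).1, (hmain ε hε hεε).2, isRealSubmanifold_stableDisk hM.1 hsub'
    (hψ.mono (Metric.ball_subset_ball hεε)) hle', coordTangent_stableDisk hM.zero_mem_target
    hM.symm_zero hε hsub' hψ0 hψd hle', ?_⟩
  rintro _ ⟨x, hx, rfl⟩
  have hx' : cvec x (ψ x) ∈ e.target := hsub' ⟨x, ψ x, hx, (hle' x hx).trans_lt hx, rfl⟩
  rw [hM.actionIm_eq (e.map_target hx'), e.right_inv hx', him x (hx.trans_le hεε), mul_zero,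
    add_zero]

theorem HermitianMetric.eq_of_riem_eq (h : HermitianMetric n X) (x : X) {v w : CSpace n}
    (hvw : ∀ ξ : CSpace n, (h.bilin x v ξ).re = (h.bilin x w ξ).re) : v = w := by
  by_contra hne
  have h1 := h.bilin_pos x (sub_ne_zero.2 hne)
  rw [LinearMap.map_sub (h.bilin x) v w, LinearMap.sub_apply, Complex.sub_re, hvw, sub_self] at h1
  exact h1.false

theorem HermitianMetric.gradient_neg (h : HermitianMetric n X) (f : X → ℝ) (x : X) :
    (h.gradient (fun y => -f y) x : CSpace n) = -(h.gradient f x : CSpace n) := by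
  refine h.eq_of_riem_eq x fun ξ => ?_
  let D : CSpace n →L[ℝ] ℝ := mfderiv 𝓘(ℝ, CSpace n) 𝓘(ℝ, ℝ) f x
  let D' : CSpace n →L[ℝ] ℝ := mfderiv 𝓘(ℝ, CSpace n) 𝓘(ℝ, ℝ) (fun y => -f y) x
  have h1 : (h.bilin x (h.gradient (fun y => -f y) x) ξ).re = D' ξ := h.riem_gradient _ x ξ
  have h2 : (h.bilin x (h.gradient f x) ξ).re = D ξ := h.riem_gradient _ x ξ
  have h3 : D' = -D := mfderiv_neg
  have h4 : (h.bilin x (-(h.gradient f x : CSpace n)) ξ).re =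
      -(h.bilin x (h.gradient f x) ξ).re :=
    (congrArg (fun L : CSpace n →ₗ⋆[ℂ] ℂ => (L ξ).re) (LinearMap.map_neg (h.bilin x) _))
  exact (h1.trans ((congrArg (fun L : CSpace n →L[ℝ] ℝ => L ξ) h3).trans
    (congrArg Neg.neg h2.symm))).trans h4.symm

/-- Rotating the phase by `π` reverses the flow. -/
theorem isFlowLineOn_add_pi_iff {γ : ℝ → X} :
    IsFlowLineOn h S (θ + Real.pi) γ T ↔ IsFlowLineOn h S θ (fun t => γ (-t)) (Neg.neg ⁻¹' T) := by
  have h1 : (fun x => -h.gradient (actionRe S θ) x) =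
      (-1 : ℝ) • (fun x => -h.gradient (actionRe S (θ + Real.pi)) x) := by
    funext x
    rw [actionRe_add_pi]
    have h2 := h.gradient_neg (actionRe S θ) x
    change (-h.gradient (actionRe S θ) x : CSpace n) =
      (-1 : ℝ) • (-h.gradient (fun y => -actionRe S θ y) x : CSpace n)
    rw [neg_one_smul, neg_neg]
    exact h2.symm
  have h2 := isMIntegralCurveOn_comp_mul_ne_zero (I := 𝓘(ℝ, CSpace n)) (γ := γ)
    (v := fun x => -h.gradient (actionRe S (θ + Real.pi)) x) (s := T) (a := -1) (by norm_num)
  have h3 : γ ∘ (fun t : ℝ => t * -1) = fun t => γ (-t) := by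
    funext t; simp
  have h4 : {t : ℝ | t * -1 ∈ T} = Neg.neg ⁻¹' T := by
    ext t; simp
  rw [h3, h4, ← h1] at h2
  exact h2.symm

/-- The substitution `t ↦ -t` exchanges backward flow lines for `θ` with forward flow lines for `θ +
π`. -/
theorem localUnstableSet_eq (U : Set X) :
    localUnstableSet h S θ p U = localStableSet h S (θ + Real.pi) p U := by
  have hT : (Neg.neg ⁻¹' Ici 0 : Set ℝ) = Iic 0 := by ext; simp
  ext z₀
  constructor
  · rintro ⟨γ, hγ0, hγ, hU, hp⟩
    refine ⟨fun t => γ (-t), by simpa using hγ0, ?_, fun s hs => hU _ (by simpa using hs),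
      hp.comp tendsto_neg_atTop_atBot⟩
    rw [isFlowLineOn_add_pi_iff, hT]
    simpa using hγ
  · rintro ⟨γ, hγ0, hγ, hU, hp⟩
    refine ⟨fun t => γ (-t), by simpa using hγ0, ?_, fun s hs => hU _ (by simpa using hs),
      hp.comp tendsto_neg_atBot_atTop⟩
    rwa [isFlowLineOn_add_pi_iff, hT] at hγ

theorem localStableSet_univ : localStableSet h S θ p univ = stableSet h S θ p := by
  simp [localStableSet, stableSet]

theorem localUnstableSet_univ : localUnstableSet h S θ p univ = unstableSet h S θ p := by
  simp [localUnstableSet, unstableSet]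

theorem unstableSet_eq : unstableSet h S θ p = stableSet h S (θ + Real.pi) p := by
  rw [← localStableSet_univ, ← localUnstableSet_univ, localUnstableSet_eq]

/-- The derivative of the inverse of a chart after a holomorphic change of coordinates. -/
theorem chartDeriv_trans (he : e ∈ holoCharts n X)
    {φ : OpenPartialHomeomorph (CSpace n) (CSpace n)} {z : CSpace n} (hz : φ.symm z ∈ e.target)
    {D : CSpace n →L[ℂ] CSpace n} (hD : HasFDerivAt φ.symm D z) (v : CSpace n) :
    chartDeriv (e ≫ₕ φ) z v = chartDeriv e (φ.symm z) (D v) := by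
  have h1 : HasMFDerivAt 𝓘(ℂ, CSpace n) 𝓘(ℂ, CSpace n) (e.symm ∘ φ.symm) z
      ((chartDeriv e (φ.symm z)).comp D) :=
    HasMFDerivAt.comp z (hasMFDerivAt_chart_symm he hz) hD.hasMFDerivAt
  exact congrArg (fun L : CSpace n →L[ℂ] CSpace n => L v) h1.mfderiv

theorem rotChart_mem_holoCharts (he : e ∈ holoCharts n X) : rotChart e ∈ holoCharts n X :=
  trans_mem_holoCharts he (rotEquiv n).contDiff.contDiffOn (rotEquiv n).symm.contDiff.contDiffOn

/-- `(-i w)² = -w²` matches the sign change of `S_θ`. -/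
theorem IsMorseChart.rotChart (hM : IsMorseChart S θ p e) :
    IsMorseChart S (θ + Real.pi) p (rotChart e) := by
  refine ⟨rotChart_mem_holoCharts hM.1, ?_, ?_, fun q hq => ?_⟩
  · rw [rotChart_source]; exact hM.2.1
  · rw [rotChart_apply, hM.2.2.1, map_zero]
  · rw [rotChart_source] at hq
    rw [rotAction_add_pi, rotAction_add_pi, hM.2.2.2 q hq]
    have h1 : ∀ j, (_root_.rotChart e q j) ^ 2 = -(e q j) ^ 2 := fun j => by
      rw [rotChart_apply, rotEquiv_apply, neg_sq, mul_pow, Complex.I_sq]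
      ring
    simp_rw [h1]
    rw [Finset.sum_neg_distrib]
    ring

/-- The coordinate vectors are multiplied by `i`, and `i · conj i = 1` leaves the metric
coefficients at the centre unchanged. -/
theorem HermitianMetric.IsRealAtCenter.rotChart (he : e ∈ holoCharts n X)
    (h0 : (0 : CSpace n) ∈ e.target) (hr : h.IsRealAtCenter e) :
    h.IsRealAtCenter (rotChart e) := by
  intro i j
  have h1 : ∀ v, chartDeriv (_root_.rotChart e) 0 v = Complex.I • chartDeriv e 0 v := by
    intro v
    have hz : (rotEquiv n).symm 0 = 0 := map_zero _
    have h2 := chartDeriv_trans he (φ := (rotEquiv n).toHomeomorph.toOpenPartialHomeomorph)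
      (z := 0) (by
        change (rotEquiv n).symm 0 ∈ e.target
        rwa [hz]) ((rotEquiv n).symm.hasFDerivAt) v
    rw [← map_smul]
    refine h2.trans ?_
    change chartDeriv e ((rotEquiv n).symm 0) ((rotEquiv n).symm v) = _
    rw [hz, rotEquiv_symm_apply]
  have h2 : (_root_.rotChart e).symm 0 = e.symm 0 := by
    rw [rotChart_symm_apply, map_zero]
  have h3 := hr i j
  rw [HermitianMetric.coeff_eq] at h3 ⊢
  rw [h1, h1, h2, LinearMap.map_smul (h.bilin _), LinearMap.smul_apply, map_smulₛₗ, smul_smul]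
  simpa using h3

/-- This is the stable statement for `θ + π` in the rotated chart, carried back by the fact that the
box is invariant under multiplication by `i`. -/
theorem exists_unstable_submanifold [T2Space X] (hS : MDifferentiable 𝓘(ℂ, CSpace n) 𝓘(ℂ, ℂ) S)
    (hM : IsMorseChart S θ p e) (hr : h.IsRealAtCenter e) :
    ∃ ε₀ > 0, coordBall n ε₀ ⊆ e.target ∧ ∃ ψ : RSpace n → RSpace n,
      ContDiffOn ℝ ∞ ψ (Metric.ball 0 ε₀) ∧ ψ 0 = 0 ∧
      HasFDerivAt ψ (0 : RSpace n →L[ℝ] RSpace n) 0 ∧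
      ∀ ε, 0 < ε → ε ≤ ε₀ →
        localUnstableSet h S θ p (e.symm '' coordBall n ε) = unstableDisk e ψ ε ∧
        unstableSet h S θ p ∩ e.symm '' coordBall n ε = unstableDisk e ψ ε ∧
        IsRealSubmanifold n n (unstableDisk e ψ ε) ∧
        coordTangent e (unstableDisk e ψ ε) p = {w : CSpace n | ∀ j, (w j).re = 0} ∧
        ∀ q ∈ unstableDisk e ψ ε, actionIm S θ q = actionIm S θ p := by
  obtain ⟨ε₀, hε₀, hsub, ψ, hψ, hψ0, hψd, hmain⟩ := exists_stable_submanifold hS hM.rotChart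
    (hr.rotChart hM.1 hM.zero_mem_target)
  refine ⟨ε₀, hε₀, ?_, fun y => -ψ y, hψ.neg, by simp [hψ0], by simpa using! hψd.neg,
    fun ε hε hεε => ?_⟩
  · intro w hw
    rw [← rotEquiv_symm_image_coordBall] at hw
    obtain ⟨w', hw', rfl⟩ := hw
    exact mem_rotChart_target.1 (hsub hw')
  · obtain ⟨h1, h2, h3, h4, h5⟩ := hmain ε hε hεε
    rw [rotChart_symm_image, rotEquiv_symm_image_coordBall, stableDisk_rotChart] at h1 h2
    rw [stableDisk_rotChart] at h3 h4 h5
    refine ⟨?_, ?_, h3, ?_, fun q hq => ?_⟩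
    · rw [localUnstableSet_eq, h1]
    · rw [unstableSet_eq, h2]
    · rw [coordTangent_eq_preimage_rotChart, h4]
      ext w
      simp only [mem_preimage, mem_ofPred_eq, rotEquiv_apply]
      simp
    · have := h5 q hq
      rw [actionIm_add_pi, actionIm_add_pi] at this
      exact neg_injective this

end UnstableDisk


/-! ### Existence of adapted Morse charts -/

section Existence

variable {n : ℕ}

/-- A family that is orthonormal for a bilinear form, as a linear change of coordinates. -/
theorem exists_continuousLinearEquiv_of_orthonormal (B : CSpace n →ₗ[ℂ] CSpace n →ₗ[ℂ] ℂ)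
    {b : Fin n → CSpace n} (hb : ∀ i j, B (b i) (b j) = if i = j then 1 else 0) :
    ∃ L : CSpace n ≃L[ℂ] CSpace n, (∀ i, L (EuclideanSpace.single i 1) = b i) ∧
      ∀ v w, B (L v) (L w) = ∑ j, v j * w j := by
  let A : CSpace n →ₗ[ℂ] CSpace n :=
    { toFun := fun v => ∑ i, v i • b i
      map_add' := fun v w => by simp [add_smul, Finset.sum_add_distrib]
      map_smul' := fun c v => by simp [mul_smul, Finset.smul_sum] }
  have hA : ∀ v, A v = ∑ i, v i • b i := fun v => rfl
  have hB : ∀ v w, B (A v) (A w) = ∑ j, v j * w j := by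
    intro v w
    simp [hA, map_sum, LinearMap.sum_apply, hb, mul_comm]
  -- The coordinate `v j` is recovered as `B (A v) (A e_j)`, so `B`-orthonormality alone gives
  -- independence.
  have hinj : Function.Injective A := by
    refine (injective_iff_map_eq_zero A).2 fun v hv => ?_
    ext j
    have := hB v (EuclideanSpace.single j 1)
    rw [hv] at this
    simpa using this.symm
  refine ⟨(LinearEquiv.ofInjectiveEndo A hinj).toContinuousLinearEquiv, fun i => ?_, hB⟩
  change A _ = _
  simp [hA]

/-- Second derivatives after an affine change of coordinates. -/
theorem fderiv_fderiv_comp_affine {s : CSpace n → ℂ} {U : Set (CSpace n)} (hU : IsOpen U)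
    (hs : DifferentiableOn ℂ s U) (k : ℂ) (L : CSpace n ≃L[ℂ] CSpace n) {z₀ : CSpace n}
    (hz₀ : z₀ ∈ U) :
    (fderiv ℂ s z₀ = 0 → fderiv ℂ (fun z => k * s (L z + z₀)) 0 = 0) ∧
      ∀ v w, fderiv ℂ (fderiv ℂ (fun z => k * s (L z + z₀))) 0 v w =
        k * fderiv ℂ (fderiv ℂ s) z₀ (L v) (L w) := by
  have hL : ∀ z, HasFDerivAt (fun z => L z + z₀) (L : CSpace n →L[ℂ] CSpace n) z := fun z =>
    L.hasFDerivAt.add_const z₀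
  have h1 : ∀ z, L z + z₀ ∈ U → fderiv ℂ (fun z => k * s (L z + z₀)) z =
      k • (fderiv ℂ s (L z + z₀)).comp (L : CSpace n →L[ℂ] CSpace n) := fun z hz =>
    ((((hs _ hz).differentiableAt (hU.mem_nhds hz)).hasFDerivAt.comp z (hL z)).const_mul k).fderiv
  have h0 : L 0 + z₀ = z₀ := by simp
  refine ⟨fun hs0 => ?_, fun v w => ?_⟩
  · rw [h1 0 (by rwa [h0]), h0, hs0]
    ext v
    simp
  have hev : fderiv ℂ (fun z => k * s (L z + z₀)) =ᶠ[𝓝 0] fun z =>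
      k • (fderiv ℂ s (L z + z₀)).comp (L : CSpace n →L[ℂ] CSpace n) := by
    have : ∀ᶠ z in 𝓝 (0 : CSpace n), L z + z₀ ∈ U :=
      (hL 0).continuousAt.eventually_mem (by rw [h0]; exact hU.mem_nhds hz₀)
    filter_upwards [this] with z hz using h1 z hz
  have hd : DifferentiableAt ℂ (fderiv ℂ s) (L 0 + z₀) := by
    rw [h0]
    have h2 := ((hs.analyticOnNhd_of_isOpen hU) z₀ hz₀).fderiv
    exact h2.differentiableAt
  have h3 := hd.hasFDerivAt.comp (0 : CSpace n) (hL 0)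
  have h4 : HasFDerivAt (fun z => k • (fderiv ℂ s (L z + z₀)).comp (L : CSpace n →L[ℂ] CSpace n))
      _ 0 := (h3.clm_comp (hasFDerivAt_const (L : CSpace n →L[ℂ] CSpace n) _)).const_smul k
  rw [hev.fderiv_eq, h4.fderiv, h0]
  simp

variable {X : Type*} [TopologicalSpace X] [ChartedSpace (CSpace n) X]
variable {h : HermitianMetric n X} {S : X → ℂ} {θ : ℝ} {p : X}

theorem differentiableOn_comp_chart_symm {c : OpenPartialHomeomorph X (CSpace n)}
    (hc : c ∈ holoCharts n X) (hS : MDifferentiable 𝓘(ℂ, CSpace n) 𝓘(ℂ, ℂ) S) :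
    DifferentiableOn ℂ (S ∘ c.symm) c.target := fun z hz =>
  (((hS (c.symm z)).comp z
    (hasMFDerivAt_chart_symm hc hz).mdifferentiableAt).differentiableAt).differentiableWithinAt

theorem fderiv_comp_chart_symm {c : OpenPartialHomeomorph X (CSpace n)}
    (hc : c ∈ holoCharts n X) (hS : MDifferentiable 𝓘(ℂ, CSpace n) 𝓘(ℂ, ℂ) S)
    (hp : p ∈ c.source) (hcrit : mfderiv 𝓘(ℂ, CSpace n) 𝓘(ℂ, ℂ) S p = 0) :
    fderiv ℂ (S ∘ c.symm) (c p) = 0 := by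
  have h1 : HasMFDerivAt 𝓘(ℂ, CSpace n) 𝓘(ℂ, ℂ) S (c.symm (c p)) (0 : CSpace n →L[ℂ] ℂ) := by
    rw [c.left_inv hp]
    have := (hS p).hasMFDerivAt
    rw [hcrit] at this
    exact this
  have h2 : HasFDerivAt (S ∘ c.symm) ((0 : CSpace n →L[ℂ] ℂ).comp (chartDeriv c (c p))) (c p) :=
    (HasMFDerivAt.comp (c p) h1 (hasMFDerivAt_chart_symm hc (c.map_source hp))).hasFDerivAt
  rw [h2.fderiv, ContinuousLinearMap.zero_comp]

/-- Coordinates at a nondegenerate critical point that diagonalize the Hessian of the rotated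
action and make the metric real. -/
theorem exists_adapted_linear_coordinates [IsManifold 𝓘(ℂ, CSpace n) ω X]
    (h : HermitianMetric n X) (hS : MDifferentiable 𝓘(ℂ, CSpace n) 𝓘(ℂ, ℂ) S) (θ : ℝ)
    (hp : IsNondegCritPt n S p) :
    ∃ L : CSpace n ≃L[ℂ] CSpace n,
      (∀ v w, Complex.exp (-(Complex.I * (θ : ℂ))) *
        fderiv ℂ (fderiv ℂ (S ∘ (chartAt (CSpace n) p).symm)) (chartAt (CSpace n) p p)
          (L v) (L w) = ∑ j, v j * w j) ∧
      ∀ i j, (h.bilin p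
        (chartDeriv (chartAt (CSpace n) p) (chartAt (CSpace n) p p)
          (L (EuclideanSpace.single i 1)))
        (chartDeriv (chartAt (CSpace n) p) (chartAt (CSpace n) p p)
          (L (EuclideanSpace.single j 1)))).im = 0 := by
  set c := chartAt (CSpace n) p with hc
  have hcm : c ∈ holoCharts n X := IsManifold.chart_mem_maximalAtlas p
  have hz₀ : c p ∈ c.target := mem_chart_target _ p
  set k := Complex.exp (-(Complex.I * (θ : ℂ))) with hk
  have hk0 : k ≠ 0 := Complex.exp_ne_zero _
  let D := fderiv ℂ (fderiv ℂ (S ∘ c.symm)) (c p)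
  have hsymm : ∀ v w, D v w = D w v := by
    have h1 : ContDiffAt ℂ ω (S ∘ c.symm) (c p) :=
      ((differentiableOn_comp_chart_symm hcm hS).analyticOnNhd_of_isOpen c.open_target
        (c p) hz₀).contDiffAt
    exact h1.isSymmSndFDerivAt (by simp)
  -- The factor `k = e^{-iθ}` makes this the Hessian of `S_θ`; being nonzero, it preserves
  -- nondegeneracy.
  let B : CSpace n →ₗ[ℂ] CSpace n →ₗ[ℂ] ℂ := LinearMap.mk₂ ℂ (fun v w => k * D v w)
    (fun v v' w => by simp [mul_add]) (fun a v w => by simp; ring)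
    (fun v w w' => by simp [mul_add]) (fun a v w => by simp; ring)
  let E : CSpace n →ₗ[ℂ] CSpace n := (chartDeriv c (c p)).toLinearMap
  have hE : ∀ v, v ≠ 0 → E v ≠ 0 := fun v hv hv' =>
    hv (chartDeriv_injective hcm hz₀ (hv'.trans (map_zero E).symm))
  let H : CSpace n →ₗ[ℂ] CSpace n →ₗ⋆[ℂ] ℂ := LinearMap.mk₂'ₛₗ (RingHom.id ℂ) (starRingEnd ℂ)
    (fun v w => h.bilin p (E v) (E w)) (fun v v' w => by simp) (fun a v w => by simp)
    (fun v w w' => by simp) (fun a v w => by simp [map_smulₛₗ])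
  have hH : ∀ v w, H v w = h.bilin p (E v) (E w) := fun v w => rfl
  obtain ⟨b, hb1, hb2⟩ := exists_takagi_family_of_form (n := n) (by simp) B
    (fun v w => by simp [B, hsymm v w])
    (fun v hv => hp.2 v fun w => (mul_eq_zero.1 (hv w)).resolve_left hk0)
    H (fun v w => h.bilin_conj_symm p _ _) (fun v hv => h.bilin_pos p (hE v hv))
  obtain ⟨L, hL1, hL2⟩ := exists_continuousLinearEquiv_of_orthonormal B hb1
  refine ⟨L, hL2, fun i j => ?_⟩
  rw [hL1, hL1]
  exact hb2 i j

/-- Adapted Morse charts exist. -/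
theorem exists_adapted_morse_chart [IsManifold 𝓘(ℂ, CSpace n) ω X]
    (h : HermitianMetric n X) (hS : MDifferentiable 𝓘(ℂ, CSpace n) 𝓘(ℂ, ℂ) S) (θ : ℝ)
    (hp : IsNondegCritPt n S p) :
    ∃ e : OpenPartialHomeomorph X (CSpace n), IsMorseChart S θ p e ∧ h.IsRealAtCenter e := by
  obtain ⟨L, hL1, hL2⟩ := exists_adapted_linear_coordinates h hS θ hp
  set c := chartAt (CSpace n) p with hc
  have hcm : c ∈ holoCharts n X := IsManifold.chart_mem_maximalAtlas p
  have hps : p ∈ c.source := mem_chart_source _ p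
  have hz₀ : c p ∈ c.target := mem_chart_target _ p
  set k := Complex.exp (-(Complex.I * (θ : ℂ))) with hk
  have hd := differentiableOn_comp_chart_symm hcm hS
  obtain ⟨hf1, hf2⟩ := fderiv_fderiv_comp_affine c.open_target hd k L hz₀
  have hUo : IsOpen {z | L z + c p ∈ c.target} :=
    c.open_target.preimage (L.continuous.add continuous_const)
  have hfd : DifferentiableOn ℂ (fun z => k * (S ∘ c.symm) (L z + c p))
      {z | L z + c p ∈ c.target} :=
    (hd.comp ((L.differentiable.add_const (c p)).differentiableOn) fun z hz => hz).const_mul k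
  obtain ⟨φ, hφ0, -, hφ00, hφ1, hφ2, hφd, hφ⟩ := exists_morse_chart hUo (by simpa using hz₀)
    hfd
    (hf1 (fderiv_comp_chart_symm hcm hS hps hp.1)) fun v w => (hf2 v w).trans (hL1 v w)
  -- The adapted chart is a composite: the preferred chart `c`, the affine map `τ` centering it and
  -- normalizing Hessian and metric, and the Morse chart `φ`.
  let τ : OpenPartialHomeomorph (CSpace n) (CSpace n) :=
    ((Homeomorph.subRight (c p)).trans L.symm.toHomeomorph).toOpenPartialHomeomorph
  have hτ : ∀ w, τ w = L.symm (w - c p) := fun w => rfl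
  have hτs : ∀ w, τ.symm w = L w + c p := fun w => rfl
  have he₁ : c ≫ₕ τ ∈ holoCharts n X := trans_mem_holoCharts hcm
    (L.symm.contDiff.comp (contDiff_id.sub contDiff_const)).contDiffOn
    (L.contDiff.add contDiff_const).contDiffOn
  have he : (c ≫ₕ τ) ≫ₕ φ ∈ holoCharts n X := trans_mem_holoCharts he₁ hφ1 hφ2
  have hφs0 : φ.symm 0 = 0 := by
    have := φ.left_inv hφ0
    rwa [hφ00] at this
  have hφt : (0 : CSpace n) ∈ φ.target := by
    have := φ.map_source hφ0
    rwa [hφ00] at this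
  have h1t : (0 : CSpace n) ∈ (c ≫ₕ τ).target := by
    simp [τ, hz₀]
  have hsymm0 : ((c ≫ₕ τ) ≫ₕ φ).symm 0 = p := by
    change c.symm (τ.symm (φ.symm 0)) = p
    rw [hφs0, hτs, map_zero, zero_add, c.left_inv hps]
  refine ⟨(c ≫ₕ τ) ≫ₕ φ, ⟨he, ?_, ?_, fun q hq => ?_⟩, fun i j => ?_⟩
  · simp [τ, hps, hφ0]
  · change φ (L.symm (c p - c p)) = 0
    rw [sub_self, map_zero, hφ00]
  · rw [OpenPartialHomeomorph.trans_source, OpenPartialHomeomorph.trans_source] at hq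
    have h1 := hφ _ hq.2
    have h2 : L ((c ≫ₕ τ) q) + c p = c q := by
      change L (L.symm (c q - c p)) + c p = c q
      simp
    simp only [Function.comp_apply, h2, map_zero, zero_add] at h1
    rw [c.left_inv hq.1.1, c.left_inv hps] at h1
    exact h1
  · have hφd' : HasFDerivAt φ.symm (ContinuousLinearMap.id ℂ (CSpace n)) 0 :=
      φ.hasFDerivAt_symm (f' := ContinuousLinearEquiv.refl ℂ (CSpace n)) hφt
        (by rw [hφs0]; exact hφd)
    have hτd : HasFDerivAt τ.symm (L : CSpace n →L[ℂ] CSpace n) 0 :=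
      L.hasFDerivAt.add_const (c p)
    have hz : τ.symm 0 = c p := by rw [hτs, map_zero, zero_add]
    -- As `Dφ(0)` is the identity, the metric at `p` remains as `L` has made it.
    have hD : ∀ v, chartDeriv ((c ≫ₕ τ) ≫ₕ φ) 0 v = chartDeriv c (c p) (L v) := by
      intro v
      rw [chartDeriv_trans he₁ (by rwa [hφs0]) hφd', hφs0,
        chartDeriv_trans hcm (by rwa [hz]) hτd, hz]
      rfl
    rw [HermitianMetric.coeff_eq, hD, hD, hsymm0]
    exact hL2 i j

end Existence

theorem mainTheorem10 {n : ℕ} {X : Type*} [TopologicalSpace X] [T2Space X]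
    [ChartedSpace (CSpace n) X] [IsManifold 𝓘(ℂ, CSpace n) ω X]
    (h : HermitianMetric n X) (S : X → ℂ) (hS : MDifferentiable 𝓘(ℂ, CSpace n) 𝓘(ℂ, ℂ) S)
    (θ : ℝ) (p : X) (hp : IsNondegCritPt n S p) :
    (∃ e : OpenPartialHomeomorph X (CSpace n), IsMorseChart S θ p e ∧ h.IsRealAtCenter e) ∧
    ∀ e : OpenPartialHomeomorph X (CSpace n), IsMorseChart S θ p e → h.IsRealAtCenter e →
      ∃ ε₀ : ℝ, 0 < ε₀ ∧ coordBall n ε₀ ⊆ e.target ∧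
      ∃ ψs ψu : RSpace n → RSpace n,
        ContDiffOn ℝ ∞ ψs (Metric.ball 0 ε₀) ∧ ψs 0 = 0 ∧
        HasFDerivAt ψs (0 : RSpace n →L[ℝ] RSpace n) 0 ∧
        ContDiffOn ℝ ∞ ψu (Metric.ball 0 ε₀) ∧ ψu 0 = 0 ∧
        HasFDerivAt ψu (0 : RSpace n →L[ℝ] RSpace n) 0 ∧
        ∀ ε : ℝ, 0 < ε → ε ≤ ε₀ →
          -- the local (un)stable manifolds are graphs, and are the germs of the global ones
          localStableSet h S θ p (e.symm '' coordBall n ε) = stableDisk e ψs ε ∧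
          localUnstableSet h S θ p (e.symm '' coordBall n ε) = unstableDisk e ψu ε ∧
          stableSet h S θ p ∩ e.symm '' coordBall n ε = stableDisk e ψs ε ∧
          unstableSet h S θ p ∩ e.symm '' coordBall n ε = unstableDisk e ψu ε ∧
          -- they are middle-dimensional real submanifolds
          IsRealSubmanifold n n (stableDisk e ψs ε) ∧
          IsRealSubmanifold n n (unstableDisk e ψu ε) ∧
          -- with tangent spaces `ℝⁿ` and `iℝⁿ`
          coordTangent e (stableDisk e ψs ε) p = {w : CSpace n | ∀ j, (w j).im = 0} ∧
          coordTangent e (unstableDisk e ψu ε) p = {w : CSpace n | ∀ j, (w j).re = 0} ∧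
          -- contained in the level set of `G_θ`
          (∀ q ∈ stableDisk e ψs ε, actionIm S θ q = actionIm S θ p) ∧
          (∀ q ∈ unstableDisk e ψu ε, actionIm S θ q = actionIm S θ p) := by
  refine ⟨exists_adapted_morse_chart h hS θ hp, fun e hM hr => ?_⟩
  obtain ⟨εs, hεs, hsubs, ψs, hs1, hs2, hs3, hs⟩ := exists_stable_submanifold hS hM hr
  obtain ⟨εu, hεu, -, ψu, hu1, hu2, hu3, hu⟩ := exists_unstable_submanifold hS hM hr
  refine ⟨min εs εu, lt_min hεs hεu, fun w hw => hsubs (mem_coordBall_iff.2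
    ((mem_coordBall_iff.1 hw).trans_le (min_le_left _ _))), ψs, ψu,
    hs1.mono (Metric.ball_subset_ball (min_le_left _ _)), hs2, hs3,
    hu1.mono (Metric.ball_subset_ball (min_le_right _ _)), hu2, hu3, fun ε hε hεε => ?_⟩
  obtain ⟨a1, a2, a3, a4, a5⟩ := hs ε hε (hεε.trans (min_le_left _ _))
  obtain ⟨b1, b2, b3, b4, b5⟩ := hu ε hε (hεε.trans (min_le_right _ _))
  exact ⟨a1, b1, a2, b2, a3, b3, a4, b4, a5, b5⟩
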